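/- **Setting.** Let $D\in\mathbb N$, $L\ge 0$, $M\in\mathbb R$, $a>0$, $0<b\le D-1$, $T>0$, $\sigma>0$. Let $\operatorname{Lip}(L,M)$ be the set of $L$-Lipschitz $f:\mathbb R^D\to\mathbb R^D$ with $\|f(x)\|\le M$ for all $x$, and let $\phi(x,t)$, $t\ge 0$, be the value at time $t$ of the unique global solution of $y'=f(y)$, $y(0)=x$. Let $\mathcal P(a,b)$ be the set of probability measures $\mu$ on $\mathbb R^D$ such that $\mu(B_2(x,R))\ge\min(aR^b,1)$ for all $x\in\operatorname{supp}(\mu)$ and $R>0$. For $\mathcal X=\operatorname{supp}(\mu)$ let $\operatorname{Env}_f(\mathcal X,T)=\{\phi(x,t): x\in\mathcal X,\ t\in[0,T]\}$. One observes $X_1,\dots,X_n$, sampled independently from $\mu$, and $$Y_{i,j}=\phi(X_i,t_j)+\sigma\varepsilon_{i,j},\qquad t_j=jT/m,\quad 1\le i\le n,\ 1\le j\le m,$$ where the $\varepsilon_{i,j}$ are independent standard $D$-variate Gaussian vectors, independent of $(X_1,\dots,X_n)$. **Estimator.** Given positive integers $k_1,k_2,k,r$ (ties in all nearest-neighbour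 and argmin selections are broken by the smallest index): 1. $\hat\phi(z,t)=\frac1{k_1k_2}\sum_{p}\sum_{q}Y_{p,q}$, where $p$ runs over the indices of the $k_1$ nearest neighbours of $z$ among $X_1,\dots,X_{\lfloor n/2\rfloor}$, and $q$ over the indices of the $k_2$ nearest neighbours of $t$ among $t_1,\dots,t_m$. 2. $\hat g_{i,j}=\sum_{l=1}^{k}w_l\,\frac{Y_{i,j+l}-Y_{i,j-l}}{t_{j+l}-t_{j-l}}$ with $w_l=\frac{6l^2}{k(k+1)(2k+1)}$, for $\lfloor n/2\rfloor<i\le n$ and $k+1\le j\le m-k-1$. 3. For $x\in\mathbb R^D$, let $i_1(x),\dots,i_r(x)$ be the $r$ indices $i\in\{\lfloor n/2\rfloor+1,\dots,n\}$ with the smallest values of $\min_{k+1\le j\le m-k-1}\|\hat\phi(X_i,t_j)-x\|$, selected successively; let $j_l(x)$ be a minimizer of $\|\hat\phi(X_{i_l(x)},t_j)-x\|$ over $k+1\le j\le m-k-1$; and put $\hat f(x)=\frac1r\sum_{l=1}^r\hat g_{i_l(x),j_l(x)}$. **Theorem.** Suppose that $$k_1\simeq\max\left(\frac{(n/\ln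 n)^{3/(b+3)}}{(m/\ln(nm))^{b/(b+3)}},1\right),\qquad k_2\simeq\max\left(\frac{m^{(b+2)/(b+3)}}{(n/(\ln n\,\ln(nm)))^{1/(b+3)}},1\right),$$ $$k\simeq\max\left(m^{\frac{b+4}{b+5}}\Big(\tfrac{\ln(nm)\ln n}{n}\Big)^{\frac1{b+5}},1\right),\qquad r\simeq\max\left(\Big(\tfrac{n}{\ln n}\Big)^{\frac5{b+5}}\Big(\tfrac{\ln(mn)}{m}\Big)^{\frac b{b+5}},1\right),$$ where $u\simeq v$ means $c\,v\le u\le c'\,v$ for fixed constants $c>0$ and $c'$. Then, for all $n$ and $m$ sufficiently large (each at least some $N$), $$\sup_{f\in\operatorname{Lip}(L,M),\ \mu\in\mathcal P(a,b)}\ \mathbb E\left[\sup_{x\in\operatorname{Env}_f(\mathcal X,T)}\|\hat f(x)-f(x)\|\right]\le C\max\left(\Big(\frac{\ln^2(nm)}{nm}\Big)^{\frac1{5+b}},\Big(\frac{\ln n}{n}\Big)^{\frac1b},\frac1m\right),$$ where $C$ and $N$ depend only on $L,M,a,b,D,T,\sigma$ (and on the constants $c,c'$ in $\simeq$). -/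

import Mathlib

open MeasureTheory ProbabilityTheory
open scoped NNReal ENNReal

noncomputable section

namespace VFEst

/-! ### Vector fields, flow and envelope -/

/-- The Euclidean state space `ℝ^D`. -/
abbrev Space (D : ℕ) : Type := EuclideanSpace ℝ (Fin D)

/-- The class `Lip(L, M)` of `L`-Lipschitz vector fields on `ℝ^D` with norm bounded by `M`. -/
def LipClass (D : ℕ) (L : ℝ≥0) (M : ℝ) : Set (Space D → Space D) :=
  {f | LipschitzWith L f ∧ ∀ x, ‖f x‖ ≤ M}

/-- `y` solves `y' = f(y)` on `[0, ∞)` with `y(0) = x`. -/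
def IsSolution {D : ℕ} (f : Space D → Space D) (x : Space D) (y : ℝ → Space D) : Prop :=
  y 0 = x ∧ IsIntegralCurveOn y (fun _ => f) (Set.Ici 0)

/-- Two global solutions with the same initial value agree on `[0, ∞)`. -/
theorem IsSolution.eqOn {D : ℕ} {L : ℝ≥0} {M : ℝ} {f : Space D → Space D}
    (hf : f ∈ LipClass D L M) {x : Space D} {y z : ℝ → Space D}
    (hy : IsSolution f x y) (hz : IsSolution f x z) : Set.EqOn y z (Set.Ici 0) := by
  intro t ht
  have key : Set.EqOn y z (Set.Icc 0 t) := by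
    refine ODE_solution_unique (v := fun _ => f) (K := L) (fun _ => hf.1) ?_ ?_ ?_ ?_ ?_
    · exact fun s hs => ((hy.2 s hs.1).continuousWithinAt).mono Set.Icc_subset_Ici_self
    · exact fun s hs => (hy.2 s hs.1).mono (Set.Ici_subset_Ici.2 hs.1)
    · exact fun s hs => ((hz.2 s hs.1).continuousWithinAt).mono Set.Icc_subset_Ici_self
    · exact fun s hs => (hz.2 s hs.1).mono (Set.Ici_subset_Ici.2 hs.1)
    · rw [hy.1, hz.1]
  exact key ⟨ht, le_rfl⟩

/-- A bounded Lipschitz vector field has a global solution from every initial value. -/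
theorem exists_isSolution {D : ℕ} {L : ℝ≥0} {M : ℝ} {f : Space D → Space D}
    (hf : f ∈ LipClass D L M) (x : Space D) : ∃ y, IsSolution f x y := by
  have hM : 0 ≤ M := (norm_nonneg _).trans (hf.2 x)
  have loc : ∀ N : ℕ, ∃ α : ℝ → Space D, α 0 = x ∧
      ∀ t ∈ Set.Icc (0 : ℝ) N, HasDerivWithinAt α (f (α t)) (Set.Icc 0 (N : ℝ)) t := by
    intro N
    have hN : (0 : ℝ) ≤ N := Nat.cast_nonneg N
    have hp : IsPicardLindelof (fun _ => f)
        (⟨0, le_rfl, hN⟩ : Set.Icc (0 : ℝ) N) x (⟨M, hM⟩ * (N : ℝ≥0)) 0 ⟨M, hM⟩ L := by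
      refine IsPicardLindelof.of_time_independent (fun z _ => hf.2 z) hf.1.lipschitzOnWith ?_
      simp only [sub_zero, sub_self, max_eq_left hN, NNReal.coe_zero]
      exact le_of_eq rfl
    simpa using hp.exists_eq_forall_mem_Icc_hasDerivWithinAt₀
  choose α h0 hα using loc
  have agree : ∀ N K : ℕ, N ≤ K → Set.EqOn (α N) (α K) (Set.Icc 0 (N : ℝ)) := by
    intro N K hNK
    have hc : (N : ℝ) ≤ K := by exact_mod_cast hNK
    have right : ∀ (Q : ℕ) (hQ : (N : ℝ) ≤ Q), ∀ t ∈ Set.Ico (0 : ℝ) N,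
        HasDerivWithinAt (α Q) (f (α Q t)) (Set.Ici t) t := by
      intro Q hQ t ht
      refine (hα Q t ⟨ht.1, ht.2.le.trans hQ⟩).mono_of_mem_nhdsWithin ?_
      have : Set.Icc t (Q : ℝ) ∈ nhdsWithin t (Set.Ici t) :=
        Icc_mem_nhdsGE (ht.2.trans_le hQ)
      exact Filter.mem_of_superset this (Set.Icc_subset_Icc_left ht.1)
    have cont : ∀ (Q : ℕ) (hQ : (N : ℝ) ≤ Q), ContinuousOn (α Q) (Set.Icc 0 (N : ℝ)) :=
      fun Q hQ t ht => ((hα Q t ⟨ht.1, ht.2.trans hQ⟩).continuousWithinAt).mono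
        (Set.Icc_subset_Icc_right hQ)
    exact ODE_solution_unique (v := fun _ => f) (K := L) (fun _ => hf.1)
      (cont N le_rfl) (right N le_rfl) (cont K hc) (right K hc) (by rw [h0, h0])
  let y : ℝ → Space D := fun t => α ⌈t⌉₊ t
  have hy : ∀ N : ℕ, Set.EqOn y (α N) (Set.Icc 0 (N : ℝ)) := fun N t ht =>
    agree _ _ (Nat.ceil_le.2 ht.2) ⟨ht.1, Nat.le_ceil t⟩
  refine ⟨y, ?_, ?_⟩
  · rw [hy 0 (by simp), h0]
  · intro t ht
    obtain ⟨N, hN⟩ := exists_nat_gt t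
    have htN : t ∈ Set.Icc (0 : ℝ) N := ⟨ht, hN.le⟩
    have h1 : HasDerivWithinAt y (f (y t)) (Set.Icc 0 (N : ℝ)) t := by
      rw [hy N htN]
      exact (hα N t htN).congr (hy N) (hy N htN)
    refine h1.mono_of_mem_nhdsWithin ?_
    rw [← Set.Ici_inter_Iic]
    exact Filter.inter_mem self_mem_nhdsWithin (mem_nhdsWithin_of_mem_nhds (Iic_mem_nhds hN))

open Classical in
/-- The flow `φ(x, t) = y_x(t)`, `t ≥ 0`, where `y_x` is the global solution of `y' = f(y)`,
`y(0) = x` (which exists and is unique for `f ∈ Lip(L, M)`, see the two theorems above). -/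
def flow {D : ℕ} (f : Space D → Space D) (x : Space D) : ℝ → Space D :=
  if h : ∃ y, IsSolution f x y then h.choose else fun _ => x

theorem isSolution_flow {D : ℕ} {L : ℝ≥0} {M : ℝ} {f : Space D → Space D}
    (hf : f ∈ LipClass D L M) (x : Space D) : IsSolution f x (flow f x) := by
  have h := exists_isSolution hf x
  rw [flow, dif_pos h]
  exact h.choose_spec

/-- The envelope of solutions `{φ(x, t) | x ∈ S, t ∈ [0, T]}`. -/
def envelope {D : ℕ} (f : Space D → Space D) (S : Set (Space D)) (T : ℝ) : Set (Space D) :=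
  {z | ∃ x ∈ S, ∃ t ∈ Set.Icc 0 T, z = flow f x t}

/-! ### Standard measures -/

/-- The class `P(a, b)` of `(a, b)`-standard probability distributions on `ℝ^D`. -/
def StandardClass (D : ℕ) (a b : ℝ) : Set (Measure (Space D)) :=
  {μ | IsProbabilityMeasure μ ∧ ∀ x ∈ μ.support, ∀ R : ℝ, 0 < R →
    ENNReal.ofReal (min (a * R ^ b) 1) ≤ μ (Metric.closedBall x R)}

/-! ### Observations

Indices are those of the mathematics: trajectories `i = 1, …, n` and times `j = 1, …, m`.
Families are written as functions on `ℕ`; only these indices matter. -/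

/-- The regular grid `t_j = j T / m`. -/
def gridTime (T : ℝ) (m j : ℕ) : ℝ := j * T / m

/-- Random initial values `X_1, …, X_n` sampled independently from `μ`, and independent standard
`D`-variate Gaussian noise vectors `ε_{i,j}`, independent of the initial values. -/
structure IsSample {D : ℕ} {Ω : Type*} [MeasurableSpace Ω] (P : Measure Ω)
    (n m : ℕ) (μ : Measure (Space D))
    (X : ℕ → Ω → Space D) (ε : ℕ → ℕ → Ω → Space D) : Prop where
  measurable_X : ∀ i ∈ Finset.Icc 1 n, Measurable (X i)
  measurable_noise : ∀ i ∈ Finset.Icc 1 n, ∀ j ∈ Finset.Icc 1 m, Measurable (ε i j)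
  law_X : ∀ i ∈ Finset.Icc 1 n, P.map (X i) = μ
  law_noise : ∀ i ∈ Finset.Icc 1 n, ∀ j ∈ Finset.Icc 1 m, P.map (ε i j) = stdGaussian (Space D)
  indep_X : iIndepFun (fun i : Finset.Icc 1 n => X i) P
  indep_noise : iIndepFun (fun p : Finset.Icc 1 n × Finset.Icc 1 m => ε p.1 p.2) P
  indep_X_noise : IndepFun (fun ω (i : Finset.Icc 1 n) => X i ω)
    (fun ω (p : Finset.Icc 1 n × Finset.Icc 1 m) => ε p.1 p.2 ω) P

/-- The noisy trajectories `Y_{i,j} = φ(X_i, t_j) + σ ε_{i,j}` (for a given outcome). -/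
def observation {D : ℕ} (f : Space D → Space D) (T σ : ℝ) (m : ℕ)
    (X : ℕ → Space D) (ε : ℕ → ℕ → Space D) (i j : ℕ) : Space D :=
  flow f (X i) (gridTime T m j) + σ • ε i j

/-! ### Nearest neighbours -/

/-- The minimizer of `d` over the finite index set `s`; ties are broken by the smallest index. -/
def argminIdx (s : Finset ℕ) (d : ℕ → ℝ) : ℕ :=
  sInf {i | i ∈ s ∧ ∀ i' ∈ s, d i ≤ d i'}

/-- The `k` indices of `s` with the smallest values of `d`, selected one after the other:
the next one minimizes `d` over the indices of `s` that are not yet selected. -/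
def nearest (s : Finset ℕ) (d : ℕ → ℝ) : ℕ → Finset ℕ
  | 0 => ∅
  | k + 1 => insert (argminIdx (s \ nearest s d k) d) (nearest s d k)

/-! ### The estimator

It is a function of the data `X`, `Y` and of the calibration parameters `k₁, k₂, k, r`. -/

/-- Step 1: the estimator `φ̂(z, t)` of the flow, which averages the observations over the `k₁`
nearest neighbours of `z` among `X_1, …, X_{⌊n/2⌋}` and the `k₂` nearest grid times of `t`. -/
def flowEst {D : ℕ} (T : ℝ) (n m k₁ k₂ : ℕ) (X : ℕ → Space D) (Y : ℕ → ℕ → Space D)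
    (z : Space D) (t : ℝ) : Space D :=
  (1 / ((k₁ : ℝ) * k₂)) •
    ∑ p ∈ nearest (Finset.Icc 1 (n / 2)) (fun i => ‖X i - z‖) k₁,
      ∑ q ∈ nearest (Finset.Icc 1 m) (fun j => |gridTime T m j - t|) k₂, Y p q

/-- The weights `w_l = 6 l² / (k (k + 1) (2 k + 1))`. -/
def weight (k l : ℕ) : ℝ := 6 * (l : ℝ) ^ 2 / ((k : ℝ) * (k + 1) * (2 * k + 1))

/-- Step 2: the estimator of `f(φ(X_i, t_j))` by weighted symmetric differences. -/
def derivEst {D : ℕ} (T : ℝ) (m k : ℕ) (Y : ℕ → ℕ → Space D) (i j : ℕ) : Space D :=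
  ∑ l ∈ Finset.Icc 1 k,
    (weight k l / (gridTime T m (j + l) - gridTime T m (j - l))) • (Y i (j + l) - Y i (j - l))

/-- The index `j ∈ {k+1, …, m-k-1}` for which `φ̂(X_i, t_j)` is closest to `x`. -/
def timeIdx {D : ℕ} (T : ℝ) (n m k₁ k₂ k : ℕ) (X : ℕ → Space D) (Y : ℕ → ℕ → Space D)
    (x : Space D) (i : ℕ) : ℕ :=
  argminIdx (Finset.Icc (k + 1) (m - k - 1))
    (fun j => ‖flowEst T n m k₁ k₂ X Y (X i) (gridTime T m j) - x‖)

/-- The distance `min_{k+1 ≤ j ≤ m-k-1} ‖φ̂(X_i, t_j) - x‖` from `x` to the `i`-th estimated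
trajectory. -/
def trajDist {D : ℕ} (T : ℝ) (n m k₁ k₂ k : ℕ) (X : ℕ → Space D) (Y : ℕ → ℕ → Space D)
    (x : Space D) (i : ℕ) : ℝ :=
  ‖flowEst T n m k₁ k₂ X Y (X i) (gridTime T m (timeIdx T n m k₁ k₂ k X Y x i)) - x‖

/-- Step 3: the estimator `f̂(x)`, which averages the estimated derivatives along the `r`
trajectories from `X_{⌊n/2⌋+1}, …, X_n` whose estimates pass closest to `x`. -/
def fieldEst {D : ℕ} (T : ℝ) (n m k₁ k₂ k r : ℕ) (X : ℕ → Space D) (Y : ℕ → ℕ → Space D)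
    (x : Space D) : Space D :=
  (1 / (r : ℝ)) •
    ∑ i ∈ nearest (Finset.Icc (n / 2 + 1) n) (trajDist T n m k₁ k₂ k X Y x) r,
      derivEst T m k Y i (timeIdx T n m k₁ k₂ k X Y x i)

/-! ### Risk and calibration -/

/-- The expectation of a nonnegative function through its measurable majorants. It equals
`∫⁻ ω, h ω ∂P` for measurable `h`, and is at least this integral for every `h`. -/
def upperExpectation {Ω : Type*} [MeasurableSpace Ω] (P : Measure Ω) (h : Ω → ℝ≥0∞) : ℝ≥0∞ :=
  ⨅ (g : Ω → ℝ≥0∞) (_ : Measurable g) (_ : ∀ ω, h ω ≤ g ω), ∫⁻ ω, g ω ∂P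

theorem upperExpectation_eq_lintegral {Ω : Type*} [MeasurableSpace Ω] (P : Measure Ω)
    {h : Ω → ℝ≥0∞} (hh : Measurable h) : upperExpectation P h = ∫⁻ ω, h ω ∂P :=
  le_antisymm (iInf_le_of_le h (iInf_le_of_le hh (iInf_le_of_le (fun _ => le_rfl) le_rfl)))
    (le_iInf fun _ => le_iInf fun _ => le_iInf fun hg => lintegral_mono hg)

/-- The sup-norm error `sup_{x ∈ Env_f(S, T)} ‖g(x) - f(x)‖` of an estimate `g` of `f`. -/
def supError {D : ℕ} (f g : Space D → Space D) (S : Set (Space D)) (T : ℝ) : ℝ≥0∞ :=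
  ⨆ x ∈ envelope f S T, ‖g x - f x‖ₑ

/-- `k ≃ v` with constants `c`, `c'`: `c v ≤ k ≤ c' v`. -/
def IsOfOrder (c c' : ℝ) (k : ℕ) (v : ℝ) : Prop := c * v ≤ k ∧ k ≤ c' * v

/-- The order of magnitude of `k₁`. -/
def k₁Order (b n m : ℝ) : ℝ :=
  max ((n / Real.log n) ^ (3 / (b + 3)) / (m / Real.log (n * m)) ^ (b / (b + 3))) 1

/-- The order of magnitude of `k₂`. -/
def k₂Order (b n m : ℝ) : ℝ :=
  max (m ^ ((b + 2) / (b + 3)) / (n / (Real.log n * Real.log (n * m))) ^ (1 / (b + 3))) 1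

/-- The order of magnitude of `k`. -/
def kOrder (b n m : ℝ) : ℝ :=
  max (m ^ ((b + 4) / (b + 5)) * ((Real.log (n * m) * Real.log n) / n) ^ (1 / (b + 5))) 1

/-- The order of magnitude of `r`. -/
def rOrder (b n m : ℝ) : ℝ :=
  max ((n / Real.log n) ^ (5 / (b + 5)) * (Real.log (m * n) / m) ^ (b / (b + 5))) 1

/-- The rate of convergence in sup norm. -/
def supRate (b n m : ℝ) : ℝ :=
  max (max ((Real.log (n * m) ^ 2 / (n * m)) ^ (1 / (5 + b))) ((Real.log n / n) ^ (1 / b))) (1 / m)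

end VFEst

end

open VFEst

namespace VFEst

/-! ### Regularity of the flow in time and in the initial value. -/

section Flow

variable {D : ℕ} {L : ℝ≥0} {M : ℝ} {f : Space D → Space D}

theorem flow_zero (hf : f ∈ LipClass D L M) (x : Space D) : flow f x 0 = x :=
  (isSolution_flow hf x).1

theorem hasDerivWithinAt_flow (hf : f ∈ LipClass D L M) (x : Space D) {t : ℝ} (ht : 0 ≤ t) :
    HasDerivWithinAt (flow f x) (f (flow f x t)) (Set.Ici 0) t :=
  (isSolution_flow hf x).2 t ht

theorem LipClass.nonneg (hf : f ∈ LipClass D L M) : 0 ≤ M := (norm_nonneg _).trans (hf.2 0)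

theorem norm_flow_sub_flow_le (hf : f ∈ LipClass D L M) (x : Space D) {s t : ℝ} (hs : 0 ≤ s)
    (ht : 0 ≤ t) : ‖flow f x t - flow f x s‖ ≤ M * |t - s| := by
  have := Convex.norm_image_sub_le_of_norm_hasDerivWithin_le
    (fun u (hu : u ∈ Set.Ici (0 : ℝ)) => hasDerivWithinAt_flow hf x hu)
    (fun u _ => hf.2 _) (convex_Ici 0) (Set.mem_Ici.2 hs) (Set.mem_Ici.2 ht)
  simpa [Real.norm_eq_abs] using this

theorem norm_flow_sub_flow_le_exp (hf : f ∈ LipClass D L M) (x y : Space D) {t : ℝ} (ht : 0 ≤ t) :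
    ‖flow f x t - flow f y t‖ ≤ Real.exp (L * t) * ‖x - y‖ := by
  have cont : ∀ z, ContinuousOn (flow f z) (Set.Icc 0 t) := fun z s hs =>
    ((hasDerivWithinAt_flow hf z hs.1).continuousWithinAt).mono Set.Icc_subset_Ici_self
  have der : ∀ z, ∀ s ∈ Set.Ico (0 : ℝ) t,
      HasDerivWithinAt (flow f z) (f (flow f z s)) (Set.Ici s) s := fun z s hs =>
    (hasDerivWithinAt_flow hf z hs.1).mono (Set.Ici_subset_Ici.2 hs.1)
  have := dist_le_of_trajectories_ODE (v := fun _ => f) (K := L) (fun _ => hf.1) (cont x) (der x)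
    (cont y) (der y) (δ := ‖x - y‖) (by rw [flow_zero hf, flow_zero hf, dist_eq_norm]) t ⟨ht, le_rfl⟩
  rw [dist_eq_norm, sub_zero] at this
  linarith

theorem norm_flow_sub_flow_le_exp_of_le (hf : f ∈ LipClass D L M) (x y : Space D) {t T : ℝ}
    (ht : 0 ≤ t) (hT : t ≤ T) :
    ‖flow f x t - flow f y t‖ ≤ Real.exp (L * T) * ‖x - y‖ := by
  refine (norm_flow_sub_flow_le_exp hf x y ht).trans ?_
  gcongr

theorem continuous_flow (hf : f ∈ LipClass D L M) {t : ℝ} (ht : 0 ≤ t) :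
    Continuous (fun x => flow f x t) := by
  have : LipschitzWith (Real.exp (L * t)).toNNReal (fun x => flow f x t) := by
    refine LipschitzWith.of_dist_le_mul fun x y => ?_
    rw [dist_eq_norm, dist_eq_norm, Real.coe_toNNReal _ (Real.exp_pos _).le]
    exact norm_flow_sub_flow_le_exp hf x y ht
  exact this.continuous

/-- Subtracting the linear motion with velocity `f (flow f x t)` leaves a curve whose derivative is
at most `L M h` on the window, because the flow moves by at most `M h` there. The mean value
inequality over length `2 h` gives the bound. No derivative of `f` is needed. -/
theorem norm_flow_symm_diff_le (hf : f ∈ LipClass D L M) (x : Space D) {t h : ℝ} (h0 : 0 ≤ h)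
    (ht : h ≤ t) :
    ‖(flow f x (t + h) - flow f x (t - h)) - (2 * h) • f (flow f x t)‖ ≤ L * M * h * (2 * h) := by
  set g : ℝ → Space D := fun s => flow f x s - s • f (flow f x t) with hg
  have hM := LipClass.nonneg hf
  have hd : ∀ s ∈ Set.Icc (t - h) (t + h),
      HasDerivWithinAt g (f (flow f x s) - f (flow f x t)) (Set.Icc (t - h) (t + h)) s := by
    intro s hs
    have hsub : Set.Icc (t - h) (t + h) ⊆ Set.Ici 0 := fun u hu => by
      have := hu.1
      simp only [Set.mem_Ici]; linarith
    have h1 := (hasDerivWithinAt_flow hf x (hsub hs)).mono hsub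
    have h2 : HasDerivWithinAt (fun s : ℝ => s • f (flow f x t)) ((1 : ℝ) • f (flow f x t))
      (Set.Icc (t - h) (t + h)) s := (hasDerivWithinAt_id s _).smul_const _
    rw [one_smul] at h2
    exact h1.sub h2
  have hb : ∀ s ∈ Set.Icc (t - h) (t + h), ‖f (flow f x s) - f (flow f x t)‖ ≤ L * M * h := by
    intro s hs
    have h1 := hf.1.dist_le_mul (flow f x s) (flow f x t)
    rw [dist_eq_norm, dist_eq_norm] at h1
    have h2 := norm_flow_sub_flow_le hf x (s := t) (t := s) (by linarith) (by linarith [hs.1])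
    have h3 : |s - t| ≤ h := abs_le.2 ⟨by linarith [hs.1], by linarith [hs.2]⟩
    calc _ ≤ L * ‖flow f x s - flow f x t‖ := h1
      _ ≤ L * (M * h) := by gcongr; exact h2.trans (by gcongr)
      _ = _ := by ring
  have := Convex.norm_image_sub_le_of_norm_hasDerivWithin_le hd hb (convex_Icc _ _)
    (x := t - h) (y := t + h) ⟨le_rfl, by linarith⟩ ⟨by linarith, le_rfl⟩
  have e1 : g (t + h) - g (t - h)
      = (flow f x (t + h) - flow f x (t - h)) - (2 * h) • f (flow f x t) := by
    simp only [hg]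
    rw [show (2 * h) = (t + h) - (t - h) by ring]
    module
  rw [e1, show t + h - (t - h) = 2 * h by ring, Real.norm_eq_abs,
    abs_of_nonneg (by linarith)] at this
  exact this

end Flow

/-! ### Selection of minimizers and nearest neighbours. -/

section Nearest

theorem argminIdx_mem {s : Finset ℕ} (hs : s.Nonempty) (d : ℕ → ℝ) : argminIdx s d ∈ s := by
  obtain ⟨i, hi, h⟩ := s.exists_min_image d hs
  exact (Nat.sInf_mem (s := {i | i ∈ s ∧ ∀ i' ∈ s, d i ≤ d i'}) ⟨i, hi, h⟩).1

theorem argminIdx_le {s : Finset ℕ} (d : ℕ → ℝ) {i : ℕ} (hi : i ∈ s) :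
    d (argminIdx s d) ≤ d i := by
  obtain ⟨i', hi', h⟩ := s.exists_min_image d ⟨i, hi⟩
  exact (Nat.sInf_mem (s := {i | i ∈ s ∧ ∀ i' ∈ s, d i ≤ d i'}) ⟨i', hi', h⟩).2 i hi

theorem argminIdx_congr {s : Finset ℕ} {d d' : ℕ → ℝ}
    (h : ∀ i ∈ s, ∀ i' ∈ s, (d i ≤ d i' ↔ d' i ≤ d' i')) : argminIdx s d = argminIdx s d' := by
  unfold argminIdx
  congr 1
  ext i
  simp only [Set.mem_ofPred_eq]
  exact and_congr_right fun hi => forall₂_congr fun i' hi' => h i hi i' hi'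

/-- Only the order of the distances matters, ties included. This is what replaces a continuum of
query points by finitely many patterns of comparisons. -/
theorem nearest_congr {s : Finset ℕ} {d d' : ℕ → ℝ}
    (h : ∀ i ∈ s, ∀ i' ∈ s, (d i ≤ d i' ↔ d' i ≤ d' i')) (k : ℕ) :
    nearest s d k = nearest s d' k := by
  induction k with
  | zero => rfl
  | succ k ih =>
    simp only [nearest, ih]
    rw [argminIdx_congr (fun i hi i' hi' => h i (Finset.sdiff_subset hi) i' (Finset.sdiff_subset hi'))]

theorem nearest_subset_and_card {s : Finset ℕ} (d : ℕ → ℝ) {k : ℕ} (hk : k ≤ s.card) :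
    nearest s d k ⊆ s ∧ (nearest s d k).card = k := by
  induction k with
  | zero => simp [nearest]
  | succ k ih =>
    obtain ⟨h1, h2⟩ := ih (by omega)
    have hne : (s \ nearest s d k).Nonempty := by
      rw [← Finset.card_pos, Finset.card_sdiff_of_subset h1]; omega
    have hm := Finset.mem_sdiff.1 (argminIdx_mem hne d)
    exact ⟨Finset.insert_subset hm.1 h1, by rw [nearest, Finset.card_insert_of_notMem hm.2, h2]⟩

theorem nearest_subset {s : Finset ℕ} (d : ℕ → ℝ) {k : ℕ} (hk : k ≤ s.card) :
    nearest s d k ⊆ s := (nearest_subset_and_card d hk).1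

theorem card_nearest {s : Finset ℕ} (d : ℕ → ℝ) {k : ℕ} (hk : k ≤ s.card) :
    (nearest s d k).card = k := (nearest_subset_and_card d hk).2

theorem le_of_mem_nearest_of_notMem {s : Finset ℕ} (d : ℕ → ℝ) {k : ℕ} {i i' : ℕ}
    (hi : i ∈ nearest s d k) (hi' : i' ∈ s) (hi'' : i' ∉ nearest s d k) : d i ≤ d i' := by
  induction k with
  | zero => simp [nearest] at hi
  | succ k ih =>
    simp only [nearest, Finset.mem_insert, not_or] at hi hi''
    rcases hi with rfl | hi
    · exact argminIdx_le d (Finset.mem_sdiff.2 ⟨hi', hi''.2⟩)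
    · exact ih hi hi''.2

/-- If a selected value exceeded `ρ`, all indices with value at most `ρ`, at least `k` of them,
would lie among the other `k - 1` selected ones. -/
theorem le_of_mem_nearest {s : Finset ℕ} {d : ℕ → ℝ} {k : ℕ} {ρ : ℝ}
    (hk : k ≤ (s.filter fun i => d i ≤ ρ).card) {i : ℕ} (hi : i ∈ nearest s d k) : d i ≤ ρ := by
  by_contra hlt
  have hks : k ≤ s.card := hk.trans (Finset.card_filter_le _ _)
  have hsub : (s.filter fun i => d i ≤ ρ) ⊆ (nearest s d k).erase i := by
    intro i' hi'
    rw [Finset.mem_filter] at hi'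
    refine Finset.mem_erase.2 ⟨fun h => hlt (h ▸ hi'.2), ?_⟩
    by_contra h
    exact hlt ((le_of_mem_nearest_of_notMem d hi hi'.1 h).trans hi'.2)
  have := Finset.card_le_card hsub
  rw [Finset.card_erase_of_mem hi, card_nearest d hks] at this
  have : 0 < k := by
    rw [← card_nearest d hks]; exact Finset.card_pos.2 ⟨i, hi⟩
  omega

end Nearest

/-! ### Comparison patterns of finite families and their measurability. -/

section Comparisons

/-- A set saturated for the fibres of a map with measurable fibres and finite range is
measurable. -/
theorem measurableSet_of_fibers {Ω κ : Type*} [MeasurableSpace Ω] (F : Ω → κ) {R : Finset κ}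
    (hR : ∀ ω, F ω ∈ R) (hF : ∀ v, MeasurableSet {ω | F ω = v}) (A : Set Ω)
    (hA : ∀ ω ω', F ω = F ω' → ω ∈ A → ω' ∈ A) : MeasurableSet A := by
  classical
  have : A = ⋃ v ∈ R.filter (fun v => ∃ ω ∈ A, F ω = v), {ω | F ω = v} := by
    ext ω
    simp only [Set.mem_iUnion, Finset.mem_filter, Set.mem_ofPred_eq, exists_prop]
    constructor
    · exact fun h => ⟨F ω, ⟨hR ω, ω, h, rfl⟩, rfl⟩
    · rintro ⟨v, ⟨-, ω', h, h'⟩, h''⟩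
      exact hA ω' ω (h'.trans h''.symm) h
  rw [this]
  exact Finset.measurableSet_biUnion _ fun v _ => hF v

open Classical in
/-- The pairs of indices whose values are in increasing order. -/
noncomputable def comparisons {κ : Type*} (I : Finset κ) (d : κ → ℝ) : Finset (κ × κ) :=
  (I ×ˢ I).filter fun p => d p.1 ≤ d p.2

theorem comparisons_mem_powerset {κ : Type*} (I : Finset κ) (d : κ → ℝ) :
    comparisons I d ∈ (I ×ˢ I).powerset := by
  classical exact Finset.mem_powerset.2 (Finset.filter_subset _ _)

theorem le_iff_of_comparisons_eq {κ : Type*} {I : Finset κ} {d d' : κ → ℝ}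
    (h : comparisons I d = comparisons I d') {i i' : κ} (hi : i ∈ I) (hi' : i' ∈ I) :
    d i ≤ d i' ↔ d' i ≤ d' i' := by
  have := congrArg (fun s => (i, i') ∈ s) h
  simpa [comparisons, hi, hi'] using this

theorem comparisons_eq_iff {κ : Type*} {I : Finset κ} {d : κ → ℝ} {τ : Finset (κ × κ)}
    (hτ : τ ⊆ I ×ˢ I) :
    comparisons I d = τ ↔ ∀ p ∈ I ×ˢ I, (d p.1 ≤ d p.2 ↔ p ∈ τ) := by
  classical
  constructor
  · rintro rfl p hp
    simp only [comparisons, Finset.mem_filter, hp, true_and]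
  · intro h
    ext p
    rw [comparisons, Finset.mem_filter]
    exact ⟨fun hp => (h p hp.1).1 hp.2, fun hp => ⟨hτ hp, (h p (hτ hp)).2 hp⟩⟩

theorem measurableSet_comparisons_eq {Ω κ : Type*} [MeasurableSpace Ω] {I : Finset κ}
    {d : κ → Ω → ℝ} (hd : ∀ i ∈ I, Measurable (d i)) (τ : Finset (κ × κ)) :
    MeasurableSet {ω | comparisons I (fun i => d i ω) = τ} := by
  classical
  by_cases hτ : τ ⊆ I ×ˢ I
  · have : {ω | comparisons I (fun i => d i ω) = τ}
        = ⋂ p ∈ I ×ˢ I, {ω | d p.1 ω ≤ d p.2 ω ↔ p ∈ τ} := by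
      ext ω; simp only [Set.mem_ofPred_eq, Set.mem_iInter]; exact comparisons_eq_iff hτ
    rw [this]
    refine Finset.measurableSet_biInter _ fun p hp => ?_
    rw [Finset.mem_product] at hp
    have := measurableSet_le (hd _ hp.1) (hd _ hp.2)
    by_cases h : p ∈ τ
    · simpa [h] using this
    · simp only [h, iff_false]
      exact this.compl
  · convert MeasurableSet.empty
    ext ω
    simp only [Set.mem_ofPred_eq, Set.mem_empty_iff_false, iff_false]
    rintro rfl
    exact hτ (Finset.mem_powerset.1 (comparisons_mem_powerset _ _))

theorem measurableSet_nearest_eq {Ω : Type*} [MeasurableSpace Ω] {s : Finset ℕ}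
    {d : ℕ → Ω → ℝ} (hd : ∀ i ∈ s, Measurable (d i)) (k : ℕ) (S : Finset ℕ) :
    MeasurableSet {ω | nearest s (fun i => d i ω) k = S} := by
  refine measurableSet_of_fibers (fun ω => comparisons s (fun i => d i ω))
    (fun ω => comparisons_mem_powerset _ _) (measurableSet_comparisons_eq hd) _ ?_
  intro ω ω' h hω
  rw [Set.mem_ofPred_eq] at hω ⊢
  rw [← hω]
  exact nearest_congr (fun i hi i' hi' => (le_iff_of_comparisons_eq h hi hi').symm) k

end Comparisons

/-! ### Counting the orders of distances to a variable point. -/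

section CellCount

/-- Sets cut out by linear functionals composed with a fixed map shatter at most as many points as
the dimension of the space of functionals. -/
theorem card_le_finrank_of_shatters {κ V X : Type*} [AddCommGroup V] [Module ℝ V]
    [FiniteDimensional ℝ V] [DecidableEq κ] {v : κ → V} {e : X → V →ₗ[ℝ] ℝ}
    {𝒜 : Finset (Finset κ)} {H : Finset κ}
    (h𝒜 : ∀ τ ∈ 𝒜, ∃ x, ∀ p ∈ H, (p ∈ τ ↔ e x (v p) ≤ 0))
    {t : Finset κ} (htH : t ⊆ H) (ht : 𝒜.Shatters t) : t.card ≤ Module.finrank ℝ V := by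
  classical
  by_contra hlt
  have hli : ¬ LinearIndependent ℝ (fun p : t => v p) := fun h => by
    have := h.fintype_card_le_finrank
    simp only [Fintype.card_coe] at this
    omega
  obtain ⟨g, hg, i, hi⟩ := Fintype.not_linearIndependent_iff.1 hli
  -- The sign is normalized because only a positive coefficient gives a strict inequality below: off
  -- `τ` the functional is `> 0`, on `τ` merely `≤ 0`.
  obtain ⟨g, hg, i, hi⟩ : ∃ g : t → ℝ, ∑ p, g p • v p = 0 ∧ ∃ i, 0 < g i := by
    rcases hi.lt_or_gt with h | h
    · exact ⟨-g, by simpa only [Pi.neg_apply, neg_smul, Finset.sum_neg_distrib, neg_eq_zero] using hg, i, by simpa using h⟩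
    · exact ⟨g, hg, i, h⟩
  -- Cutting out exactly the nonpositive coefficients makes every product `g p * e x (v p)`
  -- nonnegative and one positive, while the linear relation makes them sum to zero.
  obtain ⟨τ, hτ, hτt⟩ := ht (t := (Finset.univ.filter fun p : t => g p ≤ 0).map
    (Function.Embedding.subtype _)) (fun p hp => by
      obtain ⟨q, -, rfl⟩ := Finset.mem_map.1 hp
      exact q.2)
  obtain ⟨x, hx⟩ := h𝒜 τ hτ
  have key : ∀ p : t, (g p ≤ 0 ↔ e x (v p) ≤ 0) := fun p => by
    rw [← hx p (htH p.2)]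
    have := congrArg (fun s => (p : κ) ∈ s) hτt
    simpa [p.2] using this.symm
  have h1 : ∑ p, g p * e x (v p) = 0 := by
    have := congrArg (e x) hg
    simpa using this
  have h2 : ∀ p, 0 ≤ g p * e x (v p) := fun p => by
    by_cases h : g p ≤ 0
    · exact mul_nonneg_of_nonpos_of_nonpos h ((key p).1 h)
    · exact mul_nonneg (not_le.1 h).le (not_le.1 fun h' => h ((key p).2 h')).le
  have h3 := (Finset.sum_eq_zero_iff_of_nonneg (fun p _ => h2 p)).1 h1 i (Finset.mem_univ _)
  have : 0 < e x (v i) := not_le.1 fun h' => absurd ((key i).2 h') (not_le.2 hi)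
  exact (mul_pos hi this).ne' h3

theorem sum_choose_le (h d : ℕ) : ∑ j ∈ Finset.range (d + 1), h.choose j ≤ (h + 1) ^ d := by
  induction d with
  | zero => simp
  | succ d ih =>
    rw [Finset.sum_range_succ]
    have h1 := Nat.choose_le_pow h (d + 1)
    have h2 : h ^ d ≤ (h + 1) ^ d := Nat.pow_le_pow_left (by omega) d
    calc _ ≤ (h + 1) ^ d + h * h ^ d := by
          refine add_le_add ih (h1.trans ?_); rw [pow_succ, mul_comm]
      _ ≤ (h + 1) ^ d + h * (h + 1) ^ d := by gcongr
      _ = _ := by ring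

/-- Sauer–Shelah in Pajor's form: a family has at most as many members as it shatters sets, and the
shattered sets are subsets of `H` of size at most `d`. -/
theorem card_le_of_shatters_le {κ : Type*} [DecidableEq κ] {𝒜 : Finset (Finset κ)} {H : Finset κ}
    {d : ℕ} (hH : ∀ τ ∈ 𝒜, τ ⊆ H) (hd : ∀ t ⊆ H, 𝒜.Shatters t → t.card ≤ d) :
    𝒜.card ≤ (H.card + 1) ^ d := by
  classical
  refine 𝒜.card_le_card_shatterer.trans ?_
  have hsub : 𝒜.shatterer ⊆ (Finset.range (d + 1)).biUnion fun j => H.powersetCard j := by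
    intro t ht
    rw [Finset.mem_shatterer] at ht
    obtain ⟨τ, hτ, h⟩ := ht.exists_superset
    have := h.trans (hH τ hτ)
    simp only [Finset.mem_biUnion, Finset.mem_range, Finset.mem_powersetCard]
    exact ⟨t.card, Nat.lt_succ_of_le (hd t this ht), this, rfl⟩
  refine (Finset.card_le_card hsub).trans (Finset.card_biUnion_le.trans ?_)
  simp only [Finset.card_powersetCard]
  exact sum_choose_le _ _

/-- The term `‖x‖ ^ 2` cancels, so a comparison of distances is the sign of a functional linear in
`(‖q‖ ^ 2 - ‖q'‖ ^ 2, q - q')`, a vector of a space of dimension `D + 1`. -/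
theorem norm_sub_le_norm_sub_iff_inner {D : ℕ} (q q' x : Space D) :
    ‖q - x‖ ≤ ‖q' - x‖ ↔
      (‖q‖ ^ 2 - ‖q'‖ ^ 2) - 2 * inner ℝ x (q - q') ≤ 0 := by
  rw [← sq_le_sq₀ (norm_nonneg _) (norm_nonneg _), norm_sub_sq_real, norm_sub_sq_real,
    inner_sub_right, real_inner_comm x q, real_inner_comm x q']
  constructor <;> intro h <;> linarith

/-- The number of orderings of finitely many points by their distance to a variable point of
`ℝ^D` is polynomial in the number of points. -/
theorem card_comparisons_norm_sub_le {D : ℕ} {κ : Type*} (I : Finset κ) (Q : κ → Space D)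
    (𝒜 : Finset (Finset (κ × κ))) (h𝒜 : ∀ τ ∈ 𝒜, ∃ x, comparisons I (fun p => ‖Q p - x‖) = τ) :
    𝒜.card ≤ (I.card ^ 2 + 1) ^ (D + 1) := by
  classical
  have hsub : ∀ τ ∈ 𝒜, τ ⊆ I ×ˢ I := fun τ hτ => by
    obtain ⟨x, rfl⟩ := h𝒜 τ hτ
    exact Finset.mem_powerset.1 (comparisons_mem_powerset _ _)
  have := card_le_of_shatters_le (𝒜 := 𝒜) (H := I ×ˢ I) (d := D + 1) hsub ?_
  · simpa [Finset.card_product, sq] using this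
  intro t ht hsh
  have := card_le_finrank_of_shatters (V := ℝ × Space D) (X := Space D)
    (v := fun p : κ × κ => (‖Q p.1‖ ^ 2 - ‖Q p.2‖ ^ 2, Q p.1 - Q p.2))
    (e := fun x => LinearMap.fst ℝ ℝ (Space D) -
      (2 : ℝ) • ((innerSL ℝ x).toLinearMap ∘ₗ LinearMap.snd ℝ ℝ (Space D)))
    (𝒜 := 𝒜) (H := I ×ˢ I) ?_ ht hsh
  · simpa [Module.finrank_prod, add_comm] using this
  intro τ hτ
  obtain ⟨x, hx⟩ := h𝒜 τ hτ
  refine ⟨x, fun p hp => ?_⟩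
  rw [← (comparisons_eq_iff (hsub τ hτ)).1 hx p hp, norm_sub_le_norm_sub_iff_inner]
  simp

theorem IsSigmaCompact.measurableSet {X : Type*} [TopologicalSpace X] [T2Space X]
    [MeasurableSpace X] [BorelSpace X] {s : Set X} (hs : IsSigmaCompact s) : MeasurableSet s := by
  obtain ⟨K, hK, rfl⟩ := hs
  exact MeasurableSet.iUnion fun n => (hK n).measurableSet

/-- The quantifier over `x` is a projection, which need not preserve Borel sets. Here the set
projected is a countable union of closed subsets of a σ-compact space, so its projection is
σ-compact and hence Borel. -/
theorem measurableSet_exists_comparisons_norm_sub_eq {D : ℕ} {Ω κ : Type*} [MeasurableSpace Ω]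
    {I : Finset κ} {Q : κ → Ω → Space D} (hQ : ∀ p ∈ I, Measurable (Q p))
    (τ : Finset (κ × κ)) :
    MeasurableSet {ω | ∃ x, comparisons I (fun p => ‖Q p ω - x‖) = τ} := by
  classical
  by_cases hτ : τ ⊆ I ×ˢ I
  swap
  · convert MeasurableSet.empty
    ext ω
    simp only [Set.mem_ofPred_eq, Set.mem_empty_iff_false, iff_false]
    rintro ⟨x, rfl⟩
    exact hτ (Finset.mem_powerset.1 (comparisons_mem_powerset _ _))
  -- The strict inequalities required off `τ` are open conditions; a gap of at least `1 / (N + 1)`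
  -- makes them closed, and the union over `N` recovers them since there are finitely many pairs.
  let C : ℕ → Set ((I → Space D) × Space D) := fun N =>
    {z | ∀ p : I × I, (((p.1 : κ), (p.2 : κ)) ∈ τ → ‖z.1 p.1 - z.2‖ ≤ ‖z.1 p.2 - z.2‖) ∧
      (((p.1 : κ), (p.2 : κ)) ∉ τ → ‖z.1 p.2 - z.2‖ + 1 / ((N : ℝ) + 1) ≤ ‖z.1 p.1 - z.2‖)}
  have hC : ∀ N, IsClosed (C N) := by
    intro N
    simp only [C, Set.ofPred_forall, Set.ofPred_and]
    refine isClosed_iInter fun p => IsClosed.inter ?_ ?_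
    · by_cases h : ((p.1 : κ), (p.2 : κ)) ∈ τ
      · simp only [h, Set.iInter_true]
        exact isClosed_le (f := fun z : (I → Space D) × Space D => ‖z.1 p.1 - z.2‖)
          (g := fun z => ‖z.1 p.2 - z.2‖) (by fun_prop) (by fun_prop)
      · simp [h]
    · by_cases h : ((p.1 : κ), (p.2 : κ)) ∈ τ
      · simp [h]
      · simp only [h, not_false_eq_true, Set.iInter_true]
        exact isClosed_le
          (f := fun z : (I → Space D) × Space D => ‖z.1 p.2 - z.2‖ + 1 / ((N : ℝ) + 1))
          (g := fun z => ‖z.1 p.1 - z.2‖) (by fun_prop) (by fun_prop)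
  have hm : MeasurableSet (⋃ N, Prod.fst '' C N) := MeasurableSet.iUnion fun N =>
    ((isSigmaCompact_univ.of_isClosed_subset (hC N) (Set.subset_univ _)).image
      continuous_fst).measurableSet
  have hQ' : Measurable (fun ω (p : I) => Q p ω) := measurable_pi_lambda _ fun p => hQ p p.2
  convert hQ' hm
  ext ω
  simp only [Set.mem_ofPred_eq, Set.mem_preimage, Set.mem_iUnion, Set.mem_image, Prod.exists,
    exists_and_right, exists_eq_right]
  rw [exists_comm]
  refine exists_congr fun x => ?_
  rw [comparisons_eq_iff hτ]
  constructor
  · intro h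
    have hp : ∀ p : I × I, ((p.1 : κ), (p.2 : κ)) ∉ τ →
        ∃ N : ℕ, 1 / ((N : ℝ) + 1) < ‖Q p.1 ω - x‖ - ‖Q p.2 ω - x‖ := by
      intro p hp
      refine exists_nat_one_div_lt (sub_pos.2 (not_le.1 fun h' => hp ?_))
      exact (h (p.1, p.2) (Finset.mk_mem_product p.1.2 p.2.2)).1 h'
    choose! N hN using hp
    refine ⟨Finset.univ.sup N, fun p => ⟨fun hp => ?_, fun hp => ?_⟩⟩
    · exact (h (p.1, p.2) (Finset.mk_mem_product p.1.2 p.2.2)).2 hp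
    · have h1 := hN p hp
      have h2 : 1 / (((Finset.univ.sup N : ℕ) : ℝ) + 1) ≤ 1 / ((N p : ℝ) + 1) := by
        gcongr
        exact Finset.le_sup (Finset.mem_univ p)
      simp only
      linarith
  · rintro ⟨N, h⟩ p hp
    rw [Finset.mem_product] at hp
    have := h (⟨p.1, hp.1⟩, ⟨p.2, hp.2⟩)
    simp only at this
    constructor
    · intro h'
      by_contra h''
      have h3 := this.2 h''
      have : 0 < 1 / ((N : ℝ) + 1) := by positivity
      linarith
    · exact this.1

end CellCount

/-! ### A maximal inequality for selected Gaussian combinations. -/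

section MaximalInequality

variable {D : ℕ} {Ω : Type*} {m mΩ : MeasurableSpace Ω} {P : Measure Ω} {ι : Type*} [Fintype ι]
  {η : ι → Ω → Space D}

theorem map_apply_eq_gaussianReal {Z : Ω → Space D} (hZ : Measurable Z)
    (hlaw : P.map Z = stdGaussian (Space D)) (e : Fin D) :
    P.map (fun ω => Z ω e) = gaussianReal 0 1 := by
  have h1 : Measurable fun z : Space D => z e := by fun_prop
  have h2 : P.map (fun ω => Z ω e) = (P.map Z).map fun z => z e :=
    (Measure.map_map h1 hZ).symm
  rw [h2, hlaw, ← map_pi_eq_stdGaussian, Measure.map_map h1 (by fun_prop)]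
  exact (measurePreserving_eval (fun _ : Fin D => gaussianReal 0 1) e).map_eq

theorem lintegral_exp_sum_apply (hη : ∀ i, Measurable (η i))
    (hlaw : ∀ i, P.map (η i) = stdGaussian (Space D)) (hind : iIndepFun η P) (c : ι → ℝ)
    (e : Fin D) (t : ℝ) :
    ∫⁻ ω, ENNReal.ofReal (Real.exp (t * (∑ i, c i • η i ω) e)) ∂P
      = ENNReal.ofReal (Real.exp (t ^ 2 / 2 * ∑ i, c i ^ 2)) := by
  have : IsProbabilityMeasure P := hind.isProbabilityMeasure
  set W : ι → Ω → ℝ := fun i ω => c i * η i ω e with hW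
  have hWm : ∀ i, Measurable (W i) := fun i => by
    have : Measurable fun ω => η i ω e := by
      have h1 : Measurable fun z : Space D => z e := by fun_prop
      exact h1.comp (hη i)
    exact this.const_mul _
  have hWi : iIndepFun W P := hind.comp (fun i z => c i * z e) fun i => by fun_prop
  have hmgf : ∀ i, mgf (W i) P t = Real.exp (t ^ 2 / 2 * c i ^ 2) := fun i => by
    have := mgf_gaussianReal (map_apply_eq_gaussianReal (hη i) (hlaw i) e) (t * c i)
    simp only [mgf] at this ⊢
    have h2 : ∀ ω, t * W i ω = t * c i * η i ω e := fun ω => by simp only [hW]; ring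
    simp_rw [h2]
    rw [this]
    congr 1
    push_cast
    ring
  have hint : ∀ i, Integrable (fun ω => Real.exp (t * W i ω)) P := fun i => by
    -- The moment generating function is `0` by convention where the exponential is not integrable,
    -- so its positive value forces integrability.
    by_contra h
    have h0 := mgf_undef h
    rw [hmgf] at h0
    exact (Real.exp_pos _).ne' h0
  have hsum : ∀ ω, (∑ i, c i • η i ω) e = (∑ i, W i) ω := fun ω => by
    simp [hW, Finset.sum_apply]
  have h1 := hWi.integrable_exp_mul_sum hWm (s := Finset.univ) fun i _ => hint i
  have h2 := hWi.mgf_sum (t := t) hWm Finset.univ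
  simp_rw [hsum]
  rw [← ofReal_integral_eq_lintegral_ofReal h1 (ae_of_all _ fun ω => (Real.exp_pos _).le)]
  congr 1
  rw [mgf] at h2
  rw [h2, Finset.prod_congr rfl fun i _ => hmgf i, ← Real.exp_sum, Finset.mul_sum]

theorem norm_le_sum_abs (z : Space D) : ‖z‖ ≤ ∑ e, |z e| := by
  rw [EuclideanSpace.norm_eq]
  refine Real.sqrt_le_iff.2 ⟨Finset.sum_nonneg fun _ _ => abs_nonneg _, ?_⟩
  simp only [Real.norm_eq_abs]
  exact Finset.sum_sq_le_sq_sum_of_nonneg fun _ _ => abs_nonneg _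

/-- If at most `K` of a family of Gaussian vectors are selected, by a rule that is independent of
the noise, the largest selected norm is of order `s √(log K)`. -/
theorem exists_measurable_bound_of_selected {α : Type*} (hm : m ≤ mΩ)
    (hη : ∀ i, Measurable (η i)) (hlaw : ∀ i, P.map (η i) = stdGaussian (Space D))
    (hind : iIndepFun η P)
    (hmη : Indep m (MeasurableSpace.comap (fun ω i => η i ω) inferInstance) P)
    (I : Finset α) (coef : α → ι → ℝ) {s K : ℝ} (hs : 0 < s) (hK : 3 ≤ K)
    (hcoef : ∀ π ∈ I, ∑ i, coef π i ^ 2 ≤ s ^ 2) (A : α → Set Ω)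
    (hA : ∀ π ∈ I, MeasurableSet[m] (A π))
    (hcard : ∀ ω, ∀ J ⊆ I, (∀ π ∈ J, ω ∈ A π) → (J.card : ℝ) ≤ K) :
    ∃ g : Ω → ℝ, Measurable g ∧ (∀ ω, 0 ≤ g ω) ∧
      (∀ ω, ∀ π ∈ I, ω ∈ A π → ‖∑ i, coef π i • η i ω‖ ≤ g ω) ∧
      ∫⁻ ω, ENNReal.ofReal (g ω) ∂P ≤ ENNReal.ofReal (4 * D * s * √(Real.log K)) := by
  classical
  have : IsProbabilityMeasure P := hind.isProbabilityMeasure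
  set ℓ := Real.log K with hℓ
  have hℓ1 : 1 ≤ ℓ := by
    rw [hℓ, Real.le_log_iff_exp_le (by linarith)]
    linarith [Real.exp_one_lt_three]
  have hsq : 1 ≤ √ℓ := Real.one_le_sqrt.2 hℓ1
  have hsqℓ : √ℓ * √ℓ = ℓ := Real.mul_self_sqrt (by linarith)
  -- With this `lam` the exponential moment of a combination of variance at most `s ^ 2` is at most
  -- `exp (ℓ / 2)`, and the threshold `A0` satisfies `lam * A0 = 2 ℓ`.
  set lam := √ℓ / s with hlam
  have hlam0 : 0 < lam := by positivity
  set A0 := 2 * s * √ℓ with hA0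
  have hlA : lam * A0 = 2 * ℓ := by
    rw [hlam, hA0]; field_simp; linarith
  have hls : lam ^ 2 * s ^ 2 = ℓ := by
    rw [hlam]; field_simp; linarith
  set Z : α → Fin D → Ω → ℝ := fun π e ω => (∑ i, coef π i • η i ω) e with hZ
  have hηm : Measurable[MeasurableSpace.comap (fun ω i => η i ω) inferInstance]
      (fun ω i => η i ω) := comap_measurable _
  have hcomap : MeasurableSpace.comap (fun ω i => η i ω) inferInstance ≤ mΩ :=
    (measurable_pi_lambda _ hη).comap_le
  -- A smooth bound for the excess of `|Z|` over `A0`, from `y ≤ exp y` with `y = lam * (z - A0)`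
  -- for both signs of `Z`. Its mean is `O(s √ℓ / K)`, small enough to be summed over `K` selected
  -- candidates.
  set h : α → Fin D → Ω → ℝ := fun π e ω =>
    lam⁻¹ * (Real.exp (lam * Z π e ω - 2 * ℓ) + Real.exp (-lam * Z π e ω - 2 * ℓ)) with hh
  have hh0 : ∀ π e ω, 0 ≤ h π e ω := fun π e ω => by positivity
  have hhm : ∀ π e,
      Measurable[MeasurableSpace.comap (fun ω i => η i ω) inferInstance] (h π e) := fun π e => by
    have : Measurable fun u : ι → Space D => lam⁻¹ * (Real.exp (lam * (∑ i, coef π i • u i) e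
        - 2 * ℓ) + Real.exp (-lam * (∑ i, coef π i • u i) e - 2 * ℓ)) := by fun_prop
    exact this.comp hηm
  have hbd : ∀ π e ω, |Z π e ω| ≤ A0 + h π e ω := by
    intro π e ω
    have key : ∀ z : ℝ, z ≤ A0 + lam⁻¹ * Real.exp (lam * z - 2 * ℓ) := fun z => by
      have := Real.add_one_le_exp (lam * z - 2 * ℓ)
      have h2 : lam * z - 2 * ℓ = lam * (z - A0) := by rw [mul_sub, hlA]
      have h3 : lam⁻¹ * (lam * (z - A0)) ≤ lam⁻¹ * Real.exp (lam * z - 2 * ℓ) := by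
        gcongr; linarith
      rw [inv_mul_cancel_left₀ hlam0.ne'] at h3
      linarith
    have e1 : 0 ≤ lam⁻¹ * Real.exp (lam * Z π e ω - 2 * ℓ) := by positivity
    have e2 : 0 ≤ lam⁻¹ * Real.exp (-lam * Z π e ω - 2 * ℓ) := by positivity
    simp only [hh, mul_add]
    refine abs_le'.2 ⟨?_, ?_⟩
    · linarith [key (Z π e ω)]
    · have := key (-Z π e ω)
      rw [mul_neg, ← neg_mul] at this
      linarith
  have hhint : ∀ π ∈ I, ∀ e, ∫⁻ ω, ENNReal.ofReal (h π e ω) ∂P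
      ≤ ENNReal.ofReal (2 * s * √ℓ / K) := by
    intro π hπ e
    have hone : ∀ t : ℝ, t ^ 2 = lam ^ 2 → ∫⁻ ω, ENNReal.ofReal (Real.exp (t * Z π e ω)) ∂P
        ≤ ENNReal.ofReal (Real.exp (ℓ / 2)) := fun t ht => by
      rw [lintegral_exp_sum_apply hη hlaw hind (coef π) e t]
      refine ENNReal.ofReal_le_ofReal (Real.exp_le_exp.2 ?_)
      have := hcoef π hπ
      calc t ^ 2 / 2 * ∑ i, coef π i ^ 2 ≤ lam ^ 2 / 2 * s ^ 2 := by rw [ht]; gcongr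
        _ = ℓ / 2 := by linarith
    have hexp : ∀ ω, ENNReal.ofReal (h π e ω) = ENNReal.ofReal (lam⁻¹ * Real.exp (-(2 * ℓ))) *
        (ENNReal.ofReal (Real.exp (lam * Z π e ω)) + ENNReal.ofReal (Real.exp (-lam * Z π e ω))) := by
      intro ω
      rw [← ENNReal.ofReal_add (by positivity) (by positivity),
        ← ENNReal.ofReal_mul (by positivity)]
      congr 1
      simp only [hh, sub_eq_add_neg, Real.exp_add]
      ring
    have hZm : Measurable (Z π e) := by
      have : Measurable fun u : ι → Space D => (∑ i, coef π i • u i) e := by fun_prop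
      exact this.comp (measurable_pi_lambda _ hη)
    simp_rw [hexp]
    rw [lintegral_const_mul _ (by fun_prop), lintegral_add_left (by fun_prop)]
    refine (mul_le_mul_right (add_le_add (hone lam rfl) (hone (-lam) (neg_sq _))) _).trans ?_
    rw [← ENNReal.ofReal_add (by positivity) (by positivity),
        ← ENNReal.ofReal_mul (by positivity)]
    refine ENNReal.ofReal_le_ofReal ?_
    have h1 : lam⁻¹ ≤ s * √ℓ := by
      rw [hlam, inv_div, div_le_iff₀ (by positivity)]
      nlinarith
    have h2 : Real.exp (-(2 * ℓ)) * Real.exp (ℓ / 2) ≤ K⁻¹ := by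
      rw [← Real.exp_add, ← Real.exp_log (show 0 < K by linarith), ← Real.exp_neg, ← hℓ]
      exact Real.exp_le_exp.2 (by linarith)
    calc lam⁻¹ * Real.exp (-(2 * ℓ)) * (Real.exp (ℓ / 2) + Real.exp (ℓ / 2))
        = 2 * lam⁻¹ * (Real.exp (-(2 * ℓ)) * Real.exp (ℓ / 2)) := by ring
      _ ≤ 2 * (s * √ℓ) * K⁻¹ := by gcongr
      _ = _ := by rw [div_eq_mul_inv]; ring
  refine ⟨fun ω => ∑ e : Fin D, (A0 + ∑ π ∈ I, (A π).indicator (h π e) ω), ?_, ?_, ?_, ?_⟩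
  · refine Finset.measurable_sum _ fun e _ => measurable_const.add ?_
    exact Finset.measurable_sum _ fun π hπ => ((hhm π e).mono hcomap le_rfl).indicator
      (hm _ (hA π hπ))
  · intro ω
    refine Finset.sum_nonneg fun e _ => add_nonneg (by positivity) (Finset.sum_nonneg fun π _ => ?_)
    exact Set.indicator_nonneg (fun ω _ => hh0 π e ω) ω
  · intro ω π hπ hω
    refine (norm_le_sum_abs _).trans (Finset.sum_le_sum fun e _ => (hbd π e ω).trans ?_)
    gcongr
    refine le_trans ?_ (Finset.single_le_sum (f := fun π => (A π).indicator (h π e) ω)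
      (fun π _ => Set.indicator_nonneg (fun ω _ => hh0 π e ω) ω) hπ)
    simp [Set.indicator_of_mem hω]
  -- The sum runs over all candidates, but it is the expected number of those selected, so the size
  -- of `I` does not enter.
  · have hPA : ∑ π ∈ I, P (A π) ≤ ENNReal.ofReal K := by
      calc ∑ π ∈ I, P (A π) = ∑ π ∈ I, ∫⁻ ω, (A π).indicator 1 ω ∂P :=
            Finset.sum_congr rfl fun π hπ => (lintegral_indicator_one (hm _ (hA π hπ))).symm
        _ = ∫⁻ ω, ∑ π ∈ I, (A π).indicator 1 ω ∂P := by
            rw [lintegral_finsetSum]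
            exact fun π hπ => measurable_one.indicator (hm _ (hA π hπ))
        _ ≤ ∫⁻ _, ENNReal.ofReal K ∂P := by
            refine lintegral_mono fun ω => ?_
            have h1 : ∑ π ∈ I, (A π).indicator (1 : Ω → ℝ≥0∞) ω
                = ((I.filter fun π => ω ∈ A π).card : ℝ≥0∞) := by
              simp [Set.indicator_apply]
            rw [h1, ← ENNReal.ofReal_natCast]
            exact ENNReal.ofReal_le_ofReal (hcard ω _ (Finset.filter_subset _ _)
              fun π hπ => (Finset.mem_filter.1 hπ).2)
        _ = _ := by simp
    have hterm : ∀ e, ∀ π ∈ I, ∫⁻ ω, ENNReal.ofReal ((A π).indicator (h π e) ω) ∂P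
        ≤ P (A π) * ENNReal.ofReal (2 * s * √ℓ / K) := by
      intro e π hπ
      have h1 : ∀ ω, ENNReal.ofReal ((A π).indicator (h π e) ω)
          = (A π).indicator (1 : Ω → ℝ≥0∞) ω * ENNReal.ofReal (h π e ω) := fun ω => by
        by_cases hω : ω ∈ A π <;> simp [hω]
      simp_rw [h1]
      -- Selection is `m`-measurable and the excess depends on the noise alone, so the expectation
      -- of the product factors.
      rw [lintegral_mul_eq_lintegral_mul_lintegral_of_independent_measurableSpace
          (f := (A π).indicator 1) hm hcomap hmη
        ((@measurable_const ℝ≥0∞ Ω _ m 1).indicator (hA π hπ)) ((hhm π e).ennreal_ofReal),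
        lintegral_indicator_one (hm _ (hA π hπ))]
      gcongr
      exact hhint π hπ e
    have hcoord : ∀ e, ∫⁻ ω, ENNReal.ofReal (A0 + ∑ π ∈ I, (A π).indicator (h π e) ω) ∂P
        ≤ ENNReal.ofReal (4 * s * √ℓ) := by
      intro e
      have h1 : ∀ ω, ENNReal.ofReal (A0 + ∑ π ∈ I, (A π).indicator (h π e) ω)
          = ENNReal.ofReal A0 + ∑ π ∈ I, ENNReal.ofReal ((A π).indicator (h π e) ω) := fun ω => by
        have h0 : ∀ π ∈ I, 0 ≤ (A π).indicator (h π e) ω := fun π _ =>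
          Set.indicator_nonneg (fun ω _ => hh0 π e ω) ω
        rw [ENNReal.ofReal_add (by positivity) (Finset.sum_nonneg h0), ENNReal.ofReal_sum_of_nonneg h0]
      simp_rw [h1]
      rw [lintegral_add_left measurable_const, lintegral_const, measure_univ, mul_one,
        lintegral_finsetSum]
      · calc _ ≤ ENNReal.ofReal A0 + ∑ π ∈ I, P (A π) * ENNReal.ofReal (2 * s * √ℓ / K) := by
              gcongr with π hπ
              exact hterm e π hπ
          _ ≤ ENNReal.ofReal A0 + ENNReal.ofReal K * ENNReal.ofReal (2 * s * √ℓ / K) := by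
              rw [← Finset.sum_mul]; gcongr
          _ = _ := by
              rw [← ENNReal.ofReal_mul (by linarith), ← ENNReal.ofReal_add (by positivity)
                (by positivity)]
              congr 1
              rw [hA0]
              field_simp
              ring
      · exact fun π hπ => (((hhm π e).mono hcomap le_rfl).indicator
          (hm _ (hA π hπ))).ennreal_ofReal
    have h1 : ∀ ω, ENNReal.ofReal (∑ e : Fin D, (A0 + ∑ π ∈ I, (A π).indicator (h π e) ω))
        = ∑ e : Fin D, ENNReal.ofReal (A0 + ∑ π ∈ I, (A π).indicator (h π e) ω) := fun ω =>
      ENNReal.ofReal_sum_of_nonneg fun e _ => add_nonneg (by positivity)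
        (Finset.sum_nonneg fun π _ => Set.indicator_nonneg (fun ω _ => hh0 π e ω) ω)
    simp_rw [h1]
    rw [lintegral_finsetSum]
    · refine (Finset.sum_le_sum fun e _ => hcoord e).trans ?_
      rw [Finset.sum_const, Finset.card_univ, Fintype.card_fin, nsmul_eq_mul,
        ← ENNReal.ofReal_natCast, ← ENNReal.ofReal_mul (by positivity)]
      exact ENNReal.ofReal_le_ofReal (by linarith)
    · intro e _
      refine Measurable.ennreal_ofReal (measurable_const.add ?_)
      exact Finset.measurable_sum _ fun π hπ => ((hhm π e).mono hcomap le_rfl).indicator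
        (hm _ (hA π hπ))

end MaximalInequality

/-! ### Separated sets and nets of the support. -/

section Covering

variable {D : ℕ} {a b : ℝ} {μ : Measure (Space D)}

/-- Finitely many points of the support, `δ`-separated, number at most the inverse of the mass of a
ball of radius `δ / 3`. -/
theorem card_mul_le_one_of_separated (hμ : μ ∈ StandardClass D a b) {δ : ℝ}
    (hδ : 0 < δ) {c : Finset (Space D)} (hc : ∀ x ∈ c, x ∈ μ.support)
    (hsep : ∀ x ∈ c, ∀ y ∈ c, x ≠ y → δ < dist x y) :
    (c.card : ℝ) * min (a * (δ / 3) ^ b) 1 ≤ 1 := by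
  have := hμ.1
  by_contra hlt
  rw [not_le] at hlt
  have hdisj : (c : Set (Space D)).PairwiseDisjoint fun x => Metric.closedBall x (δ / 3) := by
    intro x hx y hy hxy
    -- Radius `δ / 3` leaves the balls disjoint since `2 δ / 3 < δ`; their total mass is at most
    -- one.
    exact Metric.closedBall_disjoint_closedBall (by have := hsep x hx y hy hxy; linarith)
  have h1 := measure_biUnion_finset (μ := μ) hdisj fun x _ => Metric.isClosed_closedBall.measurableSet
  have h2 : ∑ x ∈ c, ENNReal.ofReal (min (a * (δ / 3) ^ b) 1) ≤ 1 := by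
    calc _ ≤ ∑ x ∈ c, μ (Metric.closedBall x (δ / 3)) :=
          Finset.sum_le_sum fun x hx => hμ.2 x (hc x hx) _ (by positivity)
      _ ≤ 1 := by rw [← h1]; exact prob_le_one
  rw [Finset.sum_const, nsmul_eq_mul, ← ENNReal.ofReal_natCast,
    ← ENNReal.ofReal_mul (by positivity), ENNReal.ofReal_le_one] at h2
  linarith

/-- The support of a standard measure has a finite `δ`-net of bounded cardinality. -/
theorem exists_finset_net (ha : 0 < a) (hμ : μ ∈ StandardClass D a b) {δ : ℝ} (hδ : 0 < δ) :
    ∃ c : Finset (Space D), (∀ x ∈ c, x ∈ μ.support) ∧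
      (c.card : ℝ) * min (a * (δ / 3) ^ b) 1 ≤ 1 ∧ ∀ x ∈ μ.support, ∃ y ∈ c, dist x y ≤ δ := by
  classical
  set p := min (a * (δ / 3) ^ b) 1 with hp
  have hp0 : 0 < p := lt_min (by positivity) one_pos
  let good : Finset (Space D) → Prop := fun c => (∀ x ∈ c, x ∈ μ.support) ∧
    ∀ x ∈ c, ∀ y ∈ c, x ≠ y → δ < dist x y
  have hbound : ∀ c, good c → c.card ≤ ⌊1 / p⌋₊ := fun c hc => by
    refine Nat.le_floor ?_
    rw [le_div_iff₀ hp0]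
    exact card_mul_le_one_of_separated hμ hδ hc.1 hc.2
  -- A separated set of maximal cardinality is a net: a point of the support far from it could be
  -- added.
  obtain ⟨c, hc, hcard⟩ := Nat.findGreatest_spec (P := fun N => ∃ c, good c ∧ c.card = N)
    (n := ⌊1 / p⌋₊) (Nat.zero_le _) ⟨∅, by simp [good], rfl⟩
  refine ⟨c, hc.1, card_mul_le_one_of_separated hμ hδ hc.1 hc.2, fun x hx => ?_⟩
  by_contra! hfar
  have hxc : x ∉ c := fun h => by
    have := hfar x h
    rw [dist_self] at this
    linarith
  have hgood : good (insert x c) := by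
    refine ⟨fun y hy => ?_, fun y hy z hz hyz => ?_⟩
    · rcases Finset.mem_insert.1 hy with rfl | hy
      exacts [hx, hc.1 y hy]
    · rcases Finset.mem_insert.1 hy with hy | hy <;> rcases Finset.mem_insert.1 hz with hz | hz
      · exact absurd (hy.trans hz.symm) hyz
      · rw [hy]; exact hfar z hz
      · rw [hz, dist_comm]; exact hfar y hy
      · exact hc.2 y hy z hz hyz
  have h1 := Nat.le_findGreatest (P := fun N => ∃ c, good c ∧ c.card = N) (hbound _ hgood)
    ⟨insert x c, hgood, rfl⟩
  rw [← hcard, Finset.card_insert_of_notMem hxc] at h1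
  omega

end Covering

/-! ### Uniform bounds for nearest-neighbour distances. -/

section NearestNeighbours

variable {D : ℕ} {Ω : Type*} [MeasurableSpace Ω] {P : Measure Ω} {ι : Type*} [Fintype ι]
  {X : ι → Ω → Space D} {μ : Measure (Space D)}

open Classical in
/-- A set of mass at least `p` receives fewer than `k` of `N` independent points with exponentially
small probability. -/
theorem measure_card_filter_mem_le (hX : ∀ i, Measurable (X i)) (hlaw : ∀ i, P.map (X i) = μ)
    (hind : iIndepFun X P) {B : Set (Space D)} (hB : MeasurableSet B) {p : ℝ}
    (hpB : ENNReal.ofReal p ≤ μ B) (k : ℕ) (hcard : 0 < Fintype.card ι) :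
    P.real {ω | (Finset.univ.filter fun i => X i ω ∈ B).card ≤ k}
      ≤ Real.exp (k - p * Fintype.card ι / 2) := by
  have : IsProbabilityMeasure P := hind.isProbabilityMeasure
  have hμ : IsProbabilityMeasure μ := by
    obtain ⟨i⟩ := Fintype.card_pos_iff.1 hcard
    rw [← hlaw i]
    exact Measure.isProbabilityMeasure_map (hX i).aemeasurable
  set W : ι → Ω → ℝ := fun i ω => B.indicator 1 (X i ω) with hW
  have hBm : Measurable (B.indicator (1 : Space D → ℝ)) := measurable_one.indicator hB
  have hWm : ∀ i, Measurable (W i) := fun i => hBm.comp (hX i)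
  have hWi : iIndepFun W P := hind.comp (fun _ => B.indicator 1) fun _ => hBm
  have hint : ∀ i, Integrable (fun ω => Real.exp (-1 * W i ω)) P := fun i => by
    refine Integrable.of_bound (C := 1) (by fun_prop) (ae_of_all _ fun ω => ?_)
    rw [Real.norm_eq_abs, abs_of_pos (Real.exp_pos _), Real.exp_le_one_iff]
    have : 0 ≤ W i ω := Set.indicator_nonneg (fun _ _ => zero_le_one) _
    linarith
  -- Chernoff's bound is used with the fixed parameter `-1`: each indicator then has exponential
  -- moment at most `1 - p / 2 ≤ exp (-p / 2)`.
  have hexp : Real.exp (-1) ≤ 1 / 2 := by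
    rw [Real.exp_neg, inv_le_comm₀ (Real.exp_pos _) (by norm_num)]
    have := Real.add_one_le_exp 1
    norm_num at this ⊢
    exact this
  have hpB' : p ≤ μ.real B := (ENNReal.ofReal_le_iff_le_toReal (measure_ne_top _ _)).1 hpB
  have hmgf : ∀ i, mgf (W i) P (-1) ≤ Real.exp (-(p / 2)) := fun i => by
    have h1 : ∀ ω, Real.exp (-1 * W i ω)
        ≤ 1 - (1 / 2) * (X i ⁻¹' B).indicator 1 ω := fun ω => by
      by_cases h : X i ω ∈ B
      · simp only [hW, Set.indicator, h, Set.mem_preimage, if_true, Pi.one_apply]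
        norm_num; norm_num at hexp; exact hexp
      · simp [hW, Set.indicator, h]
    have h2 : P.real (X i ⁻¹' B) = μ.real B := by
      rw [← hlaw i, map_measureReal_apply (hX i) hB]
    have hm := hX i hB
    have hm' : Integrable (fun ω => 1 / 2 * (X i ⁻¹' B).indicator (1 : Ω → ℝ) ω) P :=
      ((integrable_const (1 : ℝ)).indicator hm).const_mul _
    calc mgf (W i) P (-1) ≤ ∫ ω, (1 - (1 / 2) * (X i ⁻¹' B).indicator 1 ω) ∂P := by
          refine integral_mono (hint i) ?_ h1
          exact (integrable_const _).sub hm'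
      _ = 1 - 1 / 2 * μ.real B := by
          rw [integral_sub (integrable_const _) hm', integral_const_mul,
            integral_indicator_one hm, h2]
          simp
      _ ≤ 1 - p / 2 := by linarith
      _ ≤ _ := by have := Real.add_one_le_exp (-(p / 2)); linarith
  have hmg := hWi.mgf_sum (t := -1) hWm Finset.univ
  have hch := measure_le_le_exp_mul_mgf (μ := P) (X := ∑ i, W i) (t := -1) (k : ℝ) (by norm_num)
    (hWi.integrable_exp_mul_sum hWm fun i _ => hint i)
  have hset : {ω | (Finset.univ.filter fun i => X i ω ∈ B).card ≤ k}
      = {ω | (∑ i, W i) ω ≤ (k : ℝ)} := by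
    ext ω
    simp only [Set.mem_ofPred_eq, Finset.sum_apply, hW]
    have : ∑ i, B.indicator (1 : Space D → ℝ) (X i ω)
        = ((Finset.univ.filter fun i => X i ω ∈ B).card : ℝ) := by
      simp [Set.indicator_apply]
    rw [this, Nat.cast_le]
  rw [hset]
  refine hch.trans ?_
  rw [hmg]
  calc _ ≤ Real.exp (- -1 * k) * ∏ _i : ι, Real.exp (-(p / 2)) := by
        gcongr with i _
        · exact fun i _ => mgf_nonneg
        · exact hmgf i
    _ = _ := by
        rw [Finset.prod_const, Finset.card_univ, ← Real.exp_nat_mul, ← Real.exp_add]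
        congr 1
        ring

open Classical in
/-- With high probability, every point of the support has `k` of `N` independent points within the
radius of a ball of mass of order `(k + log n) / n`. -/
theorem exists_measurableSet_card_filter_dist_le {a b : ℝ} (ha : 0 < a) (hb : 0 < b)
    (hX : ∀ i, Measurable (X i))
    (hlaw : ∀ i, P.map (X i) = μ) (hind : iIndepFun X P) (hμ : μ ∈ StandardClass D a b)
    {n k : ℕ} (hn : 1 ≤ n) (hk : 1 ≤ k) (hcard : (n : ℝ) / 3 ≤ Fintype.card ι) {p : ℝ}
    (hp : p = 6 * (1 + 1 / b) * (k + Real.log n) / n) (hp1 : p ≤ 1) :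
    ∃ E : Set Ω, MeasurableSet E ∧ P E ≤ ENNReal.ofReal (3 ^ b * (n : ℝ) ^ (-(1 / b))) ∧
      ∀ ω ∉ E, ∀ x ∈ μ.support,
        k ≤ (Finset.univ.filter fun i => ‖X i ω - x‖ ≤ 2 * (p / a) ^ (1 / b)).card := by
  have : IsProbabilityMeasure P := hind.isProbabilityMeasure
  have hn0 : (0 : ℝ) < n := by exact_mod_cast hn
  have hlog : 0 ≤ Real.log n := Real.log_natCast_nonneg n
  have hk1 : (1 : ℝ) ≤ k := by exact_mod_cast hk
  have hp0 : 1 / n ≤ p := by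
    rw [hp]
    gcongr
    have : 0 < 1 / b := by positivity
    nlinarith
  have hpp : 0 < p := lt_of_lt_of_le (by positivity) hp0
  set δ := (p / a) ^ (1 / b) with hδ
  have hδ0 : 0 < δ := by positivity
  have hδb : a * δ ^ b = p := by
    rw [hδ, ← Real.rpow_mul (by positivity), one_div_mul_cancel hb.ne', Real.rpow_one]
    field_simp
  obtain ⟨c, hcs, hcc, hcov⟩ := exists_finset_net ha hμ hδ0
  have hmass : ∀ y ∈ c, ENNReal.ofReal p ≤ μ (Metric.closedBall y δ) := fun y hy => by
    have := hμ.2 y (hcs y hy) δ hδ0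
    rwa [hδb, min_eq_left hp1] at this
  have hcard0 : 0 < Fintype.card ι := by
    have : (0 : ℝ) < Fintype.card ι := lt_of_lt_of_le (by positivity) hcard
    exact_mod_cast this
  -- The failure event concerns only the centres of the net. A general point of the support is
  -- within `δ` of a centre, whence the radius `2 δ`.
  set E : Set Ω := ⋃ y ∈ c,
    {ω | (Finset.univ.filter fun i => X i ω ∈ Metric.closedBall y δ).card ≤ k} with hE
  refine ⟨E, ?_, ?_, ?_⟩
  · refine Finset.measurableSet_biUnion _ fun y _ => ?_
    have : Measurable fun ω => ((Finset.univ.filter fun i => X i ω ∈ Metric.closedBall y δ).card : ℝ) := by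
      have h1 : ∀ ω, ((Finset.univ.filter fun i => X i ω ∈ Metric.closedBall y δ).card : ℝ)
          = ∑ i, (Metric.closedBall y δ).indicator (1 : Space D → ℝ) (X i ω) := fun ω => by
        simp [Set.indicator_apply]
      simp_rw [h1]
      exact Finset.measurable_sum _ fun i _ =>
        (measurable_one.indicator Metric.isClosed_closedBall.measurableSet).comp (hX i)
    have h2 := this (measurableSet_Iic (a := (k : ℝ)))
    convert h2 using 1
    ext ω
    simp
  · have hexp : ∀ y ∈ c,
        P {ω | (Finset.univ.filter fun i => X i ω ∈ Metric.closedBall y δ).card ≤ k}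
          ≤ ENNReal.ofReal ((n : ℝ) ^ (-(1 / b)) / n) := fun y hy => by
      have h1 := measure_card_filter_mem_le hX hlaw hind
        (Metric.isClosed_closedBall (x := y) (ε := δ)).measurableSet (hmass y hy) k hcard0
      rw [← ofReal_measureReal]
      refine ENNReal.ofReal_le_ofReal (h1.trans ?_)
      have h2 : (n : ℝ) ^ (-(1 / b)) / n = Real.exp (-(1 / b) * Real.log n - Real.log n) := by
        rw [Real.exp_sub, Real.exp_log hn0, Real.rpow_def_of_pos hn0]
        congr 2
        ring
      rw [h2, Real.exp_le_exp]
      -- The factor `6` in `p` compensates the `1 / 2` of the Chernoff exponent and the `1 / 3` of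
      -- the sample proportion. What remains absorbs `k` and leaves a tail of `n ^ (-1 - 1/b)`.
      have h3 : (1 + 1 / b) * (k + Real.log n) ≤ p * Fintype.card ι / 2 := by
        calc _ = p * (n / 3) / 2 := by rw [hp]; field_simp; ring
          _ ≤ _ := by gcongr
      have h4 : 0 ≤ 1 / b * k := by positivity
      nlinarith
    -- The net has at most `3 ^ b / p ≤ 3 ^ b * n` points, so the union bound loses one factor `n`
    -- of the tail.
    have hc' : (c.card : ℝ) * (1 / n) ≤ 3 ^ b := by
      have h1 : min (a * (δ / 3) ^ b) 1 = p / 3 ^ b := by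
        rw [Real.div_rpow hδ0.le (by norm_num), ← mul_div_assoc, hδb, min_eq_left]
        rw [div_le_one (by positivity)]
        exact hp1.trans (Real.one_le_rpow (by norm_num) hb.le)
      rw [h1] at hcc
      have h2 : (c.card : ℝ) * p ≤ 3 ^ b := by
        rw [mul_div_assoc', div_le_one (by positivity)] at hcc
        exact hcc
      exact le_trans (by gcongr) h2
    calc P E ≤ ∑ y ∈ c, P {ω | (Finset.univ.filter fun i =>
            X i ω ∈ Metric.closedBall y δ).card ≤ k} := measure_biUnion_finset_le _ _
      _ ≤ ∑ y ∈ c, ENNReal.ofReal ((n : ℝ) ^ (-(1 / b)) / n) := Finset.sum_le_sum hexp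
      _ = ENNReal.ofReal (c.card * (1 / n) * (n : ℝ) ^ (-(1 / b))) := by
          rw [Finset.sum_const, nsmul_eq_mul, ← ENNReal.ofReal_natCast,
            ← ENNReal.ofReal_mul (by positivity)]
          congr 1
          ring
      _ ≤ _ := by
          refine ENNReal.ofReal_le_ofReal ?_
          gcongr
  · intro ω hω x hx
    obtain ⟨y, hy, hxy⟩ := hcov x hx
    simp only [hE, Set.mem_iUnion, Set.mem_ofPred_eq, not_exists, not_le] at hω
    refine (hω y hy).le.trans (Finset.card_le_card ?_)
    intro i hi
    simp only [Finset.mem_filter, Finset.mem_univ, true_and, Metric.mem_closedBall] at hi ⊢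
    rw [← dist_eq_norm]
    calc dist (X i ω) x ≤ dist (X i ω) y + dist x y := dist_triangle_right _ _ _
      _ ≤ _ := by linarith

end NearestNeighbours

/-! ### Deterministic decomposition of the error. -/

section ErrorDecomposition

theorem norm_average_sub_le {ι E : Type*} [NormedAddCommGroup E] [NormedSpace ℝ E]
    {s : Finset ι} {r : ℝ} (hr : 0 < r) (hs : (s.card : ℝ) = r) {v : ι → E} {w : E} {C : ℝ}
    (h : ∀ i ∈ s, ‖v i - w‖ ≤ C) : ‖(1 / r) • ∑ i ∈ s, v i - w‖ ≤ C := by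
  have h1 : (1 / r) • ∑ i ∈ s, v i - w = (1 / r) • ∑ i ∈ s, (v i - w) := by
    rw [Finset.sum_sub_distrib, Finset.sum_const, smul_sub, ← Nat.cast_smul_eq_nsmul ℝ, hs,
      smul_smul, one_div_mul_cancel hr.ne', one_smul]
  rw [h1, norm_smul, Real.norm_of_nonneg (by positivity), one_div, inv_mul_le_iff₀ hr]
  refine (norm_sum_le _ _).trans ((Finset.sum_le_sum h).trans ?_)
  rw [Finset.sum_const, nsmul_eq_mul, hs]

variable {D : ℕ} {L : ℝ≥0} {M T σ : ℝ} {f : Space D → Space D} {n m k₁ k₂ k r : ℕ}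
  {X : ℕ → Space D} {ε : ℕ → ℕ → Space D}

theorem gridTime_nonneg (hT : 0 < T) (j : ℕ) : 0 ≤ gridTime T m j := by
  unfold gridTime; positivity

theorem gridTime_le (hT : 0 < T) (hm : 0 < m) {j : ℕ} (hj : j ≤ m) : gridTime T m j ≤ T := by
  unfold gridTime
  rw [div_le_iff₀ (by positivity), mul_comm]
  gcongr

theorem gridTime_sub_gridTime (j j' : ℕ) :
    gridTime T m j - gridTime T m j' = ((j : ℝ) - j') * (T / m) := by
  unfold gridTime; ring

theorem abs_gridTime_sub_le (hT : 0 < T) {j j' : ℕ} {c : ℝ} (h : |(j : ℝ) - j'| ≤ c) :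
    |gridTime T m j - gridTime T m j'| ≤ c * (T / m) := by
  rw [gridTime_sub_gridTime, abs_mul, abs_of_nonneg (by positivity : 0 ≤ T / (m : ℝ))]
  gcongr

theorem le_card_filter_gridTime (hT : 0 < T) {j : ℕ} (hj : j ∈ Finset.Icc 1 m) (hk : k ≤ m) :
    k ≤ ((Finset.Icc 1 m).filter
      fun q => |gridTime T m q - gridTime T m j| ≤ k * (T / m)).card := by
  rw [Finset.mem_Icc] at hj
  -- With truncated subtraction this window is the `k` indices ending at `j`, or `1, …, k` when `j <
  -- k`; the case of an early time needs no separate treatment.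
  have h : Finset.Icc (j - k + 1) (j - k + k) ⊆ (Finset.Icc 1 m).filter
      fun q => |gridTime T m q - gridTime T m j| ≤ k * (T / m) := by
    intro q hq
    rw [Finset.mem_Icc] at hq
    refine Finset.mem_filter.2 ⟨Finset.mem_Icc.2 (by omega), abs_gridTime_sub_le hT ?_⟩
    have h1 : (q : ℝ) ≤ j + k := by exact_mod_cast (by omega : q ≤ j + k)
    have h2 : (j : ℝ) ≤ q + k := by exact_mod_cast (by omega : j ≤ q + k)
    exact abs_le.2 ⟨by linarith, by linarith⟩
  have := Finset.card_le_card h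
  rw [Nat.card_Icc] at this
  omega

theorem exists_gridTime_near (hT : 0 < T) (hkm : 2 * k + 2 ≤ m) {t : ℝ} (ht : t ∈ Set.Icc 0 T) :
    ∃ j ∈ Finset.Icc (k + 1) (m - k - 1), |gridTime T m j - t| ≤ (k + 2) * (T / m) := by
  have hm : (0 : ℝ) < m := by exact_mod_cast (by omega : 0 < m)
  set u := t * m / T with hu
  have hu0 : 0 ≤ u := div_nonneg (mul_nonneg ht.1 hm.le) hT.le
  have hum : u ≤ m := by
    rw [hu, div_le_iff₀ hT, mul_comm]
    gcongr
    exact ht.2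
  have h1 := Nat.floor_le hu0
  have h2 := Nat.lt_floor_add_one u
  have h3 : ⌊u⌋₊ ≤ m := by exact_mod_cast (h1.trans hum)
  -- Rounding down moves `u` by at most one index and clamping to the admissible range by at most `k
  -- + 1`, which gives the factor `k + 2`.
  set j := max (k + 1) (min ⌊u⌋₊ (m - k - 1)) with hj
  refine ⟨j, Finset.mem_Icc.2 (by omega), ?_⟩
  have h4 : (j : ℝ) ≤ ⌊u⌋₊ + (k + 1) := by exact_mod_cast (by omega : j ≤ ⌊u⌋₊ + (k + 1))
  have h5 : (⌊u⌋₊ : ℝ) ≤ j + (k + 1) := by exact_mod_cast (by omega : ⌊u⌋₊ ≤ j + (k + 1))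
  have h6 : gridTime T m j - t = (j - u) * (T / m) := by
    rw [gridTime, hu]; field_simp
  rw [h6, abs_mul, abs_of_nonneg (by positivity : 0 ≤ T / (m : ℝ))]
  gcongr
  exact abs_le.2 ⟨by linarith, by linarith⟩

theorem flowEst_add (Y Z : ℕ → ℕ → Space D) (z : Space D) (t : ℝ) :
    flowEst T n m k₁ k₂ X (fun i j => Y i j + Z i j) z t
      = flowEst T n m k₁ k₂ X Y z t + flowEst T n m k₁ k₂ X Z z t := by
  simp only [flowEst, Finset.sum_add_distrib, smul_add]

theorem derivEst_add (Y Z : ℕ → ℕ → Space D) (i j : ℕ) :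
    derivEst T m k (fun i j => Y i j + Z i j) i j = derivEst T m k Y i j + derivEst T m k Z i j := by
  simp only [derivEst, ← Finset.sum_add_distrib, ← smul_add]
  refine Finset.sum_congr rfl fun l _ => ?_
  congr 1
  abel

theorem norm_flowEst_flow_sub_le (hf : f ∈ LipClass D L M) (hT : 0 < T) {z : Space D} {ρ : ℝ}
    (hk₁ : 0 < k₁) (hk₂ : 0 < k₂) (hk₂m : k₂ ≤ m) {j : ℕ} (hj : j ∈ Finset.Icc 1 m)
    (hρ : k₁ ≤ ((Finset.Icc 1 (n / 2)).filter fun i => ‖X i - z‖ ≤ ρ).card) :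
    ‖flowEst T n m k₁ k₂ X (fun i j => flow f (X i) (gridTime T m j)) z (gridTime T m j)
        - flow f z (gridTime T m j)‖ ≤ Real.exp (L * T) * ρ + M * (k₂ * (T / m)) := by
  have hM := LipClass.nonneg hf
  have hk₁n := hρ.trans (Finset.card_filter_le _ _)
  have hk₂' : k₂ ≤ (Finset.Icc 1 m).card := by simpa using hk₂m
  set S := nearest (Finset.Icc 1 (n / 2)) (fun i => ‖X i - z‖) k₁ with hS
  set Q := nearest (Finset.Icc 1 m) (fun q => |gridTime T m q - gridTime T m j|) k₂ with hQ
  have hSQ : ((S ×ˢ Q).card : ℝ) = (k₁ : ℝ) * k₂ := by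
    rw [Finset.card_product, card_nearest _ hk₁n, card_nearest _ hk₂', Nat.cast_mul]
  have := norm_average_sub_le (E := Space D) (s := S ×ˢ Q)
    (v := fun p => flow f (X p.1) (gridTime T m p.2))
    (w := flow f z (gridTime T m j)) (C := Real.exp (L * T) * ρ + M * (k₂ * (T / m)))
    (r := (k₁ : ℝ) * k₂) (by positivity) hSQ ?_
  · rwa [Finset.sum_product] at this
  rintro ⟨p, q⟩ hpq
  rw [Finset.mem_product] at hpq
  have h1 : ‖X p - z‖ ≤ ρ := le_of_mem_nearest hρ hpq.1
  have h2 : |gridTime T m q - gridTime T m j| ≤ k₂ * (T / m) :=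
    le_of_mem_nearest (d := fun q => |gridTime T m q - gridTime T m j|)
      (le_card_filter_gridTime hT hj hk₂m) hpq.2
  have hq := Finset.mem_Icc.1 (nearest_subset _ hk₂' hpq.2)
  have hm : 0 < m := by omega
  calc _ ≤ ‖flow f (X p) (gridTime T m q) - flow f z (gridTime T m q)‖
        + ‖flow f z (gridTime T m q) - flow f z (gridTime T m j)‖ := by
        exact norm_sub_le_norm_sub_add_norm_sub _ _ _
    _ ≤ Real.exp (L * T) * ‖X p - z‖ + M * |gridTime T m q - gridTime T m j| :=
        add_le_add (norm_flow_sub_flow_le_exp_of_le hf _ _ (gridTime_nonneg hT _)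
          (gridTime_le hT hm hq.2))
          (norm_flow_sub_flow_le hf _ (gridTime_nonneg hT _) (gridTime_nonneg hT _))
    _ ≤ _ := by gcongr

theorem sum_weight (hk : 0 < k) : ∑ l ∈ Finset.Icc 1 k, weight k l = 1 := by
  have h : ∀ k : ℕ, ∑ l ∈ Finset.Icc 1 k, 6 * (l : ℝ) ^ 2 = (k : ℝ) * (k + 1) * (2 * k + 1) := by
    intro k
    induction k with
    | zero => simp
    | succ k ih => rw [Finset.sum_Icc_succ_top (by omega), ih]; push_cast; ring
  unfold weight
  rw [← Finset.sum_div, h, div_self (by positivity)]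

theorem weight_nonneg (l : ℕ) : 0 ≤ weight k l := by unfold weight; positivity

theorem norm_derivEst_flow_sub_le (hf : f ∈ LipClass D L M) (hT : 0 < T) (hk : 0 < k) {i j : ℕ}
    (hj : j ∈ Finset.Icc (k + 1) (m - k - 1)) :
    ‖derivEst T m k (fun i j => flow f (X i) (gridTime T m j)) i j
        - f (flow f (X i) (gridTime T m j))‖ ≤ L * M * (k * (T / m)) := by
  have hM := LipClass.nonneg hf
  rw [Finset.mem_Icc] at hj
  have hm : (0 : ℝ) < m := by exact_mod_cast (by omega : 0 < m)
  have h1 : f (flow f (X i) (gridTime T m j))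
      = ∑ l ∈ Finset.Icc 1 k, weight k l • f (flow f (X i) (gridTime T m j)) := by
    rw [← Finset.sum_smul, sum_weight hk, one_smul]
  rw [derivEst, h1, ← Finset.sum_sub_distrib]
  calc _ ≤ ∑ l ∈ Finset.Icc 1 k, weight k l * (L * M * (k * (T / m))) := by
        refine norm_sum_le_of_le _ fun l hl => ?_
        rw [Finset.mem_Icc] at hl
        set h : ℝ := l * (T / m) with hh
        have hl0 : (0 : ℝ) < l := by exact_mod_cast hl.1
        have hlk : (l : ℝ) ≤ k := by exact_mod_cast hl.2
        have h0 : 0 < h := by positivity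
        have e1 : gridTime T m (j + l) = gridTime T m j + h := by
          rw [gridTime, gridTime, hh]; push_cast; ring
        have e2 : gridTime T m (j - l) = gridTime T m j - h := by
          rw [gridTime, gridTime, hh, Nat.cast_sub (by omega)]; ring
        have hjl : h ≤ gridTime T m j := by
          have := gridTime_nonneg (m := m) hT (j - l)
          rw [e2] at this
          linarith
        have h2 := norm_flow_symm_diff_le hf (X i) h0.le hjl
        rw [e1, e2]
        have e3 : (weight k l / (gridTime T m j + h - (gridTime T m j - h))) •
            (flow f (X i) (gridTime T m j + h) - flow f (X i) (gridTime T m j - h))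
            - weight k l • f (flow f (X i) (gridTime T m j))
            = (weight k l / (2 * h)) •
              ((flow f (X i) (gridTime T m j + h) - flow f (X i) (gridTime T m j - h))
                - (2 * h) • f (flow f (X i) (gridTime T m j))) := by
          rw [smul_sub (weight k l / (2 * h)) _ ((2 * h) • _), smul_smul,
            div_mul_cancel₀ _ (by positivity),
            show gridTime T m j + h - (gridTime T m j - h) = 2 * h by ring]
        rw [e3, norm_smul, Real.norm_of_nonneg (div_nonneg (weight_nonneg _) (by positivity))]
        have hw := weight_nonneg (k := k) l
        calc _ ≤ weight k l / (2 * h) * (L * M * h * (2 * h)) := by gcongr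
          _ = weight k l * (L * M * h) := by field_simp
          _ ≤ _ := by rw [hh]; gcongr
    _ = _ := by rw [← Finset.sum_mul, sum_weight hk, one_mul]

/-- The contribution of the noise to the estimator of the vector field. -/
noncomputable def fieldNoise {D : ℕ} (T σ : ℝ) (n m k₁ k₂ k r : ℕ) (X : ℕ → Space D) (Y ε : ℕ → ℕ → Space D)
    (x : Space D) : Space D :=
  (1 / (r : ℝ)) •
    ∑ i ∈ nearest (Finset.Icc (n / 2 + 1) n) (trajDist T n m k₁ k₂ k X Y x) r,
      derivEst T m k (fun i j => σ • ε i j) i (timeIdx T n m k₁ k₂ k X Y x i)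

theorem timeIdx_mem (hkm : 2 * k + 2 ≤ m) (Y : ℕ → ℕ → Space D) (x : Space D) (i : ℕ) :
    timeIdx T n m k₁ k₂ k X Y x i ∈ Finset.Icc (k + 1) (m - k - 1) :=
  argminIdx_mem (Finset.nonempty_Icc.2 (by omega)) _

theorem norm_fieldEst_sub_le (hf : f ∈ LipClass D L M) (hT : 0 < T) (hk : 0 < k) (hr : 0 < r)
    (hkm : 2 * k + 2 ≤ m) (hrn : r ≤ n - n / 2) (x : Space D) {C : ℝ}
    (hC : ∀ i ∈ nearest (Finset.Icc (n / 2 + 1) n)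
        (trajDist T n m k₁ k₂ k X (observation f T σ m X ε) x) r,
      ‖f (flow f (X i) (gridTime T m (timeIdx T n m k₁ k₂ k X (observation f T σ m X ε) x i)))
        - f x‖ ≤ C) :
    ‖fieldEst T n m k₁ k₂ k r X (observation f T σ m X ε) x - f x‖
      ≤ ‖fieldNoise T σ n m k₁ k₂ k r X (observation f T σ m X ε) ε x‖
        + (L * M * (k * (T / m)) + C) := by
  set Y := observation f T σ m X ε with hY
  set S := nearest (Finset.Icc (n / 2 + 1) n) (trajDist T n m k₁ k₂ k X Y x) r with hS
  set τ := timeIdx T n m k₁ k₂ k X Y x with hτ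
  have hScard : (S.card : ℝ) = r := by
    rw [card_nearest _ (by rw [Nat.card_Icc]; omega)]
  have h1 : fieldEst T n m k₁ k₂ k r X Y x - f x
      = fieldNoise T σ n m k₁ k₂ k r X Y ε x + ((1 / (r : ℝ)) • ∑ i ∈ S,
        derivEst T m k (fun i j => flow f (X i) (gridTime T m j)) i (τ i) - f x) := by
    have : ∀ i j, derivEst T m k Y i j = derivEst T m k (fun i j => flow f (X i) (gridTime T m j)) i j
        + derivEst T m k (fun i j => σ • ε i j) i j := fun i j => derivEst_add _ _ i j
    rw [fieldEst, fieldNoise]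
    simp only [← hS, ← hτ, this, Finset.sum_add_distrib, smul_add]
    abel
  rw [h1]
  refine (norm_add_le _ _).trans (add_le_add le_rfl ?_)
  refine norm_average_sub_le (by exact_mod_cast hr) hScard fun i hi => ?_
  refine (norm_sub_le_norm_sub_add_norm_sub _ (f (flow f (X i) (gridTime T m (τ i)))) _).trans ?_
  exact add_le_add (norm_derivEst_flow_sub_le hf hT hk (timeIdx_mem hkm Y x i)) (hC i hi)

/-- For the event on which some point of the support has no close neighbours in the sample. -/
theorem norm_fieldEst_sub_le_of_bounded (hf : f ∈ LipClass D L M) (hT : 0 < T) (hk : 0 < k)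
    (hr : 0 < r) (hkm : 2 * k + 2 ≤ m) (hrn : r ≤ n - n / 2) (x : Space D) :
    ‖fieldEst T n m k₁ k₂ k r X (observation f T σ m X ε) x - f x‖
      ≤ ‖fieldNoise T σ n m k₁ k₂ k r X (observation f T σ m X ε) ε x‖
        + (L * M * (k * (T / m)) + 2 * M) := by
  refine norm_fieldEst_sub_le hf hT hk hr hkm hrn x fun i _ => ?_
  refine (norm_sub_le _ _).trans ?_
  linarith [hf.2 x, hf.2 (flow f (X i) (gridTime T m
    (timeIdx T n m k₁ k₂ k X (observation f T σ m X ε) x i)))]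

/-- The flow estimation error `β` enters twice: it limits how close to `x` the estimates of the `r`
trajectories started near `x₀` pass, and it separates each selected estimate from the true point at
which `f` is taken. -/
theorem norm_fieldEst_sub_le_of_near (hf : f ∈ LipClass D L M) (hT : 0 < T) (hk₁ : 0 < k₁)
    (hk₂ : 0 < k₂) (hk₂m : k₂ ≤ m) (hk : 0 < k) (hr : 0 < r) (hkm : 2 * k + 2 ≤ m)
    {S : Set (Space D)} {ρ₁ ρ₂ N : ℝ}
    (hXS : ∀ i ∈ Finset.Icc (n / 2 + 1) n, X i ∈ S)
    (hρ₁ : ∀ z ∈ S, k₁ ≤ ((Finset.Icc 1 (n / 2)).filter fun i => ‖X i - z‖ ≤ ρ₁).card)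
    (hρ₂ : ∀ z ∈ S, r ≤ ((Finset.Icc (n / 2 + 1) n).filter fun i => ‖X i - z‖ ≤ ρ₂).card)
    (hN : ∀ i ∈ Finset.Icc (n / 2 + 1) n, ∀ j ∈ Finset.Icc 1 m,
      ‖flowEst T n m k₁ k₂ X (fun i j => σ • ε i j) (X i) (gridTime T m j)‖ ≤ N)
    {x : Space D} (hx : x ∈ envelope f S T) :
    ‖fieldEst T n m k₁ k₂ k r X (observation f T σ m X ε) x - f x‖
      ≤ ‖fieldNoise T σ n m k₁ k₂ k r X (observation f T σ m X ε) ε x‖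
        + (L * M * (k * (T / m)) + L * (2 * (N + (Real.exp (L * T) * ρ₁ + M * (k₂ * (T / m))))
          + (Real.exp (L * T) * ρ₂ + M * ((k + 2) * (T / m))))) := by
  have hM := LipClass.nonneg hf
  obtain ⟨x₀, hx₀, t, ht, rfl⟩ := hx
  set x := flow f x₀ t with hx
  set Y := observation f T σ m X ε with hY
  set β := N + (Real.exp (L * T) * ρ₁ + M * (k₂ * (T / m))) with hβ
  have hrn : r ≤ n - n / 2 := by
    have := (hρ₂ x₀ hx₀).trans (Finset.card_filter_le _ _)
    rw [Nat.card_Icc] at this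
    omega
  have hest : ∀ i ∈ Finset.Icc (n / 2 + 1) n, ∀ j ∈ Finset.Icc 1 m,
      ‖flowEst T n m k₁ k₂ X Y (X i) (gridTime T m j) - flow f (X i) (gridTime T m j)‖ ≤ β := by
    intro i hi j hj
    have h1 : flowEst T n m k₁ k₂ X Y (X i) (gridTime T m j)
        = flowEst T n m k₁ k₂ X (fun i j => flow f (X i) (gridTime T m j)) (X i) (gridTime T m j)
          + flowEst T n m k₁ k₂ X (fun i j => σ • ε i j) (X i) (gridTime T m j) :=
      flowEst_add _ _ _ _
    rw [h1, add_sub_right_comm, add_comm]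
    exact (norm_add_le _ _).trans (add_le_add (hN i hi j hj)
      (norm_flowEst_flow_sub_le hf hT hk₁ hk₂ hk₂m hj (hρ₁ _ (hXS i hi))))
  have hIcc : Finset.Icc (k + 1) (m - k - 1) ⊆ Finset.Icc 1 m :=
    Finset.Icc_subset_Icc (by omega) (by omega)
  set γ := β + (Real.exp (L * T) * ρ₂ + M * ((k + 2) * (T / m))) with hγ
  obtain ⟨j, hj, hjt⟩ := exists_gridTime_near hT hkm ht
  have hm : 0 < m := by omega
  have hnear : ∀ i ∈ Finset.Icc (n / 2 + 1) n, ‖X i - x₀‖ ≤ ρ₂ →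
      trajDist T n m k₁ k₂ k X Y x i ≤ γ := by
    intro i hi hiρ
    have hjm := Finset.mem_Icc.1 (hIcc hj)
    calc trajDist T n m k₁ k₂ k X Y x i
        ≤ ‖flowEst T n m k₁ k₂ X Y (X i) (gridTime T m j) - x‖ :=
          argminIdx_le (fun j => ‖flowEst T n m k₁ k₂ X Y (X i) (gridTime T m j) - x‖) hj
      _ ≤ ‖flowEst T n m k₁ k₂ X Y (X i) (gridTime T m j) - flow f (X i) (gridTime T m j)‖
          + (‖flow f (X i) (gridTime T m j) - flow f x₀ (gridTime T m j)‖
          + ‖flow f x₀ (gridTime T m j) - flow f x₀ t‖) :=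
          (norm_sub_le_norm_sub_add_norm_sub _ _ _).trans
            (add_le_add le_rfl (norm_sub_le_norm_sub_add_norm_sub _ _ _))
      _ ≤ β + (Real.exp (L * T) * ‖X i - x₀‖ + M * |gridTime T m j - t|) :=
          add_le_add (hest i hi j (hIcc hj)) (add_le_add
            (norm_flow_sub_flow_le_exp_of_le hf _ _ (gridTime_nonneg hT _) (gridTime_le hT hm hjm.2))
            (norm_flow_sub_flow_le hf _ ht.1 (gridTime_nonneg hT _)))
      _ ≤ γ := by rw [hγ]; gcongr
  -- The selected trajectories need not start near `x₀`. It suffices that `r` trajectories have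
  -- estimates within `γ` of `x`.
  have hcount : r ≤ ((Finset.Icc (n / 2 + 1) n).filter
      fun i => trajDist T n m k₁ k₂ k X Y x i ≤ γ).card := by
    refine (hρ₂ x₀ hx₀).trans (Finset.card_le_card fun i hi => ?_)
    rw [Finset.mem_filter] at hi ⊢
    exact ⟨hi.1, hnear i hi.1 hi.2⟩
  refine norm_fieldEst_sub_le hf hT hk hr hkm hrn x fun i hi => ?_
  have hi' : i ∈ Finset.Icc (n / 2 + 1) n :=
    nearest_subset _ (hcount.trans (Finset.card_filter_le _ _)) hi
  have htd : trajDist T n m k₁ k₂ k X Y x i ≤ γ := le_of_mem_nearest hcount hi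
  set τ := timeIdx T n m k₁ k₂ k X Y x i with hτ
  have h1 := hf.1.dist_le_mul (flow f (X i) (gridTime T m τ)) x
  rw [dist_eq_norm, dist_eq_norm] at h1
  refine h1.trans ?_
  gcongr
  calc _ ≤ ‖flow f (X i) (gridTime T m τ) - flowEst T n m k₁ k₂ X Y (X i) (gridTime T m τ)‖
        + ‖flowEst T n m k₁ k₂ X Y (X i) (gridTime T m τ) - x‖ :=
        norm_sub_le_norm_sub_add_norm_sub _ _ _
    _ ≤ β + γ := by
        refine add_le_add ?_ htd
        rw [norm_sub_rev]
        exact hest i hi' τ (hIcc (timeIdx_mem hkm Y x i))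
    _ = _ := by rw [hγ]; ring

end ErrorDecomposition

/-! ### Sums over pairs of indices. -/

section Sums

variable {E : Type*} [AddCommMonoid E]

theorem sum_coe_prod (s t : Finset ℕ) (g : ℕ → ℕ → E) :
    ∑ p : s × t, g p.1 p.2 = ∑ i ∈ s, ∑ j ∈ t, g i j := by
  rw [Fintype.sum_prod_type]
  simp_rw [Finset.sum_coe_sort t (g _)]
  exact Finset.sum_coe_sort s fun i => ∑ j ∈ t, g i j

theorem sum_sum_subset {S U Q V : Finset ℕ} (hS : S ⊆ U) (hQ : Q ⊆ V) {g : ℕ → ℕ → E}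
    (h : ∀ i j, ¬ (i ∈ S ∧ j ∈ Q) → g i j = 0) :
    ∑ i ∈ U, ∑ j ∈ V, g i j = ∑ i ∈ S, ∑ j ∈ Q, g i j := by
  rw [← Finset.sum_product', ← Finset.sum_product']
  symm
  refine Finset.sum_subset (Finset.product_subset_product hS hQ) fun p _ hp => h _ _ ?_
  rwa [Finset.mem_product] at hp

end Sums

/-! ### Measurability of the flow estimator. -/

section Measurability

variable {D : ℕ} {Ω : Type*} [MeasurableSpace Ω] {n m k₁ k₂ : ℕ} {T σ : ℝ}
  {X : ℕ → Ω → Space D}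

theorem measurable_flowEst {Y : ℕ → ℕ → Ω → Space D} {z : Ω → Space D}
    (hX : ∀ i ∈ Finset.Icc 1 (n / 2), Measurable (X i)) (hz : Measurable z)
    (hY : ∀ i ∈ Finset.Icc 1 (n / 2), ∀ j ∈ Finset.Icc 1 m, Measurable (Y i j))
    (hk₁ : k₁ ≤ n / 2) (hk₂ : k₂ ≤ m) (t : ℝ) :
    Measurable fun ω =>
      flowEst T n m k₁ k₂ (fun i => X i ω) (fun i j => Y i j ω) (z ω) t := by
  classical
  unfold flowEst
  suffices key : Measurable fun ω => ∑ p ∈ nearest (Finset.Icc 1 (n / 2))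
      (fun i => ‖X i ω - z ω‖) k₁, ∑ q ∈ nearest (Finset.Icc 1 m)
        (fun j => |gridTime T m j - t|) k₂, Y p q ω from
    key.const_smul (1 / ((k₁ : ℝ) * k₂))
  set Q := nearest (Finset.Icc 1 m) (fun j => |gridTime T m j - t|) k₂ with hQ
  have hQm : Q ⊆ Finset.Icc 1 m := nearest_subset _ (by simpa using hk₂)
  -- The random neighbour set takes finitely many values, and on each of them the sum is over a
  -- fixed set.
  have h1 : ∀ ω, ∑ p ∈ nearest (Finset.Icc 1 (n / 2)) (fun i => ‖X i ω - z ω‖) k₁,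
      ∑ q ∈ Q, Y p q ω = ∑ S ∈ (Finset.Icc 1 (n / 2)).powerset,
        {ω | nearest (Finset.Icc 1 (n / 2)) (fun i => ‖X i ω - z ω‖) k₁ = S}.indicator
          (fun ω => ∑ p ∈ S, ∑ q ∈ Q, Y p q ω) ω := by
    intro ω
    rw [Finset.sum_eq_single (nearest (Finset.Icc 1 (n / 2)) (fun i => ‖X i ω - z ω‖) k₁)]
    · simp [Set.indicator]
    · intro S _ hS
      exact Set.indicator_of_notMem (fun h => hS h.symm) _
    · intro h
      exact absurd (Finset.mem_powerset.2 (nearest_subset _ (by simpa using hk₁))) h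
  simp_rw [h1]
  refine Finset.measurable_sum _ fun S hS => Measurable.indicator ?_ ?_
  · exact Finset.measurable_sum _ fun p hp => Finset.measurable_sum _ fun q hq =>
      hY p (Finset.mem_powerset.1 hS hp) q (hQm hq)
  · exact measurableSet_nearest_eq (d := fun i ω => ‖X i ω - z ω‖)
      (fun i hi => ((hX i hi).sub hz).norm) k₁ S

theorem measurable_observation {L : ℝ≥0} {M : ℝ} {f : Space D → Space D}
    (hf : f ∈ LipClass D L M) (hT : 0 < T) {ε : ℕ → ℕ → Ω → Space D} {i j : ℕ}
    (hX : Measurable (X i)) (hε : Measurable (ε i j)) :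
    Measurable fun ω => observation f T σ m (fun i => X i ω) (fun i j => ε i j ω) i j :=
  ((continuous_flow hf (gridTime_nonneg hT j)).measurable.comp hX).add (hε.const_smul σ)

end Measurability

/-! ### Noise of the flow estimator. -/

section FlowNoise

variable {D : ℕ} {Ω : Type*} {𝓕 mΩ : MeasurableSpace Ω} {P : Measure Ω} {n m k₁ k₂ : ℕ} {T σ : ℝ}
  {X : ℕ → Ω → Space D} {ε : ℕ → ℕ → Ω → Space D} {μ : Measure (Space D)}

/-- The coefficients of an average over `S × Q`, scaled by `σ`. -/
noncomputable def averageCoef (σ : ℝ) (k₁ k₂ : ℕ) (S Q : Finset ℕ) (i j : ℕ) : ℝ :=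
  if i ∈ S ∧ j ∈ Q then σ / (k₁ * k₂) else 0

theorem sum_averageCoef_sq {S Q U V : Finset ℕ} (hS : S ⊆ U) (hQ : Q ⊆ V) (hSc : S.card = k₁)
    (hQc : Q.card = k₂) (hk₁ : 0 < k₁) (hk₂ : 0 < k₂) :
    ∑ i ∈ U, ∑ j ∈ V, averageCoef σ k₁ k₂ S Q i j ^ 2 = (σ / √(k₁ * k₂)) ^ 2 := by
  rw [sum_sum_subset hS hQ fun i j h => by simp [averageCoef, h]]
  have : ∀ i ∈ S, ∑ j ∈ Q, averageCoef σ k₁ k₂ S Q i j ^ 2 = k₂ * (σ / (k₁ * k₂)) ^ 2 := by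
    intro i hi
    rw [Finset.sum_congr rfl fun j hj => by rw [averageCoef, if_pos ⟨hi, hj⟩], Finset.sum_const, hQc,
      nsmul_eq_mul]
  rw [Finset.sum_congr rfl this, Finset.sum_const, hSc, nsmul_eq_mul, div_pow σ √_,
    Real.sq_sqrt (by positivity)]
  field_simp

theorem sum_averageCoef_smul {S Q U V : Finset ℕ} (hS : S ⊆ U) (hQ : Q ⊆ V)
    (v : ℕ → ℕ → Space D) :
    ∑ i ∈ U, ∑ j ∈ V, averageCoef σ k₁ k₂ S Q i j • v i j
      = (1 / ((k₁ : ℝ) * k₂)) • ∑ i ∈ S, ∑ j ∈ Q, σ • v i j := by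
  rw [sum_sum_subset hS hQ fun i j h => by simp [averageCoef, h], Finset.smul_sum]
  refine Finset.sum_congr rfl fun i hi => ?_
  rw [Finset.smul_sum]
  refine Finset.sum_congr rfl fun j hj => ?_
  rw [averageCoef, if_pos ⟨hi, hj⟩, smul_smul]
  congr 1
  ring

/-- The noise of the flow estimator, uniformly over the starting points of the second half of the
sample and the grid times. -/
theorem exists_bound_flowEst_noise (hs : IsSample P n m μ X ε) (h𝓕 : 𝓕 ≤ mΩ)
    (hXm : ∀ i ∈ Finset.Icc 1 n, Measurable[𝓕] (X i))
    (hind : Indep 𝓕 (MeasurableSpace.comap (fun ω (p : Finset.Icc 1 n × Finset.Icc 1 m) =>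
      ε p.1 p.2 ω) inferInstance) P) (hσ : 0 < σ) (hk₁ : 0 < k₁)
    (hk₂ : 0 < k₂) (hk₁n : k₁ ≤ n / 2) (hk₂m : k₂ ≤ m) (hnm : 3 ≤ n * m) :
    ∃ g : Ω → ℝ, Measurable g ∧ (∀ ω, 0 ≤ g ω) ∧
      (∀ ω, ∀ i ∈ Finset.Icc (n / 2 + 1) n, ∀ j ∈ Finset.Icc 1 m,
        ‖flowEst T n m k₁ k₂ (fun i => X i ω) (fun i j => σ • ε i j ω) (X i ω) (gridTime T m j)‖
          ≤ g ω) ∧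
      ∫⁻ ω, ENNReal.ofReal (g ω) ∂P
        ≤ ENNReal.ofReal (4 * D * (σ / √(k₁ * k₂)) * √(Real.log (n * m))) := by
  classical
  set Q : ℕ → Finset ℕ := fun j => nearest (Finset.Icc 1 m)
    (fun q => |gridTime T m q - gridTime T m j|) k₂ with hQ
  have hQm : ∀ j, Q j ⊆ Finset.Icc 1 m := fun j => nearest_subset _ (by simpa using hk₂m)
  have hQc : ∀ j, (Q j).card = k₂ := fun j => card_nearest _ (by simpa using hk₂m)
  set N : ℕ → Ω → Finset ℕ := fun i ω =>
    nearest (Finset.Icc 1 (n / 2)) (fun p => ‖X p ω - X i ω‖) k₁ with hN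
  have hNn : ∀ i ω, N i ω ⊆ Finset.Icc 1 (n / 2) := fun i ω => nearest_subset _ (by simpa using hk₁n)
  have hNc : ∀ i ω, (N i ω).card = k₁ := fun i ω => card_nearest _ (by simpa using hk₁n)
  have hhalf : Finset.Icc 1 (n / 2) ⊆ Finset.Icc 1 n := Finset.Icc_subset_Icc le_rfl (by omega)
  obtain ⟨g, hg, hg0, hgb, hgi⟩ := exists_measurable_bound_of_selected (P := P) (m := 𝓕)
    (η := fun (p : Finset.Icc 1 n × Finset.Icc 1 m) ω => ε p.1 p.2 ω)
    (α := Finset ℕ × ℕ)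
    h𝓕 (fun p => hs.measurable_noise _ p.1.2 _ p.2.2) (fun p => hs.law_noise _ p.1.2 _ p.2.2)
    hs.indep_noise hind
    ((Finset.Icc 1 (n / 2)).powersetCard k₁ ×ˢ Finset.Icc 1 m)
    (fun a p => averageCoef σ k₁ k₂ a.1 (Q a.2) p.1 p.2)
    (s := σ / √(k₁ * k₂)) (K := n * m) (by positivity) (by exact_mod_cast hnm)
    (by
      rintro ⟨S, j⟩ ha
      rw [Finset.mem_product, Finset.mem_powersetCard] at ha
      rw [sum_coe_prod _ _ fun i j' => averageCoef σ k₁ k₂ S (Q j) i j' ^ 2]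
      exact (sum_averageCoef_sq (ha.1.1.trans hhalf) (hQm j) ha.1.2 (hQc j) hk₁ hk₂).le)
    -- The candidates are all `k₁`-subsets paired with a time, but only those that are the neighbour
    -- set of some `X i` are selected: at most `n m` pairs for each outcome.
    (fun a => ⋃ i ∈ Finset.Icc (n / 2 + 1) n, {ω | N i ω = a.1})
    (by
      intro a _
      refine Finset.measurableSet_biUnion _ fun i hi => ?_
      have hi' : i ∈ Finset.Icc 1 n := Finset.Icc_subset_Icc (by omega) le_rfl hi
      exact @measurableSet_nearest_eq Ω 𝓕 _ (fun p ω => ‖X p ω - X i ω‖)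
        (fun p hp => measurable_norm.comp ((hXm p (hhalf hp)).sub (hXm i hi'))) k₁ a.1)
    (by
      intro ω J hJ hJA
      have hsub : J ⊆ ((Finset.Icc (n / 2 + 1) n).image fun i => N i ω) ×ˢ Finset.Icc 1 m := by
        intro a ha
        have h1 := hJA a ha
        simp only [Set.mem_iUnion, Set.mem_ofPred_eq, exists_prop] at h1
        obtain ⟨i, hi, h⟩ := h1
        exact Finset.mem_product.2 ⟨Finset.mem_image.2 ⟨i, hi, h⟩, (Finset.mem_product.1 (hJ ha)).2⟩
      have h2 := (Finset.card_le_card hsub).trans_eq (Finset.card_product _ _)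
      have h3 : ((Finset.Icc (n / 2 + 1) n).image fun i => N i ω).card ≤ n :=
        Finset.card_image_le.trans (by rw [Nat.card_Icc]; omega)
      rw [Nat.card_Icc, Nat.add_sub_cancel] at h2
      exact_mod_cast h2.trans (Nat.mul_le_mul_right m h3))
  refine ⟨g, hg, hg0, fun ω i hi j hj => ?_, hgi⟩
  have h1 := hgb ω (N i ω, j) (Finset.mem_product.2
    ⟨Finset.mem_powersetCard.2 ⟨hNn i ω, hNc i ω⟩, hj⟩)
    (by simp only [Set.mem_iUnion]; exact ⟨i, hi, rfl⟩)
  simp only at h1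
  rw [sum_coe_prod _ _ fun i' j' => averageCoef σ k₁ k₂ (N i ω) (Q j) i' j' • ε i' j' ω,
    sum_averageCoef_smul ((hNn i ω).trans hhalf) (hQm j)] at h1
  exact h1

end FlowNoise

/-! ### Coefficients of the derivative estimator. -/

section DifferenceCoefficients

variable {D : ℕ} {m k j : ℕ} {T : ℝ}

/-- The weight of the `l`-th symmetric difference. -/
noncomputable def diffWeight (T : ℝ) (m k j l : ℕ) : ℝ :=
  weight k l / (gridTime T m (j + l) - gridTime T m (j - l))

/-- The coefficient of the `q`-th observation in the derivative estimator at the `j`-th time. -/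
noncomputable def diffCoef (T : ℝ) (m k j q : ℕ) : ℝ :=
  ∑ l ∈ Finset.Icc 1 k, diffWeight T m k j l *
    ((if q = j + l then 1 else 0) - (if q = j - l then 1 else 0))

theorem sum_diffCoef_smul (hj : j ∈ Finset.Icc (k + 1) (m - k - 1)) (Y : ℕ → ℕ → Space D)
    (i : ℕ) : ∑ q ∈ Finset.Icc 1 m, diffCoef T m k j q • Y i q = derivEst T m k Y i j := by
  rw [Finset.mem_Icc] at hj
  simp only [diffCoef, Finset.sum_smul]
  rw [Finset.sum_comm, derivEst]
  refine Finset.sum_congr rfl fun l hl => ?_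
  rw [Finset.mem_Icc] at hl
  have h1 : j + l ∈ Finset.Icc 1 m := Finset.mem_Icc.2 (by omega)
  have h2 : j - l ∈ Finset.Icc 1 m := Finset.mem_Icc.2 (by omega)
  simp only [mul_smul, sub_smul, ite_smul, one_smul, zero_smul, smul_sub, Finset.sum_sub_distrib]
  rw [← Finset.smul_sum, ← Finset.smul_sum, Finset.sum_ite_eq' _ (j + l), if_pos h1,
    Finset.sum_ite_eq' _ (j - l), if_pos h2, diffWeight]

theorem diffWeight_mem (hT : 0 < T) (hk : 0 < k) (hj : j ∈ Finset.Icc (k + 1) (m - k - 1)) {l : ℕ}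
    (hl : l ∈ Finset.Icc 1 k) :
    diffWeight T m k j l ∈ Set.Icc 0 (3 * m / (2 * T * k ^ 2)) := by
  rw [Finset.mem_Icc] at hj hl
  have hm : (0 : ℝ) < m := by exact_mod_cast (by omega : 0 < m)
  have hl0 : (0 : ℝ) < l := by exact_mod_cast hl.1
  have hlk : (l : ℝ) ≤ k := by exact_mod_cast hl.2
  have hk0 : (0 : ℝ) < k := by exact_mod_cast hk
  -- Dividing weights proportional to `l ^ 2` by time gaps proportional to `l` gives coefficients
  -- linear in `l`, those of the local least-squares slope.
  have h1 : diffWeight T m k j l = 3 * m * l / (T * (k * (k + 1) * (2 * k + 1))) := by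
    rw [diffWeight, weight, gridTime_sub_gridTime, Nat.cast_sub (by omega)]
    push_cast
    have : (j : ℝ) + l - (j - l) = 2 * l := by ring
    rw [this]
    field_simp
    ring
  rw [h1]
  refine ⟨by positivity, ?_⟩
  rw [div_le_div_iff₀ (by positivity) (by positivity)]
  have h2 : (k : ℝ) * (k + 1) * (2 * k + 1) ≥ 2 * k ^ 3 := by nlinarith [sq_nonneg (k : ℝ)]
  calc 3 * (m : ℝ) * l * (2 * T * k ^ 2) ≤ 3 * m * k * (2 * T * k ^ 2) := by gcongr
    _ = 3 * m * (T * (2 * k ^ 3)) := by ring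
    _ ≤ _ := by gcongr

theorem abs_diffCoef_le (hT : 0 < T) (hk : 0 < k) (hj : j ∈ Finset.Icc (k + 1) (m - k - 1))
    (q : ℕ) : |diffCoef T m k j q| ≤ 3 * m / (2 * T * k ^ 2) := by
  classical
  set V := 3 * (m : ℝ) / (2 * T * k ^ 2) with hV
  have hV0 : 0 ≤ V := by positivity
  have hj' := Finset.mem_Icc.1 hj
  have key : ∀ (p : ℕ → Prop) [DecidablePred p], (∀ l ∈ Finset.Icc 1 k, ∀ l' ∈ Finset.Icc 1 k, p l → p l' → l = l') →
      ∑ l ∈ Finset.Icc 1 k, diffWeight T m k j l * (if p l then 1 else 0) ∈ Set.Icc 0 V := by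
    intro p _ hp
    simp only [mul_ite, mul_one, mul_zero]
    rw [← Finset.sum_filter]
    constructor
    · exact Finset.sum_nonneg fun l hl => (diffWeight_mem hT hk hj (Finset.mem_filter.1 hl).1).1
    · refine (Finset.sum_le_card_nsmul _ _ V fun l hl =>
        (diffWeight_mem hT hk hj (Finset.mem_filter.1 hl).1).2).trans ?_
      have : ((Finset.Icc 1 k).filter p).card ≤ 1 := Finset.card_le_one.2 fun l hl l' hl' =>
        hp l (Finset.mem_filter.1 hl).1 l' (Finset.mem_filter.1 hl').1 (Finset.mem_filter.1 hl).2
          (Finset.mem_filter.1 hl').2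
      calc _ ≤ 1 • V := nsmul_le_nsmul_left hV0 this
        _ = V := one_nsmul V
  have h1 := key (fun l => q = j + l) fun l _ l' _ h h' => by omega
  have h2 := key (fun l => q = j - l) fun l hl l' hl' h h' => by
    rw [Finset.mem_Icc] at hl hl'; omega
  unfold diffCoef
  simp only [mul_sub, Finset.sum_sub_distrib]
  exact abs_le.2 ⟨by linarith [h1.1, h2.2], by linarith [h1.2, h2.1]⟩

theorem diffCoef_eq_zero {q : ℕ} (hq : q ∉ Finset.Icc (j - k) (j + k)) : diffCoef T m k j q = 0 := by
  refine Finset.sum_eq_zero fun l hl => ?_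
  rw [Finset.mem_Icc] at hl hq
  rw [if_neg (by omega), if_neg (by omega), sub_zero, mul_zero]

/-- At most `2 k + 1` coefficients are nonzero and each is `O(m / k ^ 2)`, since an observation
occurs in at most one difference with a given sign. Hence the variance of order `m ^ 2 / k ^ 3`. -/
theorem sum_diffCoef_sq_le (hT : 0 < T) (hk : 0 < k) (hj : j ∈ Finset.Icc (k + 1) (m - k - 1)) :
    ∑ q ∈ Finset.Icc 1 m, diffCoef T m k j q ^ 2 ≤ (3 * m / T) ^ 2 / k ^ 3 := by
  classical
  have hj' := Finset.mem_Icc.1 hj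
  have hk1 : (1 : ℝ) ≤ k := by exact_mod_cast hk
  have hsub : Finset.Icc (j - k) (j + k) ⊆ Finset.Icc 1 m := Finset.Icc_subset_Icc (by omega) (by omega)
  rw [← Finset.sum_subset hsub fun q _ hq => by rw [diffCoef_eq_zero hq]; ring]
  have h1 : ∀ q ∈ Finset.Icc (j - k) (j + k), diffCoef T m k j q ^ 2 ≤ (3 * m / (2 * T * k ^ 2)) ^ 2 :=
    fun q _ => sq_le_sq.2 ((abs_diffCoef_le hT hk hj q).trans (le_abs_self _))
  refine (Finset.sum_le_card_nsmul _ _ _ h1).trans ?_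
  have h2 : (Finset.Icc (j - k) (j + k)).card = 2 * k + 1 := by rw [Nat.card_Icc]; omega
  rw [h2, nsmul_eq_mul]
  push_cast
  have h3 : (3 * (m : ℝ) / (2 * T * k ^ 2)) ^ 2 = (3 * m / T) ^ 2 / k ^ 3 * (1 / (4 * k)) := by
    field_simp
    ring
  rw [h3]
  have h4 : (2 * (k : ℝ) + 1) * (1 / (4 * k)) ≤ 1 := by
    rw [mul_one_div, div_le_one (by positivity)]; linarith
  calc _ = (3 * m / T) ^ 2 / k ^ 3 * ((2 * (k : ℝ) + 1) * (1 / (4 * k))) := by ring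
    _ ≤ (3 * m / T) ^ 2 / k ^ 3 * 1 := by gcongr
    _ = _ := mul_one _

end DifferenceCoefficients

/-! ### Dependence of the selected indices on the query point. -/

section Selection

variable {D : ℕ} {n m k r : ℕ} {T σ : ℝ}

/-- The best time index of the `i`-th trajectory for the distances `d`. -/
noncomputable def bestTime (m k : ℕ) (d : ℕ × ℕ → ℝ) (i : ℕ) : ℕ :=
  argminIdx (Finset.Icc (k + 1) (m - k - 1)) fun j => d (i, j)

/-- The `r` best trajectories for the distances `d`. -/
noncomputable def bestTrajectories (n m k r : ℕ) (d : ℕ × ℕ → ℝ) : Finset ℕ :=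
  nearest (Finset.Icc (n / 2 + 1) n) (fun i => d (i, bestTime m k d i)) r

/-- The indices of the points of the estimated trajectories. -/
def trajectoryIndices (n m k : ℕ) : Finset (ℕ × ℕ) :=
  Finset.Icc (n / 2 + 1) n ×ˢ Finset.Icc (k + 1) (m - k - 1)

theorem bestTime_mem (hkm : 2 * k + 2 ≤ m) (d : ℕ × ℕ → ℝ) (i : ℕ) :
    bestTime m k d i ∈ Finset.Icc (k + 1) (m - k - 1) :=
  argminIdx_mem (Finset.nonempty_Icc.2 (by omega)) _

theorem bestTime_congr {d d' : ℕ × ℕ → ℝ}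
    (h : comparisons (trajectoryIndices n m k) d = comparisons (trajectoryIndices n m k) d') {i : ℕ}
    (hi : i ∈ Finset.Icc (n / 2 + 1) n) : bestTime m k d i = bestTime m k d' i :=
  argminIdx_congr fun _ hj _ hj' => le_iff_of_comparisons_eq h (Finset.mk_mem_product hi hj)
    (Finset.mk_mem_product hi hj')

theorem bestTrajectories_congr (hkm : 2 * k + 2 ≤ m) {d d' : ℕ × ℕ → ℝ}
    (h : comparisons (trajectoryIndices n m k) d = comparisons (trajectoryIndices n m k) d') :
    bestTrajectories n m k r d = bestTrajectories n m k r d' := by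
  refine nearest_congr (fun i hi i' hi' => ?_) r
  rw [← bestTime_congr h hi, ← bestTime_congr h hi']
  exact le_iff_of_comparisons_eq h (Finset.mk_mem_product hi (bestTime_mem hkm d i))
    (Finset.mk_mem_product hi' (bestTime_mem hkm d i'))

/-- The coefficients of the noise in the estimator of the vector field. -/
noncomputable def fieldCoef (T σ : ℝ) (n m k r : ℕ) (d : ℕ × ℕ → ℝ) (i q : ℕ) : ℝ :=
  if i ∈ bestTrajectories n m k r d then σ / r * diffCoef T m k (bestTime m k d i) q else 0

theorem fieldCoef_congr (hkm : 2 * k + 2 ≤ m) {d d' : ℕ × ℕ → ℝ}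
    (h : comparisons (trajectoryIndices n m k) d = comparisons (trajectoryIndices n m k) d') {i : ℕ}
    (hi : i ∈ Finset.Icc (n / 2 + 1) n) (q : ℕ) :
    fieldCoef T σ n m k r d i q = fieldCoef T σ n m k r d' i q := by
  rw [fieldCoef, fieldCoef, bestTrajectories_congr hkm h, bestTime_congr h hi]

theorem bestTrajectories_subset (hrn : r ≤ n - n / 2) (d : ℕ × ℕ → ℝ) :
    bestTrajectories n m k r d ⊆ Finset.Icc (n / 2 + 1) n :=
  nearest_subset _ (by rw [Nat.card_Icc]; omega)

theorem card_bestTrajectories (hrn : r ≤ n - n / 2) (d : ℕ × ℕ → ℝ) :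
    (bestTrajectories n m k r d).card = r :=
  card_nearest _ (by rw [Nat.card_Icc]; omega)

theorem sum_fieldCoef_sq_le (hT : 0 < T) (hk : 0 < k) (hr : 0 < r) (hkm : 2 * k + 2 ≤ m)
    (hrn : r ≤ n - n / 2) (d : ℕ × ℕ → ℝ) :
    ∑ i ∈ Finset.Icc (n / 2 + 1) n, ∑ q ∈ Finset.Icc 1 m, fieldCoef T σ n m k r d i q ^ 2
      ≤ (3 * σ * m / (T * √(r * k ^ 3))) ^ 2 := by
  rw [← Finset.sum_subset (bestTrajectories_subset (m := m) (k := k) hrn d) fun i _ hi => by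
    simp [fieldCoef, hi]]
  have h1 : ∀ i ∈ bestTrajectories n m k r d,
      ∑ q ∈ Finset.Icc 1 m, fieldCoef T σ n m k r d i q ^ 2
        ≤ (σ / r) ^ 2 * ((3 * m / T) ^ 2 / k ^ 3) := by
    intro i hi
    simp only [fieldCoef, if_pos hi, mul_pow]
    rw [← Finset.mul_sum]
    gcongr
    exact sum_diffCoef_sq_le hT hk (bestTime_mem hkm d i)
  refine (Finset.sum_le_card_nsmul _ _ _ h1).trans (le_of_eq ?_)
  rw [card_bestTrajectories hrn, nsmul_eq_mul, div_pow _ (T * _), mul_pow T,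
    Real.sq_sqrt (by positivity)]
  have : (0 : ℝ) < r := by exact_mod_cast hr
  field_simp

/-- The estimated trajectories as points of `ℝ^D`. -/
noncomputable def trajectoryPoint {D : ℕ} (T : ℝ) (n m k₁ k₂ : ℕ) (X : ℕ → Space D)
    (Y : ℕ → ℕ → Space D) (p : ℕ × ℕ) : Space D :=
  flowEst T n m k₁ k₂ X Y (X p.1) (gridTime T m p.2)

theorem fieldNoise_eq_sum {k₁ k₂ : ℕ} (hkm : 2 * k + 2 ≤ m) (hrn : r ≤ n - n / 2)
    (X : ℕ → Space D) (Y ε : ℕ → ℕ → Space D) (x : Space D) :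
    fieldNoise T σ n m k₁ k₂ k r X Y ε x = ∑ i ∈ Finset.Icc (n / 2 + 1) n, ∑ q ∈ Finset.Icc 1 m,
      fieldCoef T σ n m k r (fun p => ‖trajectoryPoint T n m k₁ k₂ X Y p - x‖) i q • ε i q := by
  set d : ℕ × ℕ → ℝ := fun p => ‖trajectoryPoint T n m k₁ k₂ X Y p - x‖ with hd
  have h1 : fieldNoise T σ n m k₁ k₂ k r X Y ε x = (1 / (r : ℝ)) •
      ∑ i ∈ bestTrajectories n m k r d, derivEst T m k (fun i j => σ • ε i j) i (bestTime m k d i) :=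
    rfl
  rw [h1, ← Finset.sum_subset (bestTrajectories_subset (m := m) (k := k) hrn d) fun i _ hi => by
    simp [fieldCoef, hi], Finset.smul_sum]
  refine Finset.sum_congr rfl fun i hi => ?_
  rw [← sum_diffCoef_smul (bestTime_mem hkm d i), Finset.smul_sum]
  refine Finset.sum_congr rfl fun q _ => ?_
  rw [fieldCoef, if_pos hi, smul_smul, smul_smul]
  congr 1
  ring

end Selection

/-! ### Noise of the field estimator, uniformly in the query point. -/

section FieldNoise

variable {D : ℕ} {Ω : Type*} {𝓕 mΩ : MeasurableSpace Ω} {P : Measure Ω} {n m k₁ k₂ k r : ℕ}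
  {T σ : ℝ} {X : ℕ → Ω → Space D} {ε : ℕ → ℕ → Ω → Space D} {μ : Measure (Space D)}

/-- The noise of the estimator of the vector field, uniformly over the state space. -/
theorem exists_bound_fieldNoise {L : ℝ≥0} {M : ℝ} {f : Space D → Space D}
    (hf : f ∈ LipClass D L M) (hs : IsSample P n m μ X ε) (h𝓕 : 𝓕 ≤ mΩ)
    (hXm : ∀ i ∈ Finset.Icc 1 n, Measurable[𝓕] (X i))
    (hεm : ∀ i ∈ Finset.Icc 1 (n / 2), ∀ j ∈ Finset.Icc 1 m, Measurable[𝓕] (ε i j))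
    (hη : iIndepFun (fun (p : Finset.Icc (n / 2 + 1) n × Finset.Icc 1 m) => ε p.1 p.2) P)
    (hind : Indep 𝓕 (MeasurableSpace.comap (fun ω (p : Finset.Icc (n / 2 + 1) n × Finset.Icc 1 m) =>
      ε p.1 p.2 ω) inferInstance) P) (hT : 0 < T) (hσ : 0 < σ) (hk₁n : k₁ ≤ n / 2) (hk₂m : k₂ ≤ m)
    (hk : 0 < k) (hr : 0 < r) (hkm : 2 * k + 2 ≤ m) (hrn : r ≤ n - n / 2) (hnm : 3 ≤ n * m) :
    ∃ g : Ω → ℝ, Measurable g ∧ (∀ ω, 0 ≤ g ω) ∧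
      (∀ ω x, ‖fieldNoise T σ n m k₁ k₂ k r (fun i => X i ω)
        (observation f T σ m (fun i => X i ω) (fun i j => ε i j ω)) (fun i j => ε i j ω) x‖
          ≤ g ω) ∧
      ∫⁻ ω, ENNReal.ofReal (g ω) ∂P
        ≤ ENNReal.ofReal (4 * D * (3 * σ * m / (T * √(r * k ^ 3))) *
            √(Real.log ((((n : ℝ) * m) ^ 2 + 1) ^ (D + 1)))) := by
  classical
  have hhalf : Finset.Icc 1 (n / 2) ⊆ Finset.Icc 1 n := Finset.Icc_subset_Icc le_rfl (by omega)
  have hhalf' : Finset.Icc (n / 2 + 1) n ⊆ Finset.Icc 1 n := Finset.Icc_subset_Icc (by omega) le_rfl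
  set I₀ := trajectoryIndices n m k with hI₀
  have hI₀c : I₀.card ≤ n * m := by
    rw [hI₀, trajectoryIndices, Finset.card_product, Nat.card_Icc, Nat.card_Icc]
    exact Nat.mul_le_mul (by omega) (by omega)
  set q : ℕ × ℕ → Ω → Space D := fun p ω => trajectoryPoint T n m k₁ k₂ (fun i => X i ω)
    (observation f T σ m (fun i => X i ω) (fun i j => ε i j ω)) p with hq
  have hqm : ∀ p ∈ I₀, Measurable[𝓕] (q p) := by
    intro p hp
    refine @measurable_flowEst D Ω 𝓕 n m k₁ k₂ T X
      (fun i j ω => observation f T σ m (fun i => X i ω) (fun i j => ε i j ω) i j) (X p.1)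
      (fun i hi => hXm i (hhalf hi)) (hXm _ (hhalf' (Finset.mem_product.1 hp).1)) ?_ hk₁n hk₂m _
    exact fun i hi j hj => @measurable_observation D Ω 𝓕 m T σ X L M f hf hT ε i j
      (hXm i (hhalf hi)) (hεm i hi j hj)
  have hm0 : (0 : ℝ) < m := by exact_mod_cast (by omega : 0 < m)
  -- A deterministic representative of each comparison pattern turns the coefficients into functions
  -- of the pattern, so that patterns can serve as the candidates of the maximal inequality.
  have hrep : ∀ τ : Finset ((ℕ × ℕ) × (ℕ × ℕ)), ∃ d : ℕ × ℕ → ℝ,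
      (∃ d', comparisons I₀ d' = τ) → comparisons I₀ d = τ := fun τ => by
    by_cases h : ∃ d', comparisons I₀ d' = τ
    · exact ⟨h.choose, fun _ => h.choose_spec⟩
    · exact ⟨0, fun h' => absurd h' h⟩
  choose rep hrep using hrep
  obtain ⟨g, hg, hg0, hgb, hgi⟩ := exists_measurable_bound_of_selected (P := P) (m := 𝓕)
    (η := fun (p : Finset.Icc (n / 2 + 1) n × Finset.Icc 1 m) ω => ε p.1 p.2 ω)
    (α := Finset ((ℕ × ℕ) × (ℕ × ℕ)))
    h𝓕 (fun p => hs.measurable_noise _ (hhalf' p.1.2) _ p.2.2)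
    (fun p => hs.law_noise _ (hhalf' p.1.2) _ p.2.2)
    hη hind (I₀ ×ˢ I₀).powerset
    (fun τ p => fieldCoef T σ n m k r (rep τ) p.1 p.2)
    (s := 3 * σ * m / (T * √(r * k ^ 3))) (K := (((n : ℝ) * m) ^ 2 + 1) ^ (D + 1))
    (by positivity)
    (by
      have h3 : (3 : ℝ) ≤ (n : ℝ) * m := by exact_mod_cast hnm
      have h4 : (3 : ℝ) ≤ ((n : ℝ) * m) ^ 2 + 1 := by nlinarith
      exact h4.trans (le_self_pow₀ (by linarith) (by omega)))
    (by
      intro τ _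
      rw [sum_coe_prod _ _ fun i j => fieldCoef T σ n m k r (rep τ) i j ^ 2]
      exact sum_fieldCoef_sq_le hT hk hr hkm hrn _)
    (fun τ => {ω | ∃ x, comparisons I₀ (fun p => ‖q p ω - x‖) = τ})
    (fun τ _ => @measurableSet_exists_comparisons_norm_sub_eq D Ω _ 𝓕 I₀ q hqm τ)
    (by
      intro ω J _ hJ
      have h1 := card_comparisons_norm_sub_le I₀ (fun p => q p ω) J hJ
      have h2 : (I₀.card ^ 2 + 1) ^ (D + 1) ≤ ((n * m) ^ 2 + 1) ^ (D + 1) := by gcongr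
      exact_mod_cast h1.trans h2)
  refine ⟨g, hg, hg0, fun ω x => ?_, hgi⟩
  set d : ℕ × ℕ → ℝ := fun p => ‖q p ω - x‖ with hd
  have h1 := hgb ω (comparisons I₀ d) (comparisons_mem_powerset _ _) ⟨x, rfl⟩
  have h2 : comparisons I₀ (rep (comparisons I₀ d)) = comparisons I₀ d := hrep _ ⟨d, rfl⟩
  rw [sum_coe_prod _ _ fun i j => fieldCoef T σ n m k r (rep (comparisons I₀ d)) i j • ε i j ω] at h1
  rw [fieldNoise_eq_sum hkm hrn]
  refine le_trans (le_of_eq ?_) h1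
  congr 1
  refine Finset.sum_congr rfl fun i hi => Finset.sum_congr rfl fun j _ => ?_
  rw [fieldCoef_congr hkm h2 hi]

end FieldNoise

/-! ### Independence obtained from sample splitting. -/

section Independence

variable {D : ℕ} {Ω : Type*} {mΩ : MeasurableSpace Ω} {P : Measure Ω} {n m : ℕ}
  {X : ℕ → Ω → Space D} {ε : ℕ → ℕ → Ω → Space D} {μ : Measure (Space D)}

/-- The joint law is a triple product, and product measures reassociate. -/
theorem IndepFun.prodMk_left_of_indepFun {α β γ : Type*} [MeasurableSpace α] [MeasurableSpace β]
    [MeasurableSpace γ] [IsProbabilityMeasure P] {U : Ω → α} {V : Ω → β} {W : Ω → γ}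
    (hU : Measurable U) (hV : Measurable V) (hW : Measurable W)
    (h : IndepFun U (fun ω => (V ω, W ω)) P) (h' : IndepFun V W P) :
    IndepFun (fun ω => (U ω, V ω)) W P := by
  have hU' := Measure.isProbabilityMeasure_map (μ := P) hU.aemeasurable
  have hV' := Measure.isProbabilityMeasure_map (μ := P) hV.aemeasurable
  have hW' := Measure.isProbabilityMeasure_map (μ := P) hW.aemeasurable
  rw [indepFun_iff_map_prod_eq_prod_map_map (hU.prodMk hV).aemeasurable hW.aemeasurable]
  have h1 := (indepFun_iff_map_prod_eq_prod_map_map hU.aemeasurable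
    (hV.prodMk hW).aemeasurable).1 h
  have h2 := (indepFun_iff_map_prod_eq_prod_map_map hV.aemeasurable hW.aemeasurable).1 h'
  have h3 := (indepFun_iff_map_prod_eq_prod_map_map hU.aemeasurable hV.aemeasurable).1
    (h.comp measurable_id measurable_fst)
  have h4 : P.map (fun ω => (U ω, V ω)) = (P.map U).prod (P.map V) := h3
  rw [h4]
  have h5 : P.map (fun ω => ((U ω, V ω), W ω))
      = (P.map fun ω => (U ω, (V ω, W ω))).map MeasurableEquiv.prodAssoc.symm := by
    rw [Measure.map_map (MeasurableEquiv.measurable _) (hU.prodMk (hV.prodMk hW))]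
    rfl
  rw [h5, h1, h2, ← Measure.prodAssoc_prod, MeasurableEquiv.map_symm_map]

/-- The σ-algebra is generated by all initial values and the noise of the first half. It determines
the estimated trajectories, and hence the selection, but is independent of the noise that the
selected derivative estimates average. -/
theorem IsSample.exists_measurableSpace [IsProbabilityMeasure P] (hs : IsSample P n m μ X ε) :
    ∃ 𝓕 ≤ mΩ, (∀ i ∈ Finset.Icc 1 n, Measurable[𝓕] (X i)) ∧
      (∀ i ∈ Finset.Icc 1 (n / 2), ∀ j ∈ Finset.Icc 1 m, Measurable[𝓕] (ε i j)) ∧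
      Indep 𝓕 (MeasurableSpace.comap (fun ω (p : Finset.Icc (n / 2 + 1) n × Finset.Icc 1 m) =>
        ε p.1 p.2 ω) inferInstance) P := by
  classical
  have hηm : ∀ p : Finset.Icc 1 n × Finset.Icc 1 m, Measurable (ε p.1 p.2) :=
    fun p => hs.measurable_noise _ p.1.2 _ p.2.2
  set S : Finset (Finset.Icc 1 n × Finset.Icc 1 m) :=
    Finset.univ.filter fun p => (p.1 : ℕ) ≤ n / 2 with hS
  set S' : Finset (Finset.Icc 1 n × Finset.Icc 1 m) :=
    Finset.univ.filter fun p => ¬ (p.1 : ℕ) ≤ n / 2 with hS'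
  set U : Ω → (Finset.Icc 1 n → Space D) := fun ω i => X i ω with hU
  set V : Ω → (S → Space D) := fun ω p => ε p.1.1 p.1.2 ω with hV
  set W : Ω → (S' → Space D) := fun ω p => ε p.1.1 p.1.2 ω with hW
  have hUm : Measurable U := measurable_pi_lambda _ fun i => hs.measurable_X _ i.2
  have hVm : Measurable V := measurable_pi_lambda _ fun p => hηm p.1
  have hWm : Measurable W := measurable_pi_lambda _ fun p => hηm p.1
  have h1 : IndepFun V W P :=
    hs.indep_noise.indepFun_finset S S' (Finset.disjoint_filter_filter_not _ _ _) hηm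
  have h2 : IndepFun U (fun ω => (V ω, W ω)) P :=
    hs.indep_X_noise.comp (φ := id) (ψ := fun u : (Finset.Icc 1 n × Finset.Icc 1 m) → Space D =>
      ((fun p : S => u p), (fun p : S' => u p))) measurable_id (by fun_prop)
  have h3 := IndepFun.prodMk_left_of_indepFun hUm hVm hWm h2 h1
  have hmem : ∀ p : Finset.Icc (n / 2 + 1) n × Finset.Icc 1 m,
      (p.1 : ℕ) ∈ Finset.Icc 1 n := fun p => Finset.Icc_subset_Icc (by omega) le_rfl p.1.2
  have hmem' : ∀ p : Finset.Icc (n / 2 + 1) n × Finset.Icc 1 m,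
      ((⟨p.1, hmem p⟩, p.2) : Finset.Icc 1 n × Finset.Icc 1 m) ∈ S' := fun p => by
    have := (Finset.mem_Icc.1 p.1.2).1
    simp only [hS', Finset.mem_filter, Finset.mem_univ, true_and]
    omega
  have h4 : IndepFun (fun ω => (U ω, V ω))
      (fun ω (p : Finset.Icc (n / 2 + 1) n × Finset.Icc 1 m) => ε p.1 p.2 ω) P := by
    exact h3.comp (φ := id) (ψ := fun (u : S' → Space D) p => u ⟨_, hmem' p⟩) measurable_id
      (measurable_pi_lambda _ fun p => measurable_pi_apply _)
  refine ⟨MeasurableSpace.comap (fun ω => (U ω, V ω)) inferInstance, (hUm.prodMk hVm).comap_le,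
    fun i hi => ?_, fun i hi j hj => ?_, (IndepFun_iff_Indep _ _ _).1 h4⟩
  · exact ((measurable_pi_apply (⟨i, hi⟩ : Finset.Icc 1 n)).comp measurable_fst).comp
      (comap_measurable (fun ω => (U ω, V ω)))
  · have hi' := Finset.mem_Icc.1 hi
    have hp : ((⟨i, Finset.mem_Icc.2 (by omega)⟩, ⟨j, hj⟩) :
        Finset.Icc 1 n × Finset.Icc 1 m) ∈ S := by
      simp only [hS, Finset.mem_filter, Finset.mem_univ, true_and]
      exact hi'.2
    exact ((measurable_pi_apply (⟨_, hp⟩ : S)).comp measurable_snd).comp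
      (comap_measurable (fun ω => (U ω, V ω)))

theorem IsSample.iIndepFun_noise_second_half (hs : IsSample P n m μ X ε) :
    iIndepFun (fun (p : Finset.Icc (n / 2 + 1) n × Finset.Icc 1 m) => ε p.1 p.2) P := by
  have hmem : ∀ p : Finset.Icc (n / 2 + 1) n × Finset.Icc 1 m,
      (p.1 : ℕ) ∈ Finset.Icc 1 n := fun p => Finset.Icc_subset_Icc (by omega) le_rfl p.1.2
  refine hs.indep_noise.precomp (g := fun p : Finset.Icc (n / 2 + 1) n × Finset.Icc 1 m =>
    ((⟨p.1, hmem p⟩, p.2) : Finset.Icc 1 n × Finset.Icc 1 m)) ?_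
  intro p p' h
  simp only [Prod.mk.injEq, Subtype.mk.injEq] at h
  exact Prod.ext (Subtype.ext h.1) h.2

/-- The noise of the estimator of the vector field of a sample, uniformly over the state space. -/
theorem IsSample.exists_bound_fieldNoise [IsProbabilityMeasure P] {L : ℝ≥0} {M T σ : ℝ}
    {f : Space D → Space D} {k₁ k₂ k r : ℕ} (hf : f ∈ LipClass D L M) (hs : IsSample P n m μ X ε)
    (hT : 0 < T) (hσ : 0 < σ) (hk₁n : k₁ ≤ n / 2) (hk₂m : k₂ ≤ m)
    (hk : 0 < k) (hr : 0 < r) (hkm : 2 * k + 2 ≤ m) (hrn : r ≤ n - n / 2) (hnm : 3 ≤ n * m) :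
    ∃ g : Ω → ℝ, Measurable g ∧ (∀ ω, 0 ≤ g ω) ∧
      (∀ ω x, ‖fieldNoise T σ n m k₁ k₂ k r (fun i => X i ω)
        (observation f T σ m (fun i => X i ω) (fun i j => ε i j ω)) (fun i j => ε i j ω) x‖
          ≤ g ω) ∧
      ∫⁻ ω, ENNReal.ofReal (g ω) ∂P
        ≤ ENNReal.ofReal (4 * D * (3 * σ * m / (T * √(r * k ^ 3))) *
            √(Real.log ((((n : ℝ) * m) ^ 2 + 1) ^ (D + 1)))) := by
  obtain ⟨𝓕, h𝓕, hXm, hεm, hind⟩ := hs.exists_measurableSpace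
  exact VFEst.exists_bound_fieldNoise hf hs h𝓕 hXm hεm hs.iIndepFun_noise_second_half hind hT hσ hk₁n
    hk₂m hk hr hkm hrn hnm

end Independence

/-! ### Orders of magnitude of the calibrated terms. -/

section Rates

theorem exists_exp_eq {x : ℝ} (hx : 0 < x) : ∃ y, x = Real.exp y :=
  ⟨Real.log x, (Real.exp_log hx).symm⟩

variable {b n m u w : ℝ}

/-- Here and in the next identities `u` and `w` stand for `log n` and `log (n m)`. Written in
exponentials, each identity of monomials is a linear identity between exponents. -/
theorem kRate_eq (hb : 0 < b) (hn : 0 < n) (hm : 0 < m) (hu : 0 < u) (hw : 0 < w) :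
    m ^ ((b + 4) / (b + 5)) * ((w * u) / n) ^ (1 / (b + 5)) / m
      = (u * w / (n * m)) ^ (1 / (b + 5)) := by
  obtain ⟨α, rfl⟩ := exists_exp_eq hn
  obtain ⟨β, rfl⟩ := exists_exp_eq hm
  obtain ⟨u, rfl⟩ := exists_exp_eq hu
  obtain ⟨w, rfl⟩ := exists_exp_eq hw
  simp only [← Real.exp_add, ← Real.exp_sub, ← Real.exp_mul]
  congr 1
  field_simp
  ring

theorem k₂Rate_eq (hb : 0 < b) (hn : 0 < n) (hm : 0 < m) (hu : 0 < u) (hw : 0 < w) :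
    m ^ ((b + 2) / (b + 3)) / (n / (u * w)) ^ (1 / (b + 3)) / m
      = (u * w / (n * m)) ^ (1 / (b + 3)) := by
  obtain ⟨α, rfl⟩ := exists_exp_eq hn
  obtain ⟨β, rfl⟩ := exists_exp_eq hm
  obtain ⟨u, rfl⟩ := exists_exp_eq hu
  obtain ⟨w, rfl⟩ := exists_exp_eq hw
  simp only [← Real.exp_add, ← Real.exp_sub, ← Real.exp_mul]
  congr 1
  field_simp
  ring

theorem k₁Rate_eq (hb : 0 < b) (hn : 0 < n) (hm : 0 < m) (hu : 0 < u) (hw : 0 < w) :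
    u * ((n / u) ^ (3 / (b + 3)) / (m / w) ^ (b / (b + 3))) / n
      = (u * w / (n * m)) ^ (b / (b + 3)) := by
  obtain ⟨α, rfl⟩ := exists_exp_eq hn
  obtain ⟨β, rfl⟩ := exists_exp_eq hm
  obtain ⟨u, rfl⟩ := exists_exp_eq hu
  obtain ⟨w, rfl⟩ := exists_exp_eq hw
  simp only [← Real.exp_add, ← Real.exp_sub, ← Real.exp_mul]
  congr 1
  field_simp
  ring

theorem rRate_eq (hb : 0 < b) (hn : 0 < n) (hm : 0 < m) (hu : 0 < u) (hw : 0 < w) :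
    u * ((n / u) ^ (5 / (b + 5)) * (w / m) ^ (b / (b + 5))) / n
      = (u * w / (n * m)) ^ (b / (b + 5)) := by
  obtain ⟨α, rfl⟩ := exists_exp_eq hn
  obtain ⟨β, rfl⟩ := exists_exp_eq hm
  obtain ⟨u, rfl⟩ := exists_exp_eq hu
  obtain ⟨w, rfl⟩ := exists_exp_eq hw
  simp only [← Real.exp_add, ← Real.exp_sub, ← Real.exp_mul]
  congr 1
  field_simp
  ring

theorem flowNoiseRate_eq (hb : 0 < b) (hn : 0 < n) (hm : 0 < m) (hu : 0 < u) (hw : 0 < w) :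
    w / (((n / u) ^ (3 / (b + 3)) / (m / w) ^ (b / (b + 3))) *
      (m ^ ((b + 2) / (b + 3)) / (n / (u * w)) ^ (1 / (b + 3))))
      = ((u * w / (n * m)) ^ (1 / (b + 3))) ^ 2 := by
  obtain ⟨α, rfl⟩ := exists_exp_eq hn
  obtain ⟨β, rfl⟩ := exists_exp_eq hm
  obtain ⟨u, rfl⟩ := exists_exp_eq hu
  obtain ⟨w, rfl⟩ := exists_exp_eq hw
  simp only [← Real.exp_add, ← Real.exp_sub, ← Real.exp_mul, ← Real.exp_nat_mul]
  congr 1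
  field_simp
  push_cast
  ring

theorem fieldNoiseRate_eq (hb : 0 < b) (hn : 0 < n) (hm : 0 < m) (hu : 0 < u) (hw : 0 < w) :
    m ^ 2 * w / (((n / u) ^ (5 / (b + 5)) * (w / m) ^ (b / (b + 5))) *
      (m ^ ((b + 4) / (b + 5)) * ((w * u) / n) ^ (1 / (b + 5))) ^ 3)
      = ((u * w / (n * m)) ^ (1 / (b + 5))) ^ 2 := by
  obtain ⟨α, rfl⟩ := exists_exp_eq hn
  obtain ⟨β, rfl⟩ := exists_exp_eq hm
  obtain ⟨u, rfl⟩ := exists_exp_eq hu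
  obtain ⟨w, rfl⟩ := exists_exp_eq hw
  simp only [← Real.exp_add, ← Real.exp_sub, ← Real.exp_mul, ← Real.exp_nat_mul]
  congr 1
  field_simp
  push_cast
  ring

/-- `log n / n`, `log² (n m) / (n m)` and `1 / m` are small for large `n` and `m`. -/
theorem exists_nat_log_small {δ : ℝ} (hδ : 0 < δ) :
    ∃ N : ℕ, ∀ n m : ℕ, N ≤ n → N ≤ m → 1 ≤ Real.log n ∧ 3 ≤ n ∧ 3 ≤ m ∧
      Real.log n / n ≤ δ ∧ Real.log (n * m) ^ 2 / (n * m) ≤ δ ∧ 1 / (m : ℝ) ≤ δ := by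
  have h1 : ∀ᶠ x : ℝ in Filter.atTop, Real.log x ^ 1 / (1 * x + 0) < δ :=
    (Real.tendsto_pow_log_div_mul_add_atTop 1 0 1 one_ne_zero).eventually (gt_mem_nhds hδ)
  have h2 : ∀ᶠ x : ℝ in Filter.atTop, Real.log x ^ 2 / (1 * x + 0) < δ :=
    (Real.tendsto_pow_log_div_mul_add_atTop 1 0 2 one_ne_zero).eventually (gt_mem_nhds hδ)
  have h3 : ∀ᶠ x : ℝ in Filter.atTop, 1 ≤ Real.log x :=
    Real.tendsto_log_atTop.eventually_ge_atTop 1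
  obtain ⟨A, hA⟩ := Filter.eventually_atTop.1 ((h1.and h2).and
    (h3.and (Filter.eventually_ge_atTop (1 / δ))))
  refine ⟨max ⌈A⌉₊ 3, fun n m hn hm => ?_⟩
  have hn3 : 3 ≤ n := (le_max_right _ _).trans hn
  have hm3 : 3 ≤ m := (le_max_right _ _).trans hm
  have hnA : A ≤ n := (Nat.le_ceil A).trans (by exact_mod_cast (le_max_left _ _).trans hn)
  have hmA : A ≤ m := (Nat.le_ceil A).trans (by exact_mod_cast (le_max_left _ _).trans hm)
  have hm1 : (1 : ℝ) ≤ m := by exact_mod_cast (by omega : 1 ≤ m)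
  have hn0 : (0 : ℝ) ≤ n := Nat.cast_nonneg n
  have hnmA : A ≤ (n : ℝ) * m := hnA.trans (le_mul_of_one_le_right hn0 hm1)
  refine ⟨(hA _ hnA).2.1, hn3, hm3, ?_, ?_, ?_⟩
  · simpa using (hA _ hnA).1.1.le
  · simpa using (hA _ hnmA).1.2.le
  · rw [one_div_le (by linarith) hδ]; exact (hA _ hmA).2.2

/-- Bounds for the calibration parameters in terms of the rate of convergence. -/
theorem exists_nat_calibration {b c c' η : ℝ} (hb : 0 < b) (hc : 0 < c) (hc' : 1 ≤ c') (hη : 0 < η)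
    (hη1 : η ≤ 1) :
    ∃ N : ℕ, ∀ n m : ℕ, N ≤ n → N ≤ m → ∀ k₁ k₂ k r : ℕ,
      IsOfOrder c c' k₁ (k₁Order b n m) → IsOfOrder c c' k₂ (k₂Order b n m) →
      IsOfOrder c c' k (kOrder b n m) → IsOfOrder c c' r (rOrder b n m) →
      (3 ≤ n ∧ 3 ≤ m ∧ 0 < k₁ ∧ 0 < k₂ ∧ 0 < k ∧ 0 < r) ∧
      ((k₂ : ℝ) / m ≤ c' * η ∧ (k₂ : ℝ) / m ≤ c' * supRate b n m) ∧
      ((k : ℝ) / m ≤ c' * η ∧ (k : ℝ) / m ≤ c' * supRate b n m) ∧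
      ((k₁ + Real.log n) / n ≤ 2 * c' * η ∧
        (((k₁ + Real.log n) / n) / (2 * c')) ^ (1 / b) ≤ supRate b n m) ∧
      ((r + Real.log n) / n ≤ 2 * c' * η ∧
        (((r + Real.log n) / n) / (2 * c')) ^ (1 / b) ≤ supRate b n m) ∧
      √(Real.log (n * m)) / √(k₁ * k₂) ≤ supRate b n m / c ∧
      m * √(Real.log (n * m)) / √(r * k ^ 3) ≤ supRate b n m / c ^ 2 ∧
      (n : ℝ) ^ (-(1 / b)) ≤ supRate b n m := by
  -- A lower bound for the four exponents `1/(b+5)`, `1/(b+3)`, `b/(b+5)`, `b/(b+3)` of `x` below: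
  -- since `x ≤ 1`, smallness of `x ^ e₀` makes all the calibrated ratios small.
  set e₀ := min 1 b / (b + 5) with he₀
  have he₀0 : 0 < e₀ := by positivity
  obtain ⟨N, hN⟩ := exists_nat_log_small (δ := min η (η ^ (1 / e₀))) (by positivity)
  refine ⟨N, fun n m hn hm k₁ k₂ k r hk₁ hk₂ hk hr => ?_⟩
  obtain ⟨hu1, hn3, hm3, hlog, hlog2, hm1⟩ := hN n m hn hm
  have hn0 : (0 : ℝ) < n := by exact_mod_cast (by omega : 0 < n)
  have hm0 : (0 : ℝ) < m := by exact_mod_cast (by omega : 0 < m)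
  set u := Real.log n with hu
  set w := Real.log (n * m) with hw
  have huw : u ≤ w := by
    refine Real.log_le_log hn0 (le_mul_of_one_le_right hn0.le ?_)
    exact_mod_cast (by omega : 1 ≤ m)
  have hu0 : 0 < u := by linarith
  have hw0 : 0 < w := by linarith
  set x := u * w / (n * m) with hx
  set y := w ^ 2 / (n * m) with hy
  have hx0 : 0 < x := by positivity
  have hxy : x ≤ y := by rw [hx, hy, sq]; gcongr
  have hyη : y ≤ η ^ (1 / e₀) := hlog2.trans (min_le_right _ _)
  have hη' : η ^ (1 / e₀) ≤ 1 := Real.rpow_le_one hη.le hη1 (by positivity)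
  have hx1 : x ≤ 1 := hxy.trans (hyη.trans hη')
  have hsmall : ∀ e, e₀ ≤ e → x ^ e ≤ η := fun e he => by
    calc x ^ e ≤ x ^ e₀ := Real.rpow_le_rpow_of_exponent_ge hx0 hx1 he
      _ ≤ (η ^ (1 / e₀)) ^ e₀ := by gcongr; exact hxy.trans hyη
      _ = η := by rw [← Real.rpow_mul hη.le, one_div_mul_cancel he₀0.ne', Real.rpow_one]
  set R := supRate b n m with hR
  have hRy : y ^ (1 / (b + 5)) ≤ R := by
    rw [hR, supRate, add_comm b 5]; exact le_max_of_le_left (le_max_left _ _)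
  have hRx5 : x ^ (1 / (b + 5)) ≤ R := le_trans (by gcongr) hRy
  have hRx3 : x ^ (1 / (b + 3)) ≤ R :=
    (Real.rpow_le_rpow_of_exponent_ge hx0 hx1 (by gcongr; norm_num)).trans hRx5
  have hRn : (u / n) ^ (1 / b) ≤ R := by
    rw [hR, supRate]; exact le_max_of_le_left (le_max_right _ _)
  have hRm : 1 / (m : ℝ) ≤ R := by rw [hR, supRate]; exact le_max_right _ _
  have hun : u / n ≤ η := hlog.trans (min_le_left _ _)
  have hmη : 1 / (m : ℝ) ≤ η := hm1.trans (min_le_left _ _)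
  have e1 : e₀ ≤ 1 / (b + 5) := by rw [he₀]; gcongr; exact min_le_left _ _
  have e2 : e₀ ≤ 1 / (b + 3) := e1.trans (by gcongr; norm_num)
  have e3 : e₀ ≤ b / (b + 5) := by rw [he₀]; gcongr; exact min_le_right _ _
  have e4 : e₀ ≤ b / (b + 3) := e3.trans (by gcongr; norm_num)
  set X₁ := ((n : ℝ) / u) ^ (3 / (b + 3)) / ((m : ℝ) / w) ^ (b / (b + 3)) with hX₁
  set X₂ := (m : ℝ) ^ ((b + 2) / (b + 3)) / ((n : ℝ) / (u * w)) ^ (1 / (b + 3)) with hX₂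
  set X₃ := (m : ℝ) ^ ((b + 4) / (b + 5)) * ((w * u) / n) ^ (1 / (b + 5)) with hX₃
  set X₄ := ((n : ℝ) / u) ^ (5 / (b + 5)) * (w / m) ^ (b / (b + 5)) with hX₄
  have hX₁0 : 0 < X₁ := by positivity
  have hX₂0 : 0 < X₂ := by positivity
  have hX₃0 : 0 < X₃ := by positivity
  have hX₄0 : 0 < X₄ := by positivity
  have o1 : k₁Order b n m = max X₁ 1 := rfl
  have o2 : k₂Order b n m = max X₂ 1 := rfl
  have o3 : kOrder b n m = max X₃ 1 := rfl
  have o4 : rOrder b n m = max X₄ 1 := by rw [rOrder, mul_comm (m : ℝ) n]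
  rw [o1] at hk₁; rw [o2] at hk₂; rw [o3] at hk; rw [o4] at hr
  have hpos : ∀ {q : ℕ} {X : ℝ}, IsOfOrder c c' q (max X 1) → 0 < q := fun {q X} h => by
    have : (0 : ℝ) < q := lt_of_lt_of_le (by positivity) h.1
    exact_mod_cast this
  have hlow : ∀ {q : ℕ} {X : ℝ}, IsOfOrder c c' q (max X 1) → c * X ≤ q := fun h =>
    le_trans (by gcongr; exact le_max_left _ _) h.1
  have hdiv : ∀ {q : ℕ} {X B : ℝ}, IsOfOrder c c' q (max X 1) → X / m ≤ B → 1 / (m : ℝ) ≤ B →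
      (q : ℝ) / m ≤ c' * B := fun {q X B} h h1 h2 => by
    calc (q : ℝ) / m ≤ c' * max X 1 / m := by gcongr; exact h.2
      _ = c' * max (X / m) (1 / m) := by rw [mul_div_assoc, max_div_div_right hm0.le]
      _ ≤ c' * B := by gcongr; exact max_le h1 h2
  have hadd : ∀ {q : ℕ} {X B : ℝ}, IsOfOrder c c' q (max X 1) → u * X / n ≤ B → u / n ≤ B →
      (q + u) / n ≤ 2 * c' * B := fun {q X B} h h1 h2 => by
    have h3 : (1 : ℝ) ≤ max X 1 := le_max_right _ _
    have h4 : (q : ℝ) + u ≤ 2 * c' * (u * max X 1) := by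
      -- As `log n ≥ 1`, the sum `q + log n` may be replaced by a product, to which the exact rate
      -- identities apply.
      have h5 : (q : ℝ) ≤ c' * (u * max X 1) := by
        refine h.2.trans ?_
        gcongr
        nlinarith
      have h6 : u ≤ c' * (u * max X 1) := by
        calc u = 1 * (u * 1) := by ring
          _ ≤ _ := by gcongr
      linarith
    calc (q + u) / n ≤ 2 * c' * (u * max X 1) / n := by gcongr
      _ = 2 * c' * max (u * X / n) (u / n) := by
          rw [mul_div_assoc, max_div_div_right hn0.le, mul_max_of_nonneg _ _ hu0.le, mul_one]
      _ ≤ _ := by gcongr; exact max_le h1 h2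
  have hR0 : 0 < R := lt_of_lt_of_le (by positivity) hRm
  have hRb : (R ^ b) ^ (1 / b) = R := by
    rw [← Real.rpow_mul hR0.le, mul_one_div_cancel hb.ne', Real.rpow_one]
  have hunR : u / n ≤ R ^ b := by
    calc u / n = ((u / n) ^ (1 / b)) ^ b := by
          rw [← Real.rpow_mul (by positivity), one_div_mul_cancel hb.ne', Real.rpow_one]
      _ ≤ _ := by gcongr
  have hroot : ∀ {q : ℕ}, ((q : ℝ) + u) / n ≤ 2 * c' * R ^ b →
      (((q + u) / n) / (2 * c')) ^ (1 / b) ≤ R := fun {q} h => by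
    calc (((q + u) / n) / (2 * c')) ^ (1 / b) ≤ (R ^ b) ^ (1 / b) := by
          gcongr
          rw [div_le_iff₀ (by positivity), mul_comm]
          exact h
      _ = R := hRb
  have hpow : ∀ e, x ^ (1 / e) ≤ R → x ^ (b / e) ≤ R ^ b := fun e he => by
    calc x ^ (b / e) = (x ^ (1 / e)) ^ b := by
          rw [← Real.rpow_mul hx0.le]; congr 1; ring
      _ ≤ R ^ b := by gcongr
  have r3 : X₃ / m = x ^ (1 / (b + 5)) := kRate_eq hb hn0 hm0 hu0 hw0
  have r2 : X₂ / m = x ^ (1 / (b + 3)) := k₂Rate_eq hb hn0 hm0 hu0 hw0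
  have r1 : u * X₁ / n = x ^ (b / (b + 3)) := k₁Rate_eq hb hn0 hm0 hu0 hw0
  have r4 : u * X₄ / n = x ^ (b / (b + 5)) := rRate_eq hb hn0 hm0 hu0 hw0
  have r5 : w / (X₁ * X₂) = (x ^ (1 / (b + 3))) ^ 2 := flowNoiseRate_eq hb hn0 hm0 hu0 hw0
  have r6 : (m : ℝ) ^ 2 * w / (X₄ * X₃ ^ 3) = (x ^ (1 / (b + 5))) ^ 2 :=
    fieldNoiseRate_eq hb hn0 hm0 hu0 hw0
  have hk₁0 := hpos hk₁
  have hk₂0 := hpos hk₂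
  have hk0 := hpos hk
  have hr0 := hpos hr
  refine ⟨⟨hn3, hm3, hk₁0, hk₂0, hk0, hr0⟩,
    ⟨hdiv hk₂ (r2.trans_le (hsmall _ e2)) hmη, hdiv hk₂ (r2.trans_le hRx3) hRm⟩,
    ⟨hdiv hk (r3.trans_le (hsmall _ e1)) hmη, hdiv hk (r3.trans_le hRx5) hRm⟩,
    ⟨hadd hk₁ (r1.trans_le (hsmall _ e4)) hun,
      hroot (hadd hk₁ (r1.trans_le (hpow _ hRx3)) hunR)⟩,
    ⟨hadd hr (r4.trans_le (hsmall _ e3)) hun,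
      hroot (hadd hr (r4.trans_le (hpow _ hRx5)) hunR)⟩, ?_, ?_, ?_⟩
  · have h1 : (c * X₁) * (c * X₂) ≤ k₁ * k₂ := mul_le_mul (hlow hk₁) (hlow hk₂) (by positivity)
      (by positivity)
    rw [← Real.sqrt_div hw0.le, Real.sqrt_le_left (by positivity)]
    calc w / (k₁ * k₂) ≤ w / ((c * X₁) * (c * X₂)) := by gcongr
      _ = w / (X₁ * X₂) / c ^ 2 := by field_simp
      _ = (x ^ (1 / (b + 3)) / c) ^ 2 := by rw [r5, div_pow]
      _ ≤ _ := by gcongr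
  · have h1 : (c * X₄) * (c * X₃) ^ 3 ≤ r * k ^ 3 := mul_le_mul (hlow hr)
      (pow_le_pow_left₀ (by positivity) (hlow hk) 3) (by positivity) (by positivity)
    have h2 : (m : ℝ) * √w / √(r * k ^ 3) = √((m : ℝ) ^ 2 * w / (r * k ^ 3)) := by
      rw [Real.sqrt_div (by positivity), Real.sqrt_mul (sq_nonneg (m : ℝ)) w, Real.sqrt_sq hm0.le]
    rw [h2, Real.sqrt_le_left (by positivity)]
    calc (m : ℝ) ^ 2 * w / (r * k ^ 3) ≤ (m : ℝ) ^ 2 * w / ((c * X₄) * (c * X₃) ^ 3) := by gcongr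
      _ = (m : ℝ) ^ 2 * w / (X₄ * X₃ ^ 3) / (c ^ 2) ^ 2 := by field_simp
      _ = (x ^ (1 / (b + 5)) / c ^ 2) ^ 2 := by rw [r6, div_pow]
      _ ≤ _ := by gcongr
  · refine le_trans ?_ hRn
    rw [Real.rpow_neg hn0.le, ← Real.inv_rpow hn0.le, inv_eq_one_div]
    gcongr

end Rates

/-! ### From the pathwise bounds to the risk. -/

section Risk

/-- Majorants in `upperExpectation` must hold everywhere; setting the majorant to `⊤` on a
measurable null set repairs the exceptions at no cost. -/
theorem upperExpectation_le_lintegral_of_ae_le {Ω : Type*} [MeasurableSpace Ω] {P : Measure Ω}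
    {h g : Ω → ℝ≥0∞} (hg : Measurable g) (hle : ∀ᵐ ω ∂P, h ω ≤ g ω) :
    upperExpectation P h ≤ ∫⁻ ω, g ω ∂P := by
  set N := toMeasurable P {ω | ¬ h ω ≤ g ω} with hN
  have hN0 : P N = 0 := by rw [hN, measure_toMeasurable]; exact hle
  have hNm : MeasurableSet N := measurableSet_toMeasurable _ _
  have hm : Measurable fun ω => N.indicator (fun _ => (⊤ : ℝ≥0∞)) ω + g ω :=
    (measurable_const.indicator hNm).add hg
  have hh : ∀ ω, h ω ≤ N.indicator (fun _ => (⊤ : ℝ≥0∞)) ω + g ω := fun ω => by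
    by_cases h' : h ω ≤ g ω
    · exact h'.trans le_add_self
    · have : ω ∈ N := subset_toMeasurable P _ h'
      simp [this]
  have key : upperExpectation P h ≤ ∫⁻ ω, N.indicator (fun _ => (⊤ : ℝ≥0∞)) ω + g ω ∂P :=
    iInf_le_of_le _ (iInf_le_of_le hm (iInf_le_of_le hh le_rfl))
  refine key.trans ?_
  rw [lintegral_add_left (measurable_const.indicator hNm), lintegral_indicator hNm]
  simp [hN0]

theorem log_sq_add_one_pow_le {z : ℝ} (hz : 3 ≤ z) (D : ℕ) :
    Real.log ((z ^ 2 + 1) ^ (D + 1)) ≤ 3 * (D + 1) * Real.log z := by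
  have h4 : z ^ 2 + 1 ≤ z ^ 3 := by nlinarith
  rw [Real.log_pow]
  push_cast
  calc ((D : ℝ) + 1) * Real.log (z ^ 2 + 1) ≤ (D + 1) * Real.log (z ^ 3) := by gcongr
    _ = _ := by rw [Real.log_pow]; push_cast; ring

theorem card_filter_univ_coe (s : Finset ℕ) (p : ℕ → Prop) [DecidablePred p] :
    (Finset.univ.filter fun i : s => p i).card = (s.filter p).card := by
  rw [← Finset.card_map (Function.Embedding.subtype _)]
  congr 1
  ext i
  simp [and_comm]

variable {D : ℕ} {Ω : Type*} [MeasurableSpace Ω] {P : Measure Ω} {n m k₁ k₂ k r : ℕ}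
  {a b T σ : ℝ} {X : ℕ → Ω → Space D} {ε : ℕ → ℕ → Ω → Space D} {μ : Measure (Space D)}

/-- Needed because neighbour distances are controlled only from points of the support, and the flow
is estimated from the random points `X i`. -/
theorem IsSample.ae_mem_support (hs : IsSample P n m μ X ε) :
    ∀ᵐ ω ∂P, ∀ i ∈ Finset.Icc 1 n, X i ω ∈ μ.support := by
  rw [Finset.eventually_all]
  intro i hi
  have h : ∀ᵐ x ∂(P.map (X i)), x ∈ μ.support := by
    rw [hs.law_X i hi]
    exact Measure.support_mem_ae
  exact ae_of_ae_map (hs.measurable_X i hi).aemeasurable h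

open Classical in
/-- With high probability, each point of the support has `q` points of a subsample nearby. -/
theorem IsSample.exists_measurableSet_card_filter_le (hs : IsSample P n m μ X ε) (ha : 0 < a)
    (hb : 0 < b) (hμ : μ ∈ StandardClass D a b) {s : Finset ℕ} (hsn : s ⊆ Finset.Icc 1 n)
    (hn : 1 ≤ n) (hcard : n ≤ 3 * s.card) {q : ℕ} (hq : 1 ≤ q)
    (hp1 : 6 * (1 + 1 / b) * (q + Real.log n) / n ≤ 1) :
    ∃ E : Set Ω, MeasurableSet E ∧ P E ≤ ENNReal.ofReal (3 ^ b * (n : ℝ) ^ (-(1 / b))) ∧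
      ∀ ω ∉ E, ∀ x ∈ μ.support, q ≤ (s.filter fun i => ‖X i ω - x‖ ≤
        2 * ((6 * (1 + 1 / b) * (q + Real.log n) / n) / a) ^ (1 / b)).card := by
  have hind : iIndepFun (fun i : s => X i) P :=
    hs.indep_X.precomp (g := fun i : s => (⟨i, hsn i.2⟩ : Finset.Icc 1 n)) fun i j h =>
      Subtype.ext (congrArg (fun z : Finset.Icc 1 n => (z : ℕ)) h)
  obtain ⟨E, hE, hPE, h⟩ := exists_measurableSet_card_filter_dist_le (P := P)
    (X := fun i : s => X i) ha hb (fun i => hs.measurable_X _ (hsn i.2))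
    (fun i => hs.law_X _ (hsn i.2)) hind hμ hn hq (by
      rw [Fintype.card_coe, div_le_iff₀ (by norm_num), mul_comm]
      exact_mod_cast hcard) rfl hp1
  refine ⟨E, hE, hPE, fun ω hω x hx => (h ω hω x hx).trans_eq ?_⟩
  exact card_filter_univ_coe s fun i => ‖X i ω - x‖ ≤ _

/-- A bound for the risk in terms of the sample sizes and the calibration parameters. -/
theorem upperExpectation_supError_le [IsProbabilityMeasure P] {L : ℝ≥0} {M : ℝ}
    {f : Space D → Space D}
    (hf : f ∈ LipClass D L M) (hμ : μ ∈ StandardClass D a b) (hs : IsSample P n m μ X ε)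
    (ha : 0 < a) (hb : 0 < b) (hT : 0 < T) (hσ : 0 < σ) (hn : 3 ≤ n) (hm : 3 ≤ m)
    (hk₁ : 0 < k₁) (hk₂ : 0 < k₂) (hk : 0 < k) (hr : 0 < r) (hk₂m : k₂ ≤ m) (hkm : 2 * k + 2 ≤ m)
    {ρ₁ ρ₂ : ℝ}
    (hp₁ : 6 * (1 + 1 / b) * (k₁ + Real.log n) / n ≤ 1)
    (hp₂ : 6 * (1 + 1 / b) * (r + Real.log n) / n ≤ 1)
    (hρ₁ : ρ₁ = 2 * ((6 * (1 + 1 / b) * (k₁ + Real.log n) / n) / a) ^ (1 / b))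
    (hρ₂ : ρ₂ = 2 * ((6 * (1 + 1 / b) * (r + Real.log n) / n) / a) ^ (1 / b)) :
    upperExpectation P (fun ω => supError f
        (fieldEst T n m k₁ k₂ k r (fun i => X i ω)
          (observation f T σ m (fun i => X i ω) (fun i j => ε i j ω))) μ.support T)
      ≤ ENNReal.ofReal (4 * D * (3 * σ * m / (T * √(r * k ^ 3))) *
            √(Real.log ((((n : ℝ) * m) ^ 2 + 1) ^ (D + 1)))
          + (L * M * (k * (T / m)) + L * (2 * (Real.exp (L * T) * ρ₁ + M * (k₂ * (T / m)))
            + (Real.exp (L * T) * ρ₂ + M * ((k + 2) * (T / m)))))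
          + 2 * L * (4 * D * (σ / √(k₁ * k₂)) * √(Real.log (n * m)))
          + 2 * M * (2 * (3 ^ b * (n : ℝ) ^ (-(1 / b))))) := by
  classical
  have hM := LipClass.nonneg hf
  have hlog : 0 ≤ Real.log n := Real.log_natCast_nonneg n
  have hn0 : (0 : ℝ) < n := by exact_mod_cast (by omega : 0 < n)
  have hm0 : (0 : ℝ) < m := by exact_mod_cast (by omega : 0 < m)
  have hsmall : ∀ {q : ℕ}, 6 * (1 + 1 / b) * (q + Real.log n) / n ≤ 1 → 6 * q ≤ n := by
    intro q h
    rw [div_le_one hn0] at h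
    have h1 : 0 < 1 / b := by positivity
    have h2 : (0 : ℝ) ≤ q := Nat.cast_nonneg q
    have : 6 * (q : ℝ) ≤ n := by nlinarith
    exact_mod_cast this
  have hk₁n := hsmall hp₁
  have hrn := hsmall hp₂
  have hnm : 3 ≤ n * m := by nlinarith
  obtain ⟨E₁, hE₁, hPE₁, hnear₁⟩ := hs.exists_measurableSet_card_filter_le ha hb hμ
    (s := Finset.Icc 1 (n / 2)) (Finset.Icc_subset_Icc le_rfl (by omega)) (by omega)
    (by rw [Nat.card_Icc]; omega) hk₁ hp₁
  obtain ⟨E₂, hE₂, hPE₂, hnear₂⟩ := hs.exists_measurableSet_card_filter_le ha hb hμ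
    (s := Finset.Icc (n / 2 + 1) n) (Finset.Icc_subset_Icc (by omega) le_rfl) (by omega)
    (by rw [Nat.card_Icc]; omega) hr hp₂
  rw [← hρ₁] at hnear₁
  rw [← hρ₂] at hnear₂
  obtain ⟨g₁, hg₁, hg₁0, hg₁b, hg₁i⟩ := exists_bound_flowEst_noise (T := T) (σ := σ) (k₁ := k₁)
    (k₂ := k₂) hs ((measurable_pi_lambda _ fun i : Finset.Icc 1 n =>
      hs.measurable_X i i.2).comap_le) (fun i hi => (measurable_pi_apply
        (⟨i, hi⟩ : Finset.Icc 1 n)).comp (comap_measurable fun ω (i : Finset.Icc 1 n) => X i ω))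
    ((IndepFun_iff_Indep _ _ _).1 hs.indep_X_noise) hσ hk₁ hk₂ (by omega) hk₂m hnm
  obtain ⟨g₂, hg₂, hg₂0, hg₂b, hg₂i⟩ := hs.exists_bound_fieldNoise (k₁ := k₁)
    (k₂ := k₂) (k := k) (r := r) hf hT hσ (by omega) hk₂m hk hr hkm (by omega) hnm
  have hρ₁0 : 0 ≤ ρ₁ := by rw [hρ₁]; positivity
  have hρ₂0 : 0 ≤ ρ₂ := by rw [hρ₂]; positivity
  set B := L * M * (k * (T / m)) + L * (2 * (Real.exp (L * T) * ρ₁ + M * (k₂ * (T / m)))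
    + (Real.exp (L * T) * ρ₂ + M * ((k + 2) * (T / m)))) with hB
  have hB0 : 0 ≤ B := by positivity
  have hB1 : L * M * (k * (T / m)) ≤ B := le_add_of_nonneg_right (by positivity)
  -- The noise bound `g₂` holds for every outcome, so the exceptional events add only this bounded
  -- term.
  set V : Ω → ℝ := fun ω => (E₁ ∪ E₂).indicator (fun _ => 2 * M) ω with hV
  have hV0 : ∀ ω, 0 ≤ V ω := fun ω => Set.indicator_nonneg (fun _ _ => by positivity) ω
  have hVm : Measurable V := measurable_const.indicator (hE₁.union hE₂)
  have hVi : ∫⁻ ω, ENNReal.ofReal (V ω) ∂P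
      ≤ ENNReal.ofReal (2 * M * (2 * (3 ^ b * (n : ℝ) ^ (-(1 / b))))) := by
    have h1 : ∀ ω, ENNReal.ofReal (V ω)
        = (E₁ ∪ E₂).indicator (fun _ => ENNReal.ofReal (2 * M)) ω := fun ω => by
      by_cases h : ω ∈ E₁ ∪ E₂
      · simp only [hV, Set.indicator_of_mem h]
      · simp only [hV, Set.indicator_of_notMem h, ENNReal.ofReal_zero]
    simp_rw [h1]
    rw [lintegral_indicator_const (hE₁.union hE₂), ENNReal.ofReal_mul (p := 2 * M) (by positivity),
      two_mul (3 ^ b * _),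
      ENNReal.ofReal_add (by positivity) (by positivity)]
    gcongr
    exact (measure_union_le _ _).trans (add_le_add hPE₁ hPE₂)
  have hG : Measurable fun ω => ENNReal.ofReal (g₂ ω) + ENNReal.ofReal B
      + ENNReal.ofReal (2 * L) * ENNReal.ofReal (g₁ ω) + ENNReal.ofReal (V ω) := by fun_prop
  refine (upperExpectation_le_lintegral_of_ae_le hG ?_).trans ?_
  · filter_upwards [hs.ae_mem_support] with ω hω
    refine iSup₂_le fun x hx => ?_
    rw [← ofReal_norm, ← ENNReal.ofReal_mul (by positivity),
      ← ENNReal.ofReal_add (hg₂0 ω) hB0,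
      ← ENNReal.ofReal_add (add_nonneg (hg₂0 ω) hB0) (mul_nonneg (by positivity) (hg₁0 ω)),
      ← ENNReal.ofReal_add (add_nonneg (add_nonneg (hg₂0 ω) hB0)
        (mul_nonneg (by positivity) (hg₁0 ω))) (hV0 ω)]
    refine ENNReal.ofReal_le_ofReal ?_
    have hg := hg₂b ω x
    have hg₁' : 0 ≤ 2 * L * g₁ ω := mul_nonneg (by positivity) (hg₁0 ω)
    by_cases hE : ω ∈ E₁ ∪ E₂
    · have h1 := norm_fieldEst_sub_le_of_bounded (k₁ := k₁) (k₂ := k₂) (σ := σ)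
        (X := fun i => X i ω) (ε := fun i j => ε i j ω) hf hT hk hr hkm
        (show r ≤ n - n / 2 by omega) x
      have h2 : V ω = 2 * M := by simp only [hV, Set.indicator_of_mem hE]
      linarith
    · have hE' := not_or.1 hE
      have h1 := norm_fieldEst_sub_le_of_near (σ := σ)
        (X := fun i => X i ω) (ε := fun i j => ε i j ω) hf hT hk₁ hk₂ hk₂m hk hr hkm
        (S := μ.support) (fun i hi => hω i (Finset.Icc_subset_Icc (by omega) le_rfl hi))
        (hnear₁ ω hE'.1) (hnear₂ ω hE'.2) (hg₁b ω) hx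
      have h2 := hV0 ω
      have h3 : L * M * (k * (T / m)) + L * (2 * (g₁ ω + (Real.exp (L * T) * ρ₁
          + M * (k₂ * (T / m)))) + (Real.exp (L * T) * ρ₂ + M * ((k + 2) * (T / m))))
          = B + 2 * L * g₁ ω := by rw [hB]; ring
      rw [h3] at h1
      linarith
  · clear_value B
    rw [lintegral_add_right _ hVm.ennreal_ofReal,
      lintegral_add_right _ (hg₁.ennreal_ofReal.const_mul _),
      lintegral_add_right _ measurable_const, lintegral_const_mul _ hg₁.ennreal_ofReal,
      lintegral_const, measure_univ, mul_one,
      ENNReal.ofReal_add (by positivity) (by positivity),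
      ENNReal.ofReal_add (by positivity) (by positivity),
      ENNReal.ofReal_add (by positivity) hB0, ENNReal.ofReal_mul (p := 2 * (L : ℝ)) (by positivity)]
    gcongr

end Risk

end VFEst

/-! ### Choice of the constants and conclusion. -/

theorem theorem3 (D : ℕ) (L : ℝ≥0) (M a b T σ c c' : ℝ)
    (ha : 0 < a) (hb : 0 < b) (hbD : b ≤ (D : ℝ) - 1) (hT : 0 < T) (hσ : 0 < σ) (hc : 0 < c) :
    ∃ C : ℝ, 0 < C ∧ ∃ N : ℕ, ∀ n m : ℕ, N ≤ n → N ≤ m →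
      ∀ k₁ k₂ k r : ℕ,
        IsOfOrder c c' k₁ (k₁Order b n m) → IsOfOrder c c' k₂ (k₂Order b n m) →
        IsOfOrder c c' k (kOrder b n m) → IsOfOrder c c' r (rOrder b n m) →
      ∀ f ∈ LipClass D L M, ∀ μ ∈ StandardClass D a b,
      ∀ (Ω : Type*) [MeasurableSpace Ω] (P : Measure Ω) [IsProbabilityMeasure P]
        (X : ℕ → Ω → Space D) (ε : ℕ → ℕ → Ω → Space D), IsSample P n m μ X ε →
        upperExpectation P (fun ω =>
          supError f
            (fieldEst T n m k₁ k₂ k r (fun i => X i ω)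
              (observation f T σ m (fun i => X i ω) (fun i j => ε i j ω)))
            μ.support T)
          ≤ ENNReal.ofReal (C * supRate b n m) := by
  set c₁ := max c' 1 with hc₁
  have hc₁1 : 1 ≤ c₁ := le_max_right _ _
  set θ := 1 + 1 / b with hθ
  have hθ1 : 1 < θ := by rw [hθ]; linarith [show 0 < 1 / b by positivity]
  set κ := (12 * θ * c₁ / a) ^ (1 / b) with hκ
  have hκ0 : 0 < κ := by positivity
  set e := Real.exp (L * T) with he
  set C₀ := 4 * D * (3 * σ / T * √(3 * (D + 1)) / c ^ 2)
    + (L * M * (T * c₁) + L * (2 * (e * (2 * κ) + M * (T * c₁)) + (e * (2 * κ) + M * (3 * T * c₁))))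
    + 2 * L * (4 * D * (σ / c)) + 2 * M * (2 * 3 ^ b) with hC₀
  -- Chosen so that `6 θ * (2 c₁ η) = 1`, which keeps the ball masses of the neighbour bounds at
  -- most one; it also gives `k / m ≤ 1 / 12`, hence `2 k + 2 ≤ m`.
  set η := 1 / (12 * θ * c₁) with hη
  have hη0 : 0 < η := by positivity
  have hcη : c₁ * η = 1 / (12 * θ) := by rw [hη]; field_simp
  have hcη' : c₁ * η ≤ 1 / 12 := by rw [hcη]; gcongr; linarith
  have hη1 : η ≤ 1 := by nlinarith
  obtain ⟨N, hN⟩ := exists_nat_calibration hb hc hc₁1 hη0 hη1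
  refine ⟨|C₀| + 1, by positivity, N, ?_⟩
  intro n m hn hm k₁ k₂ k r h₁ h₂ h₃ h₄ f hf μ hμ Ω _ P _ X ε hs
  have hM := LipClass.nonneg hf
  have hup : ∀ {q : ℕ} {v : ℝ}, IsOfOrder c c' q (max v 1) → IsOfOrder c c₁ q (max v 1) :=
    fun h => ⟨h.1, h.2.trans (by gcongr; exact le_max_left _ _)⟩
  obtain ⟨⟨hn3, hm3, hk₁, hk₂, hk, hr⟩, ⟨hk₂η, hk₂R⟩, ⟨hkη, hkR⟩, ⟨hk₁η, hk₁R⟩, ⟨hrη, hrR⟩, hN₁, hN₂,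
    hnb⟩ := hN n m hn hm k₁ k₂ k r (hup h₁) (hup h₂) (hup h₃) (hup h₄)
  set R := supRate b n m with hR
  have hn0 : (0 : ℝ) < n := by exact_mod_cast (by omega : 0 < n)
  have hm0 : (0 : ℝ) < m := by exact_mod_cast (by omega : 0 < m)
  have hR0 : 0 < R := lt_of_lt_of_le (by positivity) hnb
  have hlog : 0 ≤ Real.log n := Real.log_natCast_nonneg n
  have hp : ∀ {q : ℕ}, ((q : ℝ) + Real.log n) / n ≤ 2 * c₁ * η →
      6 * θ * (q + Real.log n) / n ≤ 1 := fun {q} h => by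
    calc 6 * θ * (q + Real.log n) / n = 6 * θ * ((q + Real.log n) / n) := by ring
      _ ≤ 6 * θ * (2 * c₁ * η) := by gcongr
      _ = 12 * θ * (c₁ * η) := by ring
      _ = 1 := by rw [hcη]; field_simp
  have hρ : ∀ {q : ℕ}, (((q + Real.log n) / n) / (2 * c₁)) ^ (1 / b) ≤ R →
      2 * ((6 * θ * (q + Real.log n) / n) / a) ^ (1 / b) ≤ 2 * κ * R := fun {q} h => by
    have h1 : (6 * θ * (q + Real.log n) / n) / a
        = 12 * θ * c₁ / a * (((q + Real.log n) / n) / (2 * c₁)) := by field_simp; ring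
    rw [h1, Real.mul_rpow (by positivity) (by positivity), mul_assoc 2 κ R]
    gcongr
  have hk₂m : k₂ ≤ m := by
    have : (k₂ : ℝ) / m ≤ 1 := by linarith
    rw [div_le_one hm0] at this
    exact_mod_cast this
  have hkm : 2 * k + 2 ≤ m := by
    have : (k : ℝ) / m ≤ 1 / 12 := by linarith
    rw [div_le_iff₀ hm0] at this
    have : (12 * k : ℝ) ≤ m := by linarith
    have : 12 * k ≤ m := by exact_mod_cast this
    omega
  obtain ⟨ρ₁, hρ₁⟩ : ∃ ρ, ρ = 2 * ((6 * θ * (k₁ + Real.log n) / n) / a) ^ (1 / b) := ⟨_, rfl⟩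
  obtain ⟨ρ₂, hρ₂⟩ : ∃ ρ, ρ = 2 * ((6 * θ * (r + Real.log n) / n) / a) ^ (1 / b) := ⟨_, rfl⟩
  have hmain := upperExpectation_supError_le hf hμ hs ha hb hT hσ hn3 hm3 hk₁ hk₂ hk hr hk₂m hkm
    (hp hk₁η) (hp hrη) hρ₁ hρ₂
  refine hmain.trans (ENNReal.ofReal_le_ofReal ?_)
  replace hρ₁ : ρ₁ ≤ 2 * κ * R := hρ₁.trans_le (hρ hk₁R)
  replace hρ₂ : ρ₂ ≤ 2 * κ * R := hρ₂.trans_le (hρ hrR)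
  have hkT : (k : ℝ) * (T / m) ≤ T * c₁ * R := by
    calc (k : ℝ) * (T / m) = T * (k / m) := by ring
      _ ≤ T * (c₁ * R) := by gcongr
      _ = _ := by ring
  have hkT' : ((k : ℝ) + 2) * (T / m) ≤ 3 * T * c₁ * R := by
    have hk1 : (1 : ℝ) ≤ k := by exact_mod_cast hk
    calc ((k : ℝ) + 2) * (T / m) ≤ (3 * k) * (T / m) := by gcongr; linarith
      _ = 3 * (k * (T / m)) := by ring
      _ ≤ 3 * (T * c₁ * R) := by gcongr
      _ = _ := by ring
  have hk₂T : (k₂ : ℝ) * (T / m) ≤ T * c₁ * R := by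
    calc (k₂ : ℝ) * (T / m) = T * (k₂ / m) := by ring
      _ ≤ T * (c₁ * R) := by gcongr
      _ = _ := by ring
  have hflow : σ / √(k₁ * k₂) * √(Real.log (n * m)) ≤ σ / c * R := by
    calc _ = σ * (√(Real.log (n * m)) / √(k₁ * k₂)) := by ring
      _ ≤ σ * (R / c) := by gcongr
      _ = _ := by ring
  have hlogK : Real.log ((((n : ℝ) * m) ^ 2 + 1) ^ (D + 1)) ≤ 3 * (D + 1) * Real.log (n * m) := by
    refine log_sq_add_one_pow_le ?_ D
    exact_mod_cast hn3.trans (Nat.le_mul_of_pos_right n (by omega))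
  have hfield : 3 * σ * m / (T * √(r * k ^ 3)) *
      √(Real.log ((((n : ℝ) * m) ^ 2 + 1) ^ (D + 1)))
      ≤ 3 * σ / T * √(3 * (D + 1)) / c ^ 2 * R := by
    calc _ ≤ 3 * σ * m / (T * √(r * k ^ 3)) * (√(3 * (D + 1)) * √(Real.log (n * m))) := by
          rw [← Real.sqrt_mul (by positivity)]
          gcongr
      _ = 3 * σ / T * √(3 * (D + 1)) * (m * √(Real.log (n * m)) / √(r * k ^ 3)) := by
          field_simp
      _ ≤ 3 * σ / T * √(3 * (D + 1)) * (R / c ^ 2) := by gcongr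
      _ = _ := by ring
  rw [← he]
  have he0 : 0 ≤ e := (Real.exp_pos _).le
  have t₁ : 4 * D * (3 * σ * m / (T * √(r * k ^ 3))) *
      √(Real.log ((((n : ℝ) * m) ^ 2 + 1) ^ (D + 1)))
      ≤ 4 * D * (3 * σ / T * √(3 * (D + 1)) / c ^ 2 * R) := by
    rw [mul_assoc (4 * (D : ℝ))]
    exact mul_le_mul_of_nonneg_left hfield (by positivity)
  have t₂ : 4 * D * (σ / √(k₁ * k₂)) * √(Real.log (n * m)) ≤ 4 * D * (σ / c * R) := by
    rw [mul_assoc (4 * (D : ℝ))]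
    exact mul_le_mul_of_nonneg_left hflow (by positivity)
  have t₃ : e * ρ₁ + M * (k₂ * (T / m)) ≤ e * (2 * κ * R) + M * (T * c₁ * R) :=
    add_le_add (mul_le_mul_of_nonneg_left hρ₁ he0) (mul_le_mul_of_nonneg_left hk₂T hM)
  have t₄ : e * ρ₂ + M * ((k + 2) * (T / m)) ≤ e * (2 * κ * R) + M * (3 * T * c₁ * R) :=
    add_le_add (mul_le_mul_of_nonneg_left hρ₂ he0) (mul_le_mul_of_nonneg_left hkT' hM)
  have hL : (0 : ℝ) ≤ L := L.2
  have t₅ : L * M * (k * (T / m)) ≤ L * M * (T * c₁ * R) :=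
    mul_le_mul_of_nonneg_left hkT (by positivity)
  have t₆ : (3 : ℝ) ^ b * (n : ℝ) ^ (-(1 / b)) ≤ 3 ^ b * R :=
    mul_le_mul_of_nonneg_left hnb (by positivity)
  have t₇ : L * (2 * (e * ρ₁ + M * (k₂ * (T / m))) + (e * ρ₂ + M * ((k + 2) * (T / m))))
      ≤ L * (2 * (e * (2 * κ * R) + M * (T * c₁ * R)) + (e * (2 * κ * R) + M * (3 * T * c₁ * R))) :=
    mul_le_mul_of_nonneg_left (add_le_add (mul_le_mul_of_nonneg_left t₃ zero_le_two) t₄) hL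
  have hLM : (0 : ℝ) ≤ 2 * M := mul_nonneg zero_le_two hM
  refine (add_le_add (add_le_add (add_le_add t₁ (add_le_add t₅ t₇))
    (mul_le_mul_of_nonneg_left t₂ (mul_nonneg zero_le_two hL))) (mul_le_mul_of_nonneg_left
      (mul_le_mul_of_nonneg_left t₆ zero_le_two) hLM)).trans ?_
  have hC : C₀ * R ≤ (|C₀| + 1) * R :=
    mul_le_mul_of_nonneg_right ((le_abs_self C₀).trans (le_add_of_nonneg_right zero_le_one)) hR0.le
  refine le_trans (le_of_eq ?_) hC
  rw [hC₀]
  ring
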